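/- **Setting.** Let $d\ge 1$, let $\Omega^{(x)}=\mathbb R^d/\Lambda$ be a periodic domain ($\Lambda$ a full lattice of periods) and let $\Omega^{(v)}=\mathbb R^d$, $\omega(v)=e^{-\|v\|^2/2}$. Let $\mathcal T_h^{(x)}$ be a finite periodic mesh of $\Omega^{(x)}$ with bounded convex polyhedral elements, and $\mathcal T_h^{(v)}$ a locally finite mesh of $\mathbb R^d$ with closed convex polyhedral elements (for instance simplices; hanging nodes are allowed). The set of faces $\mathcal F_h$ consists of the $(d-1)$-dimensional intersections $e$ of two neighbouring elements $T^-,T^+$, each with a fixed unit normal $n^{(e)}$ pointing from $T^-$ to $T^+$. Write $U_e^\pm$ for the traces from $T^\pm$, $\{U\}_e=\frac12(U_e^++U_e^-)$, $[U]_e=U_e^--U_e^+$. $\mathcal V^{(x)}_{h,p}$ is the space of piecewise polynomials of degree $\le p$ on $\mathcal T_h^{(x)}$, and $\mathcal V^{(v)}_{h,q}$ is the space of piecewise polynomials $V$ of degree $\le q$ on $\mathcal T_h^{(v)}$ for which $(1+\|v\|^2)^{1/2}V$, the broken gradient of $V$ and the traces of $V$ on the faces are square integrable with weight $\omega$ (no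 restriction if $\mathcal T^{(v)}_h$ is finite). Inner products are $(X,Y)_x=\int_{\Omega^{(x)}}XY\,dx$, $(V,W)_v=\int VW\,dv$, $(V,W)_{v,\omega}=\int VW\omega\,dv$, and the discrete derivatives are $$(\hat{\mathrm d}_{y_s}U,W)_y=\sum_{T}\int_T\partial_{y_s}U\,W\,dy-\sum_{e}\int_e n_s^{(e)}[U]_e\{W\}_e\,dS .$$ **Scheme.** Fix $\tau>0$ and $m\ge 1+d$ functions $U_1,\dots,U_m\in\mathcal V^{(v)}_{h,q}$ whose span contains $1$ and $v_1,\dots,v_d$. At time $n$ the state is $$f^n=\omega\sum_{ij}S^n_{ij}X^n_i\otimes V^n_j,\qquad X^n_i\in\mathcal V^{(x)}_{h,p},\quad V^n_j\in\mathcal V^{(v)}_{h,q},$$ with $(X_i^n)$ $L_2$-orthonormal, $(V_j^n)$ orthonormal in $(\cdot,\cdot)_{v,\omega}$ and $V^n_a=U_a$ for $a\le m$; the numbers of basis functions may depend on $n$. Put $$\rho^n=\int f^n\,dv,\qquad j^n_s=\int v_sf^n\,dv,\qquad \sigma^n_{s}=\Big(\int v_sv_{s'}f^n\,dv\Big)_{s'=1,\dots,d}.$$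 The electric field is the exact one: $E^n=-\nabla\Phi^n$, where $\Phi^n$ is a periodic weak ($H^1$) solution of $-\Delta\Phi^n=1-\rho^n$. One time step of the rank-adaptive unconventional integrator consists of the following. 1. K-step (explicit Euler, central flux): with $K^n_j=\sum_iX^n_iS^n_{ij}$, $\mathsf A^{(s)}_{ij}=(v_sV_j^n,V_i^n)_{v,\omega}$, $\mathsf B^{(s)}_{ij}=(\hat{\mathrm d}_{v_s}(\omega V_j^n),V_i^n)_v$, the functions $K_j^{n+1}\in\mathcal V^{(x)}_{h,p}$ satisfy, for all vectors $\psi$ of functions of $\mathcal V^{(x)}_{h,p}$, $$\tfrac1\tau(K^{n+1}-K^n,\psi)_x+\sum_T\sum_s\int_T\big[-(\mathsf A^{(s)}K^n)\cdot\partial_{x_s}\psi-E^n_s(\mathsf B^{(s)}K^n)\cdot\psi\big]dx+\sum_e\int_e\Big(\sum_sn^{(e)}_s\mathsf A^{(s)}\{K^n\}_e\Big)\cdot[\psi]_e\,dS=0 .$$ 2. L-step: it returns functions $L_p^{n+1}\in\mathcal V_{h,q}^{(v)}$ (nothing else about them is used; the result holds for arbitrary ones). 3. Augmentation: $(\tilde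 X_k)$ is an $L_2$-orthonormal system in $\mathcal V^{(x)}_{h,p}$ whose span contains all $X_i^n,K_j^{n+1}$; $(\tilde V_\ell)$ is a $(\cdot,\cdot)_{v,\omega}$-orthonormal system in $\mathcal V^{(v)}_{h,q}$ with $\tilde V_a=U_a$ for $a\le m$ whose span contains all $V_j^n,L_p^{n+1}$. 4. S-step: with $\tilde S^n_{k\ell}=\sum_{ij}(\tilde X_k,X_i^n)_xS^n_{ij}(\tilde V_\ell,V_j^n)_{v,\omega}$, $$\tilde S^{n+1}_{k\ell}=\tilde S^n_{k\ell}-\tau\sum_{ijs}\Big[(\hat{\mathrm d}_{x_s}X_i^n,\tilde X_k)_xS^n_{ij}(\tilde V_\ell,v_sV_j^n)_{v,\omega}+(\tilde X_k,-E^n_sX^n_i)_xS^n_{ij}(\hat{\mathrm d}_{v_s}(\omega V_j^n),\tilde V_\ell)_v\Big].$$ 5. Conservative truncation: $f^{n+1}=\omega\sum_{ij}S^{n+1}_{ij}X^{n+1}_i\otimes V^{n+1}_j$ is any state of the above form such that $\sum_iS^{n+1}_{ia}X^{n+1}_i=\sum_k\tilde S^{n+1}_{ka}\tilde X_k$ for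 $a\le m$ and $V^{n+1}_j\in\operatorname{span}\{\tilde V_\ell:\ell>m\}$ for $j>m$. **Theorem.** For every run $n=0,1,2,\dots$ of this scheme and all $s=1,\dots,d$: (i) $j^n_s\in\mathcal V^{(x)}_{h,p}$, and for all $\psi\in\mathcal V^{(x)}_{h,p}$ $$\frac1\tau(j_s^{n+1}-j_s^n,\psi)_x+\sum_{T\in\mathcal T_h^{(x)}}\int_T-\sigma^n_s\cdot\nabla\psi+E^n_s\rho^n\psi\,dx+\sum_{e\in\mathcal F_h^{(x)}}\int_e\big(n^{(e)}\cdot\{\sigma^n_s\}_e\big)[\psi]_e\,dS=0,$$ that is, the $j_s^n$ satisfy the central-flux explicit-Euler DG discretization of $\partial_tj_s+\nabla\cdot\sigma_s=-E_s\rho$; (ii) $\int_{\Omega^{(x)}}E^n_s(1-\rho^n)\,dx=0$; (iii) the total momentum is conserved: $\int_{\Omega^{(x)}}j^n_s\,dx=\int_{\Omega^{(x)}}j^0_s\,dx$. -/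

import Mathlib

open MeasureTheory
open scoped ContDiff

noncomputable section

/-- Closed convex polyhedra: finite intersections of closed half-spaces (simplices, boxes,
unbounded polyhedral cells, ...). -/
def IsPolyhedron {d : ℕ} (P : Set (EuclideanSpace ℝ (Fin d))) : Prop :=
  ∃ H : Finset (EuclideanSpace ℝ (Fin d) × ℝ), P = {x | ∀ h ∈ H, inner ℝ h.1 x ≤ h.2}

/-- A (not necessarily conforming) polyhedral mesh of the domain `ℝ^d / Λ`, where `Λ` is a group of
periods: a full lattice for a periodic domain, and `⊥` for the whole space `ℝ^d`.
`cell T` is a representative in `ℝ^d` of the element `T`; the elements and their translates by `Λ`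
tile `ℝ^d`.  The faces are the `(d-1)`-dimensional intersections of two neighbouring (translated)
elements, each listed once up to translation and up to the choice of the direction of its
unit normal.  For a face `e`, the element `T⁻` is `cell (minus e)`, the element `T⁺` is
`shift e + cell (plus e)`, and `normal e` points from `T⁻` to `T⁺`. -/
structure DGMesh {d : ℕ} (Λ : Submodule ℤ (EuclideanSpace ℝ (Fin d))) where
  Cell : Type
  cell : Cell → Set (EuclideanSpace ℝ (Fin d))
  isPolyhedron_cell : ∀ T, IsPolyhedron (cell T)
  nonempty_interior : ∀ T, (interior (cell T)).Nonempty
  cover : ∀ x, ∃ T, ∃ l ∈ Λ, x - l ∈ cell T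
  disjoint_interior : ∀ T T', ∀ l ∈ Λ, (T ≠ T' ∨ l ≠ 0) →
    ∀ x, x ∈ interior (cell T) → x - l ∉ interior (cell T')
  locallyFinite : ∀ K : Set (EuclideanSpace ℝ (Fin d)), IsCompact K →
    {Tl : Cell × EuclideanSpace ℝ (Fin d) |
      Tl.2 ∈ Λ ∧ ∃ x ∈ K, x - Tl.2 ∈ cell Tl.1}.Finite
  Face : Type
  minus : Face → Cell
  plus : Face → Cell
  shift : Face → EuclideanSpace ℝ (Fin d)
  normal : Face → EuclideanSpace ℝ (Fin d)
  shift_mem : ∀ e, shift e ∈ Λ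
  norm_normal : ∀ e, ‖normal e‖ = 1
  /-- the normal points from `T⁻` to `T⁺` -/
  normal_direction : ∀ e x y, x ∈ cell (minus e) → y - shift e ∈ cell (plus e) →
    inner ℝ (normal e) x ≤ inner ℝ (normal e) y
  /-- a face lies between two different elements of the tiling of `ℝ^d` -/
  face_ne : ∀ e, minus e ≠ plus e ∨ shift e ≠ 0
  face_nonempty : ∀ e, {x | x ∈ cell (minus e) ∧ x - shift e ∈ cell (plus e)}.Nonempty
  /-- a face has dimension `d - 1` -/
  face_dim : ∀ e, Module.finrank ℝ
    (vectorSpan ℝ {x | x ∈ cell (minus e) ∧ x - shift e ∈ cell (plus e)}) + 1 = d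
  /-- every `(d-1)`-dimensional intersection of two elements is listed exactly once,
  up to translation and orientation -/
  face_complete : ∀ T T', ∀ l ∈ Λ, (T ≠ T' ∨ l ≠ 0) →
    {x | x ∈ cell T ∧ x - l ∈ cell T'}.Nonempty →
    Module.finrank ℝ (vectorSpan ℝ {x | x ∈ cell T ∧ x - l ∈ cell T'}) + 1 = d →
    ∃! e, (minus e = T ∧ plus e = T' ∧ shift e = l) ∨
      (minus e = T' ∧ plus e = T ∧ shift e = -l)

/-- The partial derivative `∂_s g`. -/
def partialDeriv {d : ℕ} (s : Fin d) (g : EuclideanSpace ℝ (Fin d) → ℝ)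
    (x : EuclideanSpace ℝ (Fin d)) : ℝ :=
  fderiv ℝ g x (EuclideanSpace.single s 1)

namespace DGMesh

variable {d : ℕ} {Λ : Submodule ℤ (EuclideanSpace ℝ (Fin d))} (M : DGMesh Λ)

/-- The set `T⁻ ∩ T⁺` for a face. -/
def face (e : M.Face) : Set (EuclideanSpace ℝ (Fin d)) :=
  {x | x ∈ M.cell (M.minus e) ∧ x - M.shift e ∈ M.cell (M.plus e)}

/-- Broken (element-wise) functions on the domain: on the element `T` the function is `U T`
(only the values on `cell T` matter). -/
abbrev Broken : Type := M.Cell → EuclideanSpace ℝ (Fin d) → ℝ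

/-- Piecewise polynomial functions of degree at most `p`; the function on `T` is represented by its
(unique) polynomial extension to `ℝ^d`. -/
def IsPiecewisePoly (p : ℕ) (U : M.Broken) : Prop :=
  ∀ T, ∃ P : MvPolynomial (Fin d) ℝ, P.totalDegree ≤ p ∧
    ∀ x, U T x = MvPolynomial.eval (fun i => x i) P

/-- `∑_T ∫_T g dy` -/
def cellSum (g : M.Broken) : ℝ := ∑' T, ∫ x in M.cell T, g T x

/-- `∑_e ∫_e g dS`, with the `(d-1)`-dimensional surface measure -/
def faceSum (g : M.Face → EuclideanSpace ℝ (Fin d) → ℝ) : ℝ :=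
  ∑' e, ∫ x in M.face e, g e x ∂(μHE[d - 1])

/-- the trace `U_e⁻` -/
def traceMinus (U : M.Broken) (e : M.Face) (x : EuclideanSpace ℝ (Fin d)) : ℝ :=
  U (M.minus e) x

/-- the trace `U_e⁺` (of the periodic extension) -/
def tracePlus (U : M.Broken) (e : M.Face) (x : EuclideanSpace ℝ (Fin d)) : ℝ :=
  U (M.plus e) (x - M.shift e)

/-- the average `{U}_e = (U_e⁺ + U_e⁻) / 2` -/
def avg (U : M.Broken) (e : M.Face) (x : EuclideanSpace ℝ (Fin d)) : ℝ :=
  (1 / 2) * (M.tracePlus U e x + M.traceMinus U e x)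

/-- the jump `[U]_e = U_e⁻ - U_e⁺` -/
def jump (U : M.Broken) (e : M.Face) (x : EuclideanSpace ℝ (Fin d)) : ℝ :=
  M.traceMinus U e x - M.tracePlus U e x

/-- The `L₂` inner product `(U, W)`. -/
def ip (U W : M.Broken) : ℝ := M.cellSum fun T x => U T x * W T x

/-- Orthonormality with respect to a bilinear form on broken functions. -/
def OrthonormalFor {ι : Type} (b : M.Broken → M.Broken → ℝ) (φ : ι → M.Broken) : Prop :=
  (∀ i, b (φ i) (φ i) = 1) ∧ ∀ i j, i ≠ j → b (φ i) (φ j) = 0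

/-- The discrete partial derivative
`(d̂_s U, W) = ∑_T ∫_T ∂_s U W dy - ∑_e ∫_e n_s [U]_e {W}_e dS`. -/
def dhat (s : Fin d) (U W : M.Broken) : ℝ :=
  M.cellSum (fun T x => partialDeriv s (U T) x * W T x)
    - M.faceSum fun e x => M.normal e s * M.jump U e x * M.avg W e x

/-- `F` is the exact electric field of the density `ρ` on the periodic domain:
`F = -∇Φ` with `-ΔΦ = 1 - ρ`, where `Φ` is a periodic `H¹` function and both equations are
understood weakly, that is, tested with all smooth periodic functions. -/
def IsElectricField (ρ : M.Broken)
    (F : EuclideanSpace ℝ (Fin d) → EuclideanSpace ℝ (Fin d)) : Prop :=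
  (∀ l ∈ Λ, ∀ x, F (x + l) = F x) ∧
  (∀ T, MemLp F 2 (volume.restrict (M.cell T))) ∧
  ∃ Φ : EuclideanSpace ℝ (Fin d) → ℝ,
    (∀ l ∈ Λ, ∀ x, Φ (x + l) = Φ x) ∧
    (∀ T, MemLp Φ 2 (volume.restrict (M.cell T))) ∧
    ∀ φ : EuclideanSpace ℝ (Fin d) → ℝ, ContDiff ℝ ∞ φ → (∀ l ∈ Λ, ∀ x, φ (x + l) = φ x) →
      (∀ s, M.cellSum (fun _ x => Φ x * partialDeriv s φ x)
        = -M.cellSum (fun _ x => (-F x s) * φ x)) ∧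
      M.cellSum (fun _ x => ∑ s, (-F x s) * partialDeriv s φ x)
        = M.cellSum (fun T x => (1 - ρ T x) * φ x)

end DGMesh

/-- The Gaussian weight `ω(v) = exp(-‖v‖²/2)`. -/
def gaussWeight {d : ℕ} (v : EuclideanSpace ℝ (Fin d)) : ℝ := Real.exp (-‖v‖ ^ 2 / 2)

namespace DGMesh

variable {d : ℕ} (M : DGMesh (⊥ : Submodule ℤ (EuclideanSpace ℝ (Fin d))))

/-- The weighted inner product `(V, W)_{v,ω}`. -/
def wip (V W : M.Broken) : ℝ := M.cellSum fun T v => V T v * W T v * gaussWeight v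

/-- The broken function `ω V`. -/
def weighted (V : M.Broken) : M.Broken := fun T v => gaussWeight v * V T v

/-- The broken function `v_s V`. -/
def mulCoord (s : Fin d) (V : M.Broken) : M.Broken := fun T v => v s * V T v

/-- The velocity DG space: piecewise polynomials of degree at most `q` on a mesh of `ℝ^d`, for
which the `ω`-weighted quantities of the scheme converge: `(1 + ‖v‖²)^{1/2} V` and the broken
gradient are in `L₂(ω)` and so are the traces on the faces.
On a mesh with finitely many elements all piecewise polynomials have this property. -/
def MemVelocitySpace (q : ℕ) (V : M.Broken) : Prop :=
  M.IsPiecewisePoly q V ∧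
  (∑' T, ∫⁻ v in M.cell T, ENNReal.ofReal
    (gaussWeight v * ((1 + ‖v‖ ^ 2) * V T v ^ 2 + ‖fderiv ℝ (V T) v‖ ^ 2))) < ⊤ ∧
  (∑' e, ∫⁻ v in M.face e, ENNReal.ofReal
    (gaussWeight v * (M.traceMinus V e v ^ 2 + M.tracePlus V e v ^ 2)) ∂(μHE[d - 1])) < ⊤

end DGMesh

/-- `|A| = Q |D| Q⁻¹` for a symmetric matrix `A = Q D Q⁻¹` with `D` diagonal. -/
def symmAbs {ι : Type} [Fintype ι] [DecidableEq ι] (A : Matrix ι ι ℝ) : Matrix ι ι ℝ :=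
  open Classical in
  if h : A.IsHermitian then
    (h.eigenvectorUnitary : Matrix ι ι ℝ) * Matrix.diagonal (fun i => |h.eigenvalues i|) *
      star (h.eigenvectorUnitary : Matrix ι ι ℝ)
  else 0

/-- The numerical flux `A {u} + (1-α)/2 |A| [u]`; `α = 0` is the upwind flux and `α = 1` is the
central flux. -/
def numericalFlux {ι : Type} [Fintype ι] [DecidableEq ι] (α : ℝ) (A : Matrix ι ι ℝ)
    (uMinus uPlus : ι → ℝ) : ι → ℝ :=
  A.mulVec ((1 / 2 : ℝ) • (uPlus + uMinus))
    + ((1 - α) / 2) • (symmAbs A).mulVec (uMinus - uPlus)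

section Scheme

variable {d : ℕ} {Λ : Submodule ℤ (EuclideanSpace ℝ (Fin d))} (Mx : DGMesh Λ)
  (Mv : DGMesh (⊥ : Submodule ℤ (EuclideanSpace ℝ (Fin d)))) (m : ℕ)

/-- The discrete data at one time: spatial basis functions `X_i`, variable velocity basis functions
`W_p`, and coefficients `S`.  The velocity basis consists of `m` fixed functions `U_a`, indexed by
`Sum.inl a`, and of the functions `W_p`, indexed by `Sum.inr p`.  The numbers of basis functions
may vary in time. -/
structure LowRankState where
  r : ℕ
  k : ℕ
  X : Fin r → Mx.Broken
  W : Fin k → Mv.Broken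
  S : Matrix (Fin r) (Fin m ⊕ Fin k) ℝ

variable {Mx Mv m}

/-- A spatial basis: functions of the DG space that are orthonormal in `L₂`. -/
def IsSpatialBasis (p : ℕ) {r : ℕ} (X : Fin r → Mx.Broken) : Prop :=
  (∀ i, Mx.IsPiecewisePoly p (X i)) ∧ Mx.OrthonormalFor Mx.ip X

/-- A velocity basis: the fixed functions `U_a` followed by functions `W_p`, all in the velocity
DG space and orthonormal in `L₂(ω)`. -/
def IsVelocityBasis (q : ℕ) {k : ℕ} (U : Fin m → Mv.Broken) (W : Fin k → Mv.Broken) : Prop :=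
  (∀ j, Mv.MemVelocitySpace q (Sum.elim U W j)) ∧ Mv.OrthonormalFor Mv.wip (Sum.elim U W)

namespace LowRankState

variable (st : LowRankState Mx Mv m) (U : Fin m → Mv.Broken)

/-- The velocity basis `V = (U_1, …, U_m, W_{m+1}, …)`. -/
def V : Fin m ⊕ Fin st.k → Mv.Broken := Sum.elim U st.W

/-- `K_j = ∑_i X_i S_ij` -/
def K (j : Fin m ⊕ Fin st.k) : Mx.Broken := fun T x => ∑ i, st.X i T x * st.S i j

/-- The phase space density `f = ω ∑_ij S_ij X_i ⊗ V_j`, on the product of the element `T` of the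
spatial mesh and the element `T'` of the velocity mesh. -/
def f (T : Mx.Cell) (T' : Mv.Cell) (x v : EuclideanSpace ℝ (Fin d)) : ℝ :=
  gaussWeight v * ∑ i, ∑ j, st.S i j * st.X i T x * st.V U j T' v

/-- The velocity moment `∫ g(v) f(x, v) dv`. -/
def moment (g : EuclideanSpace ℝ (Fin d) → ℝ) : Mx.Broken :=
  fun T x => Mv.cellSum fun T' v => g v * st.f U T T' x v

/-- The mass density `ρ = ∫ f dv`. -/
def rho : Mx.Broken := st.moment U fun _ => 1

/-- The momentum density `j_s = ∫ v_s f dv`. -/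
def mom (s : Fin d) : Mx.Broken := st.moment U fun v => v s

/-- `σ_{s,s'} = ∫ v_s v_{s'} f dv`. -/
def sigma (s s' : Fin d) : Mx.Broken := st.moment U fun v => v s * v s'

/-- `A^{(x,s)}_{ij} = (v_s V_j, V_i)_{v,ω}` -/
def matA (s : Fin d) : Matrix (Fin m ⊕ Fin st.k) (Fin m ⊕ Fin st.k) ℝ :=
  Matrix.of fun i j => Mv.wip (Mv.mulCoord s (st.V U j)) (st.V U i)

/-- `B_h^{(x,s)}_{ij} = (d̂_{v_s} (ω V_j), V_i)_v` -/
def matB (s : Fin d) : Matrix (Fin m ⊕ Fin st.k) (Fin m ⊕ Fin st.k) ℝ :=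
  Matrix.of fun i j => Mv.dhat s (Mv.weighted (st.V U j)) (st.V U i)

/-- The K-step: `K'` (with components in the spatial DG space) is the result of one explicit Euler
step of size `τ` of the DG discretization with flux parameter `α`, for the electric field `F`. -/
def IsKStep (p : ℕ) (τ α : ℝ) (F : EuclideanSpace ℝ (Fin d) → EuclideanSpace ℝ (Fin d))
    (K' : Fin m ⊕ Fin st.k → Mx.Broken) : Prop :=
  (∀ j, Mx.IsPiecewisePoly p (K' j)) ∧
  ∀ ψ : Fin m ⊕ Fin st.k → Mx.Broken, (∀ j, Mx.IsPiecewisePoly p (ψ j)) →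
    1 / τ * ∑ j, Mx.ip (K' j - st.K j) (ψ j)
    + Mx.cellSum (fun T x => ∑ s,
        (-((st.matA U s).mulVec (fun j => st.K j T x) ⬝ᵥ fun j => partialDeriv s (ψ j T) x)
          - F x s * ((st.matB U s).mulVec (fun j => st.K j T x) ⬝ᵥ fun j => ψ j T x)))
    + Mx.faceSum (fun e x =>
        numericalFlux α (∑ s, Mx.normal e s • st.matA U s)
          (fun j => Mx.traceMinus (st.K j) e x) (fun j => Mx.tracePlus (st.K j) e x)
        ⬝ᵥ fun j => Mx.jump (ψ j) e x) = 0

/-- The S-step in the augmented bases `Xt` and `Vt = (U, Wt)`: the old coefficients are transformed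
to `M S Nᵀ` and then one explicit Euler step is performed. -/
def sStep (τ : ℝ) (F : EuclideanSpace ℝ (Fin d) → EuclideanSpace ℝ (Fin d)) {rt kt : ℕ}
    (Xt : Fin rt → Mx.Broken) (Wt : Fin kt → Mv.Broken) :
    Matrix (Fin rt) (Fin m ⊕ Fin kt) ℝ :=
  Matrix.of fun k l =>
    (∑ i, ∑ j, Mx.ip (Xt k) (st.X i) * st.S i j * Mv.wip (Sum.elim U Wt l) (st.V U j))
    - τ * ∑ i, ∑ j, ∑ s,
      (Mx.dhat s (st.X i) (Xt k) * st.S i j *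
          Mv.wip (Sum.elim U Wt l) (Mv.mulCoord s (st.V U j))
        + Mx.ip (Xt k) (fun T x => -F x s * st.X i T x) * st.S i j *
          Mv.dhat s (Mv.weighted (st.V U j)) (Sum.elim U Wt l))

end LowRankState

/-- One time step `st → st'` of the discretized rank-adaptive unconventional integrator with
electric field `F`, step size `τ`, and flux parameter `α` in the K-step.
* K-step: `K'`.
* The functions `L` stand for the output of the L-step; they only serve to enrich the velocity basis
  and may be arbitrary functions of the velocity DG space here.
* Augmentation: `Xt` is an orthonormal basis of a space containing all `X_i` and `K'_j`, and
  `(U, Wt)` is an `ω`-orthonormal basis, starting with the fixed functions, of a space containing all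
  `V_j` and `L_p`.
* S-step: the new coefficients `St` in the augmented bases.
* Conservative rank truncation, and change of the spatial basis: the part of the solution belonging
  to the fixed functions `U_a` is kept, the remaining part is replaced by some other function whose
  velocity factors are in the span of the `Wt`. -/
def IsTimeStep (p q : ℕ) (U : Fin m → Mv.Broken) (τ α : ℝ)
    (F : EuclideanSpace ℝ (Fin d) → EuclideanSpace ℝ (Fin d))
    (st st' : LowRankState Mx Mv m) : Prop :=
  ∃ (K' : Fin m ⊕ Fin st.k → Mx.Broken) (nL : ℕ) (L : Fin nL → Mv.Broken)
    (rt kt : ℕ) (Xt : Fin rt → Mx.Broken) (Wt : Fin kt → Mv.Broken)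
    (St : Matrix (Fin rt) (Fin m ⊕ Fin kt) ℝ),
    st.IsKStep U p τ α F K' ∧
    (∀ l, Mv.MemVelocitySpace q (L l)) ∧
    IsSpatialBasis p Xt ∧
    (∀ i, st.X i ∈ Submodule.span ℝ (Set.range Xt)) ∧
    (∀ j, K' j ∈ Submodule.span ℝ (Set.range Xt)) ∧
    IsVelocityBasis q U Wt ∧
    (∀ j, st.V U j ∈ Submodule.span ℝ (Set.range (Sum.elim U Wt))) ∧
    (∀ l, L l ∈ Submodule.span ℝ (Set.range (Sum.elim U Wt))) ∧
    St = st.sStep U τ F Xt Wt ∧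
    (∀ a T x, st'.K (Sum.inl a) T x = ∑ k, Xt k T x * St k (Sum.inl a)) ∧
    (∀ b, st'.W b ∈ Submodule.span ℝ (Set.range Wt))

/-- A run of the scheme: at every time the bases are orthonormal bases in the DG spaces (with the
fixed functions `U_a`), the electric field `E n` is the exact field of the discrete density `ρ^n`,
and the state at time `n + 1` arises from the one at time `n` by one time step. -/
structure IsSchemeRun (p q : ℕ) (U : Fin m → Mv.Broken) (τ α : ℝ)
    (st : ℕ → LowRankState Mx Mv m)
    (E : ℕ → EuclideanSpace ℝ (Fin d) → EuclideanSpace ℝ (Fin d)) : Prop where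
  spatialBasis : ∀ n, IsSpatialBasis p (st n).X
  velocityBasis : ∀ n, IsVelocityBasis q U (st n).W
  electricField : ∀ n, Mx.IsElectricField ((st n).rho U) (E n)
  timeStep : ∀ n, IsTimeStep p q U τ α (E n) (st n) (st (n + 1))

end Scheme

end

/-! The momentum density depends only on the part of `f` that belongs to the fixed functions. If
`v_s = ∑ c_a U_a`, orthonormality gives `j_s = ∑ c_a K_a`, and the truncation keeps the augmented
`K_a`. It remains to know what the S-step does to them. For a fixed `U_a`, the S-step equation with
index `(k, a)` is row `a` of the K-step tested with `X̃_k`: the discrete product rule (`dhat_eq`)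
turns the weak central-flux form into the discrete derivative, and `(U_a, V_j)` is a Kronecker
delta. So the new coefficients are `(K'_a, X̃_k)` (`sStep_eq`), and since `K'_a` lies in the span of
the orthonormal `X̃_k`, the new `K_a` is exactly `K'_a` (`K_succ_eq`).

The balance law is therefore the combination of K-step rows with coefficients `c_a`. The transport
matrices combine to the moments of `v_s v_{s'} V_j`, that is, to `σ_s` (`sigma_eq`). The field
matrices combine to `(d̂_{s'}(ω V_j), v_s)`. As `v_s` is continuous across faces, summation by parts
leaves no face term and gives `-δ_{ss'} ∫ V_j ω`, hence `ρ` (`sum_matB`, `dhat_weighted_coord`).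

Both summations by parts rest on a divergence theorem for meshes of convex polyhedra with hanging
nodes. It is obtained by translation: along almost every line in direction `u`, the indicator of an
element changes by the signed number of facets crossed. Integrating this over all lines compares the
element with its translate by `ε u`, and the derivative at `ε = 0` is the divergence theorem.
Summing over elements pairs the two sides of each face; on an unbounded mesh a cutoff is removed by
dominated convergence.

For the force, put `r = 1 - ρ`, so that `F = -∇Φ` and `∇ · F = r` weakly on the torus. With an even
mollifier `η`, integrations by parts and the symmetry of convolution turn `∫ F_s (η * r)` into a sum
of terms `∫ Φ (k * Φ)`, where `k` is a third derivative of `η`. Such a `k` is odd, so each term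
equals its own negative. Since `r` is bounded and `F` is integrable, the mollifier can be removed.
Testing the gradient equation with `1` gives `∫ F_s = 0`, so `∫ F_s ρ = 0`, and the balance law with
`ψ = 1` conserves the total momentum. -/

/-! ### Shadows and tubes of convex sets along a direction. -/

section Shadow

variable {V : Type*} [AddCommGroup V] [Module ℝ V]

/-- The points from which the set `A` is hit when moving along `u` for a time in `(0, ε)`. -/
def shadow (A : Set V) (u : V) (ε : ℝ) : Set V := {x | ∃ t ∈ Set.Ioo 0 ε, x + t • u ∈ A}

/-- Averages of hitting times are hitting times of averages. Convexity is used later to get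
null-measurability of shadows. -/
theorem convex_shadow {A : Set V} (hA : Convex ℝ A) (u : V) (ε : ℝ) :
    Convex ℝ (shadow A u ε) := by
  rintro x ⟨t, ht, hx⟩ y ⟨s, hs, hy⟩ a b ha hb hab
  refine ⟨a * t + b * s, convex_Ioo 0 ε ht hs ha hb hab, ?_⟩
  have := hA hx hy ha hb hab
  convert this using 1
  module

/-- The union of the lines in direction `u` through the points of `A`. -/
def tube (A : Set V) (u : V) : Set V := {x | ∃ t : ℝ, x + t • u ∈ A}

/-- This makes the frontier of a tube Lebesgue-null, which is what allows exceptional lines to be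
discarded. -/
theorem convex_tube {A : Set V} (hA : Convex ℝ A) (u : V) : Convex ℝ (tube A u) := by
  rintro x ⟨t, hx⟩ y ⟨s, hy⟩ a b ha hb hab
  refine ⟨a * t + b * s, ?_⟩
  have := hA hx hy ha hb hab
  convert this using 1
  module

theorem subset_tube (A : Set V) (u : V) : A ⊆ tube A u :=
  fun x hx => ⟨0, by simpa using hx⟩

theorem tube_neg (A : Set V) (u : V) : tube A (-u) = tube A u := by
  ext x
  constructor
  · rintro ⟨t, ht⟩
    exact ⟨-t, by simpa using ht⟩
  · rintro ⟨t, ht⟩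
    exact ⟨-t, by simpa using ht⟩

theorem add_smul_mem_tube {A : Set V} {u x : V} (t : ℝ) :
    x + t • u ∈ tube A u ↔ x ∈ tube A u := by
  constructor
  · rintro ⟨s, hs⟩
    exact ⟨t + s, by convert hs using 1; module⟩
  · rintro ⟨s, hs⟩
    exact ⟨s - t, by convert hs using 1; module⟩

end Shadow

/-! ### Fubini's theorem along a direction oblique to a hyperplane. -/

section Oblique

variable {V : Type*} [NormedAddCommGroup V] [InnerProductSpace ℝ V] [FiniteDimensional ℝ V]

theorem finrank_orthogonal_of_norm_eq_one {n : V} (hn : ‖n‖ = 1) :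
    Module.finrank ℝ ((Submodule.span ℝ {n})ᗮ : Submodule ℝ V) = Module.finrank ℝ V - 1 := by
  have h1 := (Submodule.span ℝ {n}).finrank_add_finrank_orthogonal
  rw [finrank_span_singleton (by rintro rfl; simp at hn)] at h1
  omega

variable [MeasurableSpace V] [BorelSpace V]

/-- The parametrization of the hyperplane by `n^⊥` is an isometry, and the normalized Hausdorff
measure of top dimension is Lebesgue measure. -/
theorem restrict_hyperplane_eq_map {n : V} (hn : ‖n‖ = 1) (c : ℝ) :
    (μHE[Module.finrank ℝ V - 1] : Measure V).restrict {x | inner ℝ n x = c}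
      = Measure.map (fun y : ((Submodule.span ℝ {n})ᗮ : Submodule ℝ V) => (y : V) + c • n)
          volume := by
  have hi : Isometry (fun y : ((Submodule.span ℝ {n})ᗮ : Submodule ℝ V) => (y : V) + c • n) :=
    (isometry_add_right (c • n)).comp isometry_subtype_coe
  rw [← InnerProductSpace.euclideanHausdorffMeasure_eq_volume,
    finrank_orthogonal_of_norm_eq_one hn, hi.map_euclideanHausdorffMeasure]
  congr 1
  ext x
  simp only [Set.mem_ofPred_eq, Set.mem_range]
  constructor
  · intro hx
    refine ⟨⟨x - c • n, ?_⟩, by simp⟩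
    rw [Submodule.mem_orthogonal_singleton_iff_inner_right, inner_sub_right, inner_smul_right,
      real_inner_self_eq_norm_sq, hn, hx]
    simp
  · rintro ⟨y, rfl⟩
    rw [inner_add_right, inner_smul_right, real_inner_self_eq_norm_sq, hn,
      Submodule.mem_orthogonal_singleton_iff_inner_right.1 y.2]
    simp

theorem setIntegral_hyperplane {n : V} (hn : ‖n‖ = 1) (c : ℝ) (g : V → ℝ) :
    ∫ x in {x | inner ℝ n x = c}, g x ∂(μHE[Module.finrank ℝ V - 1])
      = ∫ y : ((Submodule.span ℝ {n})ᗮ : Submodule ℝ V), g ((y : V) + c • n) := by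
  have hi : Isometry (fun y : ((Submodule.span ℝ {n})ᗮ : Submodule ℝ V) => (y : V) + c • n) :=
    (isometry_add_right (c • n)).comp isometry_subtype_coe
  rw [restrict_hyperplane_eq_map hn]
  exact hi.isClosedEmbedding.measurableEmbedding.integral_map g

theorem integral_eq_integral_line_orthogonal {n : V} (hn : ‖n‖ = 1) {g : V → ℝ}
    (hg : Integrable g) :
    ∫ x, g x = ∫ a : ℝ, ∫ y : ((Submodule.span ℝ {n})ᗮ : Submodule ℝ V), g ((y : V) + a • n) := by
  have h0 := ((Submodule.span ℝ {n}).measurePreserving_measurableEquivProd (0 : V)).symm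
  rw [InnerProductSpace.euclideanHausdorffMeasure_eq_volume] at h0
  have h1 := (LinearIsometryEquiv.toSpanUnitSingleton (𝕜 := ℝ) n hn).measurePreserving
  let e := ((LinearIsometryEquiv.toSpanUnitSingleton (𝕜 := ℝ) n hn).toMeasurableEquiv.prodCongr
    (MeasurableEquiv.refl ((Submodule.span ℝ {n})ᗮ : Submodule ℝ V))).trans
    ((Submodule.span ℝ {n}).measurableEquivProd (0 : V)).symm
  have he : ∀ p, e p = (p.2 : V) + p.1 • n := by
    intro p
    simp [e, MeasurableEquiv.prodCongr, add_comm]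
  have h2 : MeasurePreserving e (volume.prod volume) volume :=
    h0.comp (h1.prod (MeasurePreserving.id volume))
  rw [← h2.integral_comp' g, integral_prod]
  · simp_rw [he]
  · exact (h2.integrable_comp_emb e.measurableEmbedding).2 hg

/-- Moving by `t • u` changes the height over the hyperplane by `t ⟪n, u⟫`, whence the Jacobian. The
tangential part of the motion is absorbed by translation invariance in `n^⊥`. -/
theorem integral_eq_oblique {n u : V} (hn : ‖n‖ = 1) (c : ℝ) (hu : inner ℝ n u ≠ 0) {g : V → ℝ}
    (hg : Integrable g) :
    ∫ x, g x = |inner ℝ n u| *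
      ∫ t : ℝ, ∫ x in {x | inner ℝ n x = c}, g (x + t • u) ∂(μHE[Module.finrank ℝ V - 1]) := by
  set b : ℝ := inner ℝ n u with hb
  have hw : u - b • n ∈ ((Submodule.span ℝ {n})ᗮ : Submodule ℝ V) := by
    rw [Submodule.mem_orthogonal_singleton_iff_inner_right, inner_sub_right, inner_smul_right,
      real_inner_self_eq_norm_sq, hn]
    simp [hb]
  set w : ((Submodule.span ℝ {n})ᗮ : Submodule ℝ V) := ⟨u - b • n, hw⟩
  set h : ℝ → ℝ := fun a => ∫ y : ((Submodule.span ℝ {n})ᗮ : Submodule ℝ V), g ((y : V) + a • n)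
  have key : ∀ t : ℝ, ∫ x in {x | inner ℝ n x = c}, g (x + t • u)
      ∂(μHE[Module.finrank ℝ V - 1]) = h (b * t + c) := by
    intro t
    rw [setIntegral_hyperplane hn c fun x => g (x + t • u)]
    rw [← integral_add_right_eq_self _ (-(t • w))]
    congr 1
    ext y
    congr 1
    simp only [Submodule.coe_add, Submodule.coe_neg, Submodule.coe_smul, w]
    module
  simp_rw [key]
  rw [integral_eq_integral_line_orthogonal hn hg]
  rw [Measure.integral_comp_mul_left (fun x => h (x + c)) b, integral_add_right_eq_self h c]
  rw [smul_eq_mul, ← mul_assoc, abs_inv, mul_inv_cancel₀ (abs_ne_zero.2 hu), one_mul]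

/-- A line transversal to the hyperplane meets the flat set `A` at most once, so its shadow is `A ×
(0, ε)` in oblique coordinates. -/
theorem integral_indicator_shadow {n u : V} (hn : ‖n‖ = 1) {c : ℝ} (hu : inner ℝ n u ≠ 0)
    {A : Set V} (hA : Convex ℝ A) (hAm : MeasurableSet A) (hAn : ∀ x ∈ A, inner ℝ n x = c) {ε : ℝ}
    (hε : 0 ≤ ε) {g : V → ℝ} (hg : Integrable g) :
    ∫ x, (shadow A u ε).indicator g x = |inner ℝ n u| *
      ∫ t in (0 : ℝ)..ε, ∫ x in A, g (x - t • u) ∂(μHE[Module.finrank ℝ V - 1]) := by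
  rw [integral_eq_oblique hn c hu (hg.indicator₀ ((convex_shadow hA u ε).nullMeasurableSet volume))]
  congr 1
  rw [intervalIntegral.integral_of_le hε, integral_Ioc_eq_integral_Ioo,
    ← integral_indicator measurableSet_Ioo,
    -- The shadow lies upstream of `A`, at the points `x - t • u`; hence the change of sign of `t`.
    ← integral_neg_eq_self]
  congr 1
  ext t
  have hmem : ∀ x, inner ℝ n x = c → ((x + (-t) • u) ∈ shadow A u ε ↔ (t ∈ Set.Ioo 0 ε ∧ x ∈ A)) := by
    intro x hx
    constructor
    · rintro ⟨s, hs, hxs⟩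
      have h1 := hAn _ hxs
      rw [inner_add_right, inner_add_right, inner_smul_right, inner_smul_right, hx] at h1
      have h2 : (s - t) * inner ℝ n u = 0 := by linarith
      have h3 : s = t := by
        rcases mul_eq_zero.1 h2 with h | h
        · linarith
        · exact absurd h hu
      subst h3
      refine ⟨hs, ?_⟩
      convert hxs using 1
      module
    · rintro ⟨ht, hx⟩
      refine ⟨t, ht, ?_⟩
      convert hx using 1
      module
  have hH : MeasurableSet {x : V | inner ℝ n x = c} :=
    (isClosed_eq (by fun_prop) continuous_const).measurableSet
  have hAH : A = {x : V | inner ℝ n x = c} ∩ A := by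
    ext x
    exact ⟨fun h => ⟨hAn x h, h⟩, fun h => h.2⟩
  by_cases ht : t ∈ Set.Ioo 0 ε
  · rw [Set.indicator_of_mem ht]
    conv_rhs => rw [hAH, ← setIntegral_indicator hAm]
    refine setIntegral_congr_fun hH fun x hx => ?_
    by_cases hxA : x ∈ A
    · rw [Set.indicator_of_mem hxA, Set.indicator_of_mem ((hmem x hx).2 ⟨ht, hxA⟩), neg_smul,
        sub_eq_add_neg]
    · rw [Set.indicator_of_notMem hxA,
        Set.indicator_of_notMem fun h => hxA ((hmem x hx).1 h).2]
  · rw [Set.indicator_of_notMem ht]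
    rw [setIntegral_congr_fun (g := fun _ => (0 : ℝ)) hH, integral_zero]
    intro x hx
    exact Set.indicator_of_notMem (fun h => ht ((hmem x hx).1 h).1) _

end Oblique

/-! ### Generic points of flat boundary pieces. -/

section Tube

variable {V : Type*} [NormedAddCommGroup V] [InnerProductSpace ℝ V]

theorem add_smul_mem_frontier_tube {A : Set V} {u x : V} (t : ℝ) :
    x + t • u ∈ frontier (tube A u) ↔ x ∈ frontier (tube A u) := by
  have h : (Homeomorph.addRight (t • u)) ⁻¹' tube A u = tube A u := by
    ext y
    exact add_smul_mem_tube t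
  conv_rhs => rw [← h, ← Homeomorph.preimage_frontier]
  rfl

/-- If a line in direction `u` hits the transversal `(d-1)`-dimensional part `A` of the boundary of
a convex set at a generic point, then it comes from the interior of the convex set. -/
theorem eventually_sub_smul_mem_interior {T A : Set V} {n u h p : V} {c : ℝ}
    (hT : Convex ℝ T) (hAT : A ⊆ T) (hA : ∀ x ∈ A, inner ℝ n x = c) (hp : p ∈ interior T)
    (hpc : inner ℝ n p < c) (hu : 0 < inner ℝ n u) (hh : h ∈ A)
    (hint : h ∈ interior (tube A u)) :
    ∀ᶠ t in nhdsWithin (0 : ℝ) (Set.Ioi 0), h - t • u ∈ interior T := by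
  set b : ℝ := inner ℝ n u
  -- The weight is chosen so that `h - t • u = (1 - l t) • a t + l t • p` with `a t` at height `c`:
  -- the height `t b` lost along `-u` has to equal `l t (c - ⟪n, p⟫)`.
  set l : ℝ → ℝ := fun t => t * b / (c - inner ℝ n p) with hl
  set a : ℝ → V := fun t => (1 - l t)⁻¹ • (h - t • u - l t • p) with ha
  have hl0 : l 0 = 0 := by simp [hl]
  have hlc : Continuous l := by fun_prop
  have hac : ContinuousAt a 0 := by
    refine ContinuousAt.smul (ContinuousAt.inv₀ (by fun_prop) (by simp [hl0])) (by fun_prop)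
  have ha0 : a 0 = h := by simp [ha, hl0]
  have h1 : ∀ᶠ t in nhds (0 : ℝ), a t ∈ interior (tube A u) :=
    hac.eventually_mem (by rw [ha0]; exact isOpen_interior.mem_nhds hint)
  have h2 : ∀ᶠ t in nhds (0 : ℝ), l t < 1 :=
    hlc.continuousAt.eventually_lt continuousAt_const (by simp [hl0])
  filter_upwards [nhdsWithin_le_nhds h1, nhdsWithin_le_nhds h2, self_mem_nhdsWithin]
    with t ht1 ht2 ht3
  have hlpos : 0 < l t := div_pos (mul_pos ht3 hu) (by linarith)
  have hne : (1 - l t) ≠ 0 := by linarith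
  obtain ⟨s, hs⟩ := interior_subset ht1
  have hna : inner ℝ n (a t) = c := by
    have e1 : l t * (c - inner ℝ n p) = t * b := div_mul_cancel₀ _ (by linarith)
    simp only [ha, inner_smul_right, inner_sub_right, hA h hh]
    rw [inv_mul_eq_iff_eq_mul₀ hne]
    change c - t * b - _ = _
    linarith
  -- The line through `a t` hits `A` after time `s`, but `a t` already has the height of `A`; hence
  -- `a t ∈ A`.
  have hsz : s = 0 := by
    have : inner ℝ n (a t + s • u) = c := hA _ hs
    rw [inner_add_right, hna, inner_smul_right] at this
    have h3 : s * b = 0 := by linarith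
    exact (mul_eq_zero.1 h3).resolve_right hu.ne'
  rw [hsz, zero_smul, add_zero] at hs
  have := hT.combo_self_interior_mem_interior (hAT hs) hp (sub_nonneg.2 ht2.le) hlpos (by ring)
  convert this using 1
  simp only [ha, smul_smul, mul_inv_cancel₀ hne, one_smul]
  module

/-- The tube has full dimension and its directions are those of `A` together with `u`, so `A` has
codimension at most one. Empty interior excludes codimension zero. -/
theorem finrank_vectorSpan_add_one_of_mem_interior_tube [FiniteDimensional ℝ V] {A : Set V}
    {u h : V} (hA : Convex ℝ A) (hne : A.Nonempty) (hAi : interior A = ∅)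
    (hint : h ∈ interior (tube A u)) :
    Module.finrank ℝ (vectorSpan ℝ A) + 1 = Module.finrank ℝ V := by
  have h1 : vectorSpan ℝ (tube A u) = ⊤ := by
    have := ((convex_tube hA u).interior_nonempty_iff_affineSpan_eq_top).1 ⟨h, hint⟩
    rw [← direction_affineSpan, this, AffineSubspace.direction_top]
  have h2 : vectorSpan ℝ (tube A u) ≤ vectorSpan ℝ A ⊔ Submodule.span ℝ {u} := by
    rw [vectorSpan_def, Submodule.span_le]
    rintro _ ⟨x, ⟨t, hx⟩, y, ⟨s, hy⟩, rfl⟩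
    change x - y ∈ _
    have e : x - y = ((x + t • u) - (y + s • u)) + (s - t) • u := by module
    rw [e]
    exact Submodule.add_mem_sup (vsub_mem_vectorSpan ℝ hx hy)
      (Submodule.smul_mem _ _ (Submodule.mem_span_singleton_self u))
  have h3 : Module.finrank ℝ V ≤ Module.finrank ℝ (vectorSpan ℝ A) + 1 := by
    rw [h1, top_le_iff] at h2
    rw [← finrank_top ℝ V, ← h2]
    refine (Submodule.finrank_add_le_finrank_add_finrank _ _).trans ?_
    gcongr
    exact (finrank_span_le_card {u}).trans (by simp)
  have h4 : Module.finrank ℝ (vectorSpan ℝ A) < Module.finrank ℝ V := by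
    refine Submodule.finrank_lt fun htop => ?_
    have : (interior A).Nonempty := by
      rw [hA.interior_nonempty_iff_affineSpan_eq_top]
      exact (AffineSubspace.affineSpan_eq_top_iff_vectorSpan_eq_top_of_nonempty ℝ V V hne).2 htop
    simp [hAi] at this
  omega

end Tube

/-! ### Elements, sides of faces and facets of a mesh. -/

namespace DGMesh

variable {d : ℕ} {Λ : Submodule ℤ (EuclideanSpace ℝ (Fin d))} (M : DGMesh Λ)

theorem _root_.IsPolyhedron.isClosed {P : Set (EuclideanSpace ℝ (Fin d))} (h : IsPolyhedron P) :
    IsClosed P := by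
  obtain ⟨H, rfl⟩ := h
  simp only [Set.ofPred_forall]
  exact isClosed_biInter fun h _ => isClosed_le (by fun_prop) continuous_const

theorem _root_.IsPolyhedron.convex {P : Set (EuclideanSpace ℝ (Fin d))} (h : IsPolyhedron P) :
    Convex ℝ P := by
  obtain ⟨H, rfl⟩ := h
  simp only [Set.ofPred_forall]
  refine convex_iInter fun h => convex_iInter fun _ => ?_
  exact convex_halfSpace_le (LinearMap.isLinear (innerₗ _ h.1)) h.2

theorem isClosed_cell (T : M.Cell) : IsClosed (M.cell T) := (M.isPolyhedron_cell T).isClosed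

theorem convex_cell (T : M.Cell) : Convex ℝ (M.cell T) := (M.isPolyhedron_cell T).convex

/-- The intersection of `T` with the translated element `l + T'`. -/
def inter (T T' : M.Cell) (l : EuclideanSpace ℝ (Fin d)) : Set (EuclideanSpace ℝ (Fin d)) :=
  {x | x ∈ M.cell T ∧ x - l ∈ M.cell T'}

theorem inter_eq (T T' : M.Cell) (l : EuclideanSpace ℝ (Fin d)) :
    M.inter T T' l = M.cell T ∩ (Homeomorph.subRight l) ⁻¹' M.cell T' := rfl

theorem convex_translate_cell (T' : M.Cell) (l : EuclideanSpace ℝ (Fin d)) :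
    Convex ℝ ((Homeomorph.subRight l) ⁻¹' M.cell T') := by
  have h := (M.convex_cell T').translate_preimage_right (-l)
  have e : (fun x => -l + x) ⁻¹' M.cell T' = (Homeomorph.subRight l) ⁻¹' M.cell T' := by
    ext x
    simp [sub_eq_add_neg, add_comm]
  rwa [← e]

theorem convex_inter (T T' : M.Cell) (l : EuclideanSpace ℝ (Fin d)) :
    Convex ℝ (M.inter T T' l) :=
  (M.convex_cell T).inter (M.convex_translate_cell T' l)

theorem isClosed_inter (T T' : M.Cell) (l : EuclideanSpace ℝ (Fin d)) :
    IsClosed (M.inter T T' l) :=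
  (M.isClosed_cell T).inter ((M.isClosed_cell T').preimage (Homeomorph.subRight l).continuous)

theorem interior_inter_eq_empty {T T' : M.Cell} {l : EuclideanSpace ℝ (Fin d)} (hl : l ∈ Λ)
    (h : T ≠ T' ∨ l ≠ 0) : interior (M.inter T T' l) = ∅ := by
  rw [inter_eq, interior_inter, ← Homeomorph.preimage_interior]
  ext x
  simp only [Set.mem_inter_iff, Set.mem_preimage, Set.mem_empty_iff_false, iff_false, not_and]
  exact M.disjoint_interior T T' l hl h x

/-- A point of the interior of a translated element does not lie in another element. -/
theorem notMem_cell_of_mem_interior {T T' : M.Cell} {l : EuclideanSpace ℝ (Fin d)} (hl : l ∈ Λ)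
    (h : T ≠ T' ∨ l ≠ 0) {x : EuclideanSpace ℝ (Fin d)} (hx : x - l ∈ interior (M.cell T')) :
    x ∉ M.cell T := by
  intro hxT
  have h1 : x ∈ closure (interior (M.cell T)) := by
    rw [(M.convex_cell T).closure_interior_eq_closure_of_nonempty_interior (M.nonempty_interior T)]
    exact subset_closure hxT
  have h2 : IsOpen ((Homeomorph.subRight l) ⁻¹' interior (M.cell T')) :=
    isOpen_interior.preimage (Homeomorph.subRight l).continuous
  obtain ⟨y, hy1, hy2⟩ := mem_closure_iff.1 h1 _ h2 hx
  exact M.disjoint_interior T T' l hl h y hy2 hy1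

/-- A face together with one of its two sides: `Sum.inl e` is the face `e` seen from `T⁻`, and
`Sum.inr e` is the face seen from `T⁺`. -/
abbrev Side : Type := M.Face ⊕ M.Face

/-- the element on this side -/
def own : M.Side → M.Cell := Sum.elim M.minus M.plus

/-- the element on the other side -/
def nbr : M.Side → M.Cell := Sum.elim M.plus M.minus

/-- the period by which the element on the other side is translated -/
def offset : M.Side → EuclideanSpace ℝ (Fin d) := Sum.elim M.shift fun e => -M.shift e

/-- the outer normal -/
def outer : M.Side → EuclideanSpace ℝ (Fin d) := Sum.elim M.normal fun e => -M.normal e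

/-- the face as a subset of the boundary of the element -/
def facet (o : M.Side) : Set (EuclideanSpace ℝ (Fin d)) := M.inter (M.own o) (M.nbr o) (M.offset o)

theorem norm_outer (o : M.Side) : ‖M.outer o‖ = 1 := by
  cases o <;> simp [outer, M.norm_normal]

theorem offset_mem (o : M.Side) : M.offset o ∈ Λ := by
  cases o with
  | inl e => exact M.shift_mem e
  | inr e => exact Λ.neg_mem (M.shift_mem e)

theorem own_ne (o : M.Side) : M.own o ≠ M.nbr o ∨ M.offset o ≠ 0 := by
  cases o with
  | inl e => exact M.face_ne e
  | inr e => simpa [own, nbr, offset, ne_comm] using M.face_ne e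

theorem inner_outer_le (o : M.Side) {x y : EuclideanSpace ℝ (Fin d)} (hx : x ∈ M.cell (M.own o))
    (hy : y - M.offset o ∈ M.cell (M.nbr o)) : inner ℝ (M.outer o) x ≤ inner ℝ (M.outer o) y := by
  cases o with
  | inl e => exact M.normal_direction e x y hx hy
  | inr e =>
    have := M.normal_direction e (y + M.shift e) (x + M.shift e)
      (by simpa [offset, nbr] using hy) (by simpa [own] using hx)
    simp only [inner_add_right] at this
    simp only [outer, Sum.elim_inr, inner_neg_left]
    linarith

theorem facet_inr (e : M.Face) : M.facet (Sum.inr e) = {x | x + M.shift e ∈ M.face e} := by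
  ext x
  simp [facet, inter, own, nbr, offset, face, and_comm]

theorem facet_inl (e : M.Face) : M.facet (Sum.inl e) = M.face e := rfl

/-- A `(d-1)`-dimensional intersection with a neighbouring element is a facet of exactly one
side. -/
theorem exists_side {T T' : M.Cell} {l : EuclideanSpace ℝ (Fin d)} (hl : l ∈ Λ)
    (h : T ≠ T' ∨ l ≠ 0) (hne : (M.inter T T' l).Nonempty)
    (hdim : Module.finrank ℝ (vectorSpan ℝ (M.inter T T' l)) + 1 = d) :
    ∃ o, M.own o = T ∧ M.nbr o = T' ∧ M.offset o = l := by
  obtain ⟨e, he, -⟩ := M.face_complete T T' l hl h hne hdim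
  rcases he with ⟨h1, h2, h3⟩ | ⟨h1, h2, h3⟩
  · exact ⟨Sum.inl e, h1, h2, h3⟩
  · exact ⟨Sum.inr e, h2, h1, by simp [offset, h3]⟩

theorem facet_nonempty (o : M.Side) : (M.facet o).Nonempty := by
  cases o with
  | inl e => exact M.face_nonempty e
  | inr e =>
    obtain ⟨x, hx⟩ := M.face_nonempty e
    exact ⟨x - M.shift e, by rw [facet_inr]; simpa [face] using hx⟩

open scoped Pointwise in
theorem facet_dim (o : M.Side) : Module.finrank ℝ (vectorSpan ℝ (M.facet o)) + 1 = d := by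
  cases o with
  | inl e => exact M.face_dim e
  | inr e =>
    have : M.facet (Sum.inr e) = (-M.shift e) +ᵥ M.face e := by
      rw [facet_inr]
      ext x
      simp [Set.mem_vadd_set_iff_neg_vadd_mem, add_comm]
    rw [this, vectorSpan_vadd]
    exact M.face_dim e

theorem _root_.EuclideanSpace.eq_zero_of_eq_neg {v : EuclideanSpace ℝ (Fin d)} (h : v = -v) : v = 0 := by
  have : (2 : ℝ) • v = 0 := by
    rw [two_smul]
    nth_rw 2 [h]
    exact add_neg_cancel v
  simpa using this

/-- `face_complete` lists only one face for an unoriented pair, so both sides come from the same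
face. The two sides of one face cannot agree, since that would give `minus = plus` and `shift =
-shift`, contrary to `face_ne`. -/
theorem side_injective {o o' : M.Side} (h1 : M.own o = M.own o') (h2 : M.nbr o = M.nbr o')
    (h3 : M.offset o = M.offset o') : o = o' := by
  obtain ⟨e, -, he⟩ := M.face_complete (M.own o) (M.nbr o) (M.offset o) (M.offset_mem o)
    (M.own_ne o) (M.facet_nonempty o) (M.facet_dim o)
  have key : ∀ o'', M.own o'' = M.own o → M.nbr o'' = M.nbr o → M.offset o'' = M.offset o →
      o'' = Sum.inl e ∨ o'' = Sum.inr e := by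
    intro o'' g1 g2 g3
    cases o'' with
    | inl e' => exact Or.inl (congrArg _ (he e' (Or.inl ⟨g1, g2, g3⟩)))
    | inr e' => exact Or.inr (congrArg _ (he e' (Or.inr ⟨g2, g1, by rw [← g3]; simp [offset]⟩)))
  have hne := M.face_ne e
  rcases key o rfl rfl rfl with h | h <;> rcases key o' h1.symm h2.symm h3.symm with h' | h'
  · rw [h, h']
  · exfalso
    subst h h'
    rcases hne with hne | hne
    · exact hne h1
    · exact hne (EuclideanSpace.eq_zero_of_eq_neg h3)
  · exfalso
    subst h h'
    rcases hne with hne | hne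
    · exact hne h1.symm
    · exact hne (EuclideanSpace.eq_zero_of_eq_neg h3.symm)
  · rw [h, h']

end DGMesh

/-! ### Crossings of facets by generic lines. -/

namespace DGMesh

variable {d : ℕ} {Λ : Submodule ℤ (EuclideanSpace ℝ (Fin d))} (M : DGMesh Λ)

/-- A point is generic for the element `T` and the direction `u` if the line through this point
meets the intersections of `T` with the other elements only in the relative interior of
`(d-1)`-dimensional transversal ones. -/
def Generic (T : M.Cell) (u x : EuclideanSpace ℝ (Fin d)) : Prop :=
  ∀ T', ∀ l ∈ Λ, (T ≠ T' ∨ l ≠ 0) → x ∉ frontier (tube (M.inter T T' l) u)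

variable {M}

theorem Generic.add_smul {T : M.Cell} {u x : EuclideanSpace ℝ (Fin d)} (h : M.Generic T u x)
    (t : ℝ) : M.Generic T u (x + t • u) := fun T' l hl hne hx =>
  h T' l hl hne ((add_smul_mem_frontier_tube t).1 hx)

theorem Generic.neg {T : M.Cell} {u x : EuclideanSpace ℝ (Fin d)} (h : M.Generic T u x) :
    M.Generic T (-u) x := fun T' l hl hne hx => h T' l hl hne (by rwa [tube_neg] at hx)

theorem Generic.mem_interior {T T' : M.Cell} {l u x : EuclideanSpace ℝ (Fin d)}
    (h : M.Generic T u x) (hl : l ∈ Λ) (hne : T ≠ T' ∨ l ≠ 0) (hx : x ∈ M.inter T T' l) :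
    x ∈ interior (tube (M.inter T T' l) u) := by
  by_contra hi
  exact h T' l hl hne ⟨subset_closure (subset_tube _ _ hx), hi⟩

/-- Around a generic point the tube of the intersection has interior, so the intersection has
dimension `d - 1` and is listed as a face; corners and lower-dimensional contacts are never met. -/
theorem Generic.exists_side {T T' : M.Cell} {l u x : EuclideanSpace ℝ (Fin d)}
    (h : M.Generic T u x) (hl : l ∈ Λ) (hne : T ≠ T' ∨ l ≠ 0) (hx : x ∈ M.inter T T' l) :
    ∃ o, M.own o = T ∧ M.nbr o = T' ∧ M.offset o = l := by
  refine M.exists_side hl hne ⟨x, hx⟩ ?_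
  rw [finrank_vectorSpan_add_one_of_mem_interior_tube (M.convex_inter T T' l) ⟨x, hx⟩
    (M.interior_inter_eq_empty hl hne) (h.mem_interior hl hne hx), finrank_euclideanSpace_fin]

/-- A point of the facet belongs to both elements, so the separation inequality holds in both
directions. -/
theorem inner_outer_eq {o : M.Side} {x y : EuclideanSpace ℝ (Fin d)} (hx : x ∈ M.facet o)
    (hy : y ∈ M.facet o) : inner ℝ (M.outer o) y = inner ℝ (M.outer o) x :=
  le_antisymm (M.inner_outer_le o hy.1 hx.2) (M.inner_outer_le o hx.1 hy.2)

/-- An interior point of a set on one side of a hyperplane is not on the hyperplane. -/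
theorem _root_.inner_lt_of_mem_interior {V : Type*} [NormedAddCommGroup V] [InnerProductSpace ℝ V]
    {S : Set V} {n p : V} {c : ℝ} (hn : n ≠ 0) (hS : ∀ x ∈ S, inner ℝ n x ≤ c)
    (hp : p ∈ interior S) : inner ℝ n p < c := by
  have h1 : ContinuousAt (fun t : ℝ => p + t • n) 0 := by fun_prop
  have h2 : ∀ᶠ t in nhdsWithin (0 : ℝ) (Set.Ioi 0), p + t • n ∈ S :=
    nhdsWithin_le_nhds (h1 (by simpa using mem_interior_iff_mem_nhds.1 hp))
  obtain ⟨t, ht, ht0⟩ := (h2.and self_mem_nhdsWithin).exists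
  have := hS _ ht
  rw [inner_add_right, inner_smul_right] at this
  have := mul_pos (show 0 < t from ht0) (real_inner_self_pos.2 hn)
  linarith

theorem outer_ne_zero (o : M.Side) : M.outer o ≠ 0 := by
  rw [← norm_ne_zero_iff, M.norm_outer]
  exact one_ne_zero

/-- If `u` were parallel to the facet, the tube would stay inside a hyperplane and have no interior
point. -/
theorem Generic.inner_outer_ne_zero {u x : EuclideanSpace ℝ (Fin d)} {o : M.Side}
    (h : M.Generic (M.own o) u x) (hx : x ∈ M.facet o) : inner ℝ (M.outer o) u ≠ 0 := by
  intro h0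
  have h1 := h.mem_interior (M.offset_mem o) (M.own_ne o) hx
  refine (inner_lt_of_mem_interior (outer_ne_zero o) (c := inner ℝ (M.outer o) x) ?_ h1).false
  rintro y ⟨t, hy⟩
  have := inner_outer_eq hx hy
  rw [inner_add_right, inner_smul_right, h0] at this
  linarith

/-- Through a facet whose outer normal has a positive component in the direction `u`, a generic
line in the direction `u` passes from the element to its neighbour. -/
theorem Generic.eventually_crossing {u x : EuclideanSpace ℝ (Fin d)} {o : M.Side}
    (h : M.Generic (M.own o) u x) (hx : x ∈ M.facet o) (hu : 0 < inner ℝ (M.outer o) u) :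
    ∀ᶠ t in nhdsWithin (0 : ℝ) (Set.Ioi 0), x - t • u ∈ interior (M.cell (M.own o)) ∧
      x + t • u - M.offset o ∈ interior (M.cell (M.nbr o)) := by
  have h1 := h.mem_interior (M.offset_mem o) (M.own_ne o) hx
  have hsub : ∀ y ∈ M.facet o, inner ℝ (M.outer o) y = inner ℝ (M.outer o) x :=
    fun y hy => inner_outer_eq hx hy
  obtain ⟨p, hp⟩ := M.nonempty_interior (M.own o)
  obtain ⟨q, hq⟩ := M.nonempty_interior (M.nbr o)
  refine (eventually_sub_smul_mem_interior (M.convex_cell _) (fun y hy => hy.1) hsub hp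
    (inner_lt_of_mem_interior (outer_ne_zero o)
      (fun y hy => M.inner_outer_le o hy hx.2) hp) hu hx h1).and ?_
  set N := (Homeomorph.subRight (M.offset o)) ⁻¹' M.cell (M.nbr o) with hN
  have hNi : interior N = (Homeomorph.subRight (M.offset o)) ⁻¹' interior (M.cell (M.nbr o)) :=
    (Homeomorph.preimage_interior _ _).symm
  have hNc : Convex ℝ N := M.convex_translate_cell _ _
  have hq' : q + M.offset o ∈ interior N := by
    rw [hNi]
    simpa using hq
  have hn0 : -M.outer o ≠ 0 := neg_ne_zero.2 (outer_ne_zero o)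
  -- The second half is the same statement for the neighbour, with normal and direction reversed.
  have := eventually_sub_smul_mem_interior (T := N) (A := M.facet o) (n := -M.outer o) (u := -u)
    (c := -inner ℝ (M.outer o) x) hNc (fun y hy => hy.2)
    (fun y hy => by rw [inner_neg_left, hsub y hy]) hq'
    (inner_lt_of_mem_interior hn0
      (fun y hy => by
        rw [inner_neg_left]
        exact neg_le_neg (M.inner_outer_le o hx.1 hy)) hq') (by simpa using hu) hx
    (by rw [tube_neg]; exact h1)
  filter_upwards [this] with t ht
  rw [hNi] at ht
  simpa using ht

/-- Points outside `T` close to `x` lie in other translated elements. By local finiteness finitely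
many of these suffice, so their union is closed and contains `x`. -/
theorem exists_mem_inter_of_mem_frontier {T : M.Cell} {x : EuclideanSpace ℝ (Fin d)}
    (hx : x ∈ frontier (M.cell T)) :
    ∃ T', ∃ l ∈ Λ, (T ≠ T' ∨ l ≠ 0) ∧ x ∈ M.inter T T' l := by
  have hxT : x ∈ M.cell T := (M.isClosed_cell T).frontier_subset hx
  set B := Metric.closedBall x 1
  have hfin := M.locallyFinite B (isCompact_closedBall x 1)
  set J := {Tl : M.Cell × EuclideanSpace ℝ (Fin d) | Tl.2 ∈ Λ ∧ ∃ x ∈ B, x - Tl.2 ∈ M.cell Tl.1}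
  set J' := {Tl ∈ J | T ≠ Tl.1 ∨ Tl.2 ≠ 0}
  have hJ' : J'.Finite := hfin.subset fun _ h => h.1
  set C := ⋃ Tl ∈ J', (Homeomorph.subRight Tl.2) ⁻¹' M.cell Tl.1
  have hC : IsClosed C := hJ'.isClosed_biUnion fun Tl _ =>
    (M.isClosed_cell _).preimage (Homeomorph.subRight _).continuous
  have hxC : x ∈ C := by
    rw [← hC.closure_eq]
    have h1 : x ∈ closure (M.cell T)ᶜ := (frontier_subset_closure (s := (M.cell T)ᶜ))
      (by rwa [frontier_compl])
    have h2 : x ∈ closure ((M.cell T)ᶜ ∩ Metric.ball x 1) := by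
      rw [Set.inter_comm]
      exact Metric.isOpen_ball.inter_closure ⟨Metric.mem_ball_self one_pos, h1⟩
    refine closure_mono ?_ h2
    rintro y ⟨hyT, hyB⟩
    obtain ⟨T', l, hl, hy⟩ := M.cover y
    refine Set.mem_biUnion (x := (T', l)) ⟨⟨hl, y, Metric.ball_subset_closedBall hyB, hy⟩, ?_⟩ hy
    by_contra hcon
    push Not at hcon
    obtain ⟨rfl, hl0⟩ := hcon
    simp only at hl0
    subst hl0
    exact hyT (by simpa using hy)
  simp only [C, Set.mem_iUnion] at hxC
  obtain ⟨⟨T', l⟩, hTl, hx'⟩ := hxC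
  exact ⟨T', l, hTl.1.1, hTl.2, hxT, hx'⟩

/-- A generic line does not meet the element again after having left it. -/
theorem Generic.le_of_mem_facet {T : M.Cell} {u x : EuclideanSpace ℝ (Fin d)}
    (h : M.Generic T u x) {o : M.Side} (ho : M.own o = T) (hu : 0 < inner ℝ (M.outer o) u) {t : ℝ}
    (hx : x + t • u ∈ M.facet o) {t₁ : ℝ} (ht₁ : x + t₁ • u ∈ M.cell T) : t₁ ≤ t := by
  by_contra! hlt
  subst ho
  have hg := h.add_smul t
  have hsm : ∀ᶠ s in nhdsWithin (0 : ℝ) (Set.Ioi 0), s ∈ Set.Ioo 0 (t₁ - t) :=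
    Ioo_mem_nhdsGT (by linarith)
  obtain ⟨s, ⟨-, hs1⟩, hs2⟩ := ((hg.eventually_crossing hx hu).and hsm).exists
  refine M.notMem_cell_of_mem_interior (M.offset_mem o) (M.own_ne o) hs1 ?_
  have hlen : 0 < t₁ - t := by linarith
  -- A point just behind the facet is interior to the neighbour, but convexity of `T` between times
  -- `t` and `t₁` would put it into `T` as well.
  have := (M.convex_cell (M.own o)) hx.1 ht₁ (a := 1 - s / (t₁ - t)) (b := s / (t₁ - t))
    (by rw [sub_nonneg, div_le_one hlen]; exact hs2.2.le) (div_nonneg hs2.1.le hlen.le) (by ring)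
  convert this using 1
  have e1 : s = s / (t₁ - t) * (t₁ - t) := (div_mul_cancel₀ _ hlen.ne').symm
  nth_rw 1 [e1]
  module

/-- A generic line that leaves the element `T` in the time interval `(0, ε)` does so through exactly
one facet. -/
theorem Generic.existsUnique_exit {T : M.Cell} {u x : EuclideanSpace ℝ (Fin d)} {ε : ℝ}
    (h : M.Generic T u x) (hM : x ∈ shadow (M.cell T) u ε) (hε : x + ε • u ∉ M.cell T) :
    ∃! o, M.own o = T ∧ 0 < inner ℝ (M.outer o) u ∧ x ∈ shadow (M.facet o) u ε := by
  obtain ⟨t₀, ht₀, hxt₀⟩ := hM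
  set I : Set ℝ := {t | t ∈ Set.Icc t₀ ε ∧ x + t • u ∈ M.cell T} with hI
  have hIc : IsClosed I := isClosed_Icc.inter ((M.isClosed_cell T).preimage (by fun_prop))
  have hIb : BddAbove I := ⟨ε, fun t ht => ht.1.2⟩
  have hIn : I.Nonempty := ⟨t₀, ⟨le_rfl, ht₀.2.le⟩, hxt₀⟩
  -- The last time up to `ε` at which the line is in `T`; the facet through this point is the exit.
  set t := sSup I with ht
  have htI : t ∈ I := hIc.csSup_mem hIn hIb
  have htε : t < ε := lt_of_le_of_ne htI.1.2 fun hh => hε (hh ▸ htI.2)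
  have ht0 : 0 < t := ht₀.1.trans_le htI.1.1
  have hafter : ∀ s, 0 < s → s < ε - t → x + t • u + s • u ∉ M.cell T := by
    intro s hs hs' hmem
    have : t + s ∈ I := ⟨⟨by linarith [htI.1.1], by linarith⟩, by
      convert hmem using 1
      module⟩
    linarith [le_csSup hIb this]
  have hsmall : ∀ᶠ s in nhdsWithin (0 : ℝ) (Set.Ioi 0), 0 < s ∧ s < ε - t :=
    Ioo_mem_nhdsGT (by linarith)
  have hfr : x + t • u ∈ frontier (M.cell T) := by
    rw [(M.isClosed_cell T).frontier_eq]
    refine ⟨htI.2, fun hint => ?_⟩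
    have hc : ContinuousAt (fun s : ℝ => x + t • u + s • u) 0 := by fun_prop
    have h2 : ∀ᶠ s in nhdsWithin (0 : ℝ) (Set.Ioi 0), x + t • u + s • u ∈ M.cell T :=
      nhdsWithin_le_nhds (hc (by simpa using mem_interior_iff_mem_nhds.1 hint))
    obtain ⟨s, hs1, hs2⟩ := (h2.and hsmall).exists
    exact hafter s hs2.1 hs2.2 hs1
  obtain ⟨T', l, hl, hne, hmem⟩ := exists_mem_inter_of_mem_frontier hfr
  obtain ⟨o, rfl, rfl, rfl⟩ := (h.add_smul t).exists_side hl hne hmem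
  -- Otherwise the reversed line would leave `T` here, so `T` would contain points of the line just
  -- after the last time.
  have hpos : 0 < inner ℝ (M.outer o) u := by
    by_contra hneg
    have hne := (h.add_smul t).inner_outer_ne_zero hmem
    have hneg' : 0 < inner ℝ (M.outer o) (-u) := by
      rw [inner_neg_right]
      exact neg_pos.2 (lt_of_le_of_ne (not_lt.1 hneg) hne)
    obtain ⟨s, ⟨hs1, -⟩, hs2⟩ :=
      (((h.add_smul t).neg.eventually_crossing hmem hneg').and hsmall).exists
    exact hafter s hs2.1 hs2.2 (by simpa using interior_subset hs1)
  refine ⟨o, ⟨rfl, hpos, t, ⟨ht0, htε⟩, hmem⟩, ?_⟩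
  rintro o' ⟨ho', hpos', t', ht', hmem'⟩
  -- Two exits happen at the same time. Just afterwards the line is in the interior of both
  -- neighbours, which must then be the same translated element.
  have htt : t' = t := le_antisymm (h.le_of_mem_facet rfl hpos hmem (ho' ▸ hmem'.1))
    (h.le_of_mem_facet ho' hpos' hmem' htI.2)
  rw [htt] at hmem'
  have hg' : M.Generic (M.own o') u (x + t • u) := by
    rw [ho']
    exact h.add_smul t
  obtain ⟨s, ⟨-, hs1⟩, -, hs2⟩ := (((h.add_smul t).eventually_crossing hmem hpos).and
    (hg'.eventually_crossing hmem' hpos')).exists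
  by_contra hoo
  have hdiff : M.nbr o ≠ M.nbr o' ∨ M.offset o' - M.offset o ≠ 0 := by
    by_contra! hcon
    exact hoo (M.side_injective ho' hcon.1.symm (sub_eq_zero.1 hcon.2))
  refine M.disjoint_interior _ _ _ (Λ.sub_mem (M.offset_mem o') (M.offset_mem o)) hdiff _ hs1 ?_
  convert hs2 using 1
  abel

/-- A generic line with positive component of the outer normal at a facet leaves `T` there. -/
theorem Generic.exit_of_mem_shadow_facet {T : M.Cell} {u x : EuclideanSpace ℝ (Fin d)} {ε : ℝ}
    (h : M.Generic T u x) {o : M.Side} (ho : M.own o = T) (hu : 0 < inner ℝ (M.outer o) u)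
    (hx : x ∈ shadow (M.facet o) u ε) :
    x ∈ shadow (M.cell T) u ε ∧ x + ε • u ∉ M.cell T := by
  obtain ⟨t, ht, hxt⟩ := hx
  refine ⟨⟨t, ht, ho ▸ hxt.1⟩, fun hmem => ?_⟩
  exact absurd (h.le_of_mem_facet ho hu hxt hmem) (not_le.2 ht.2)

/-- The number of exits through facets. -/
theorem Generic.sum_exits {T : M.Cell} {u x : EuclideanSpace ℝ (Fin d)} {ε : ℝ}
    (h : M.Generic T u x) (F : Finset M.Side) (hF : ∀ o ∈ F, M.own o = T)
    (hF' : ∀ o, M.own o = T → x ∈ shadow (M.facet o) u ε → o ∈ F) :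
    (∑ o ∈ F, if 0 < inner ℝ (M.outer o) u then (shadow (M.facet o) u ε).indicator 1 x else 0)
      = ((shadow (M.cell T) u ε) \ {y | y + ε • u ∈ M.cell T}).indicator (1 : EuclideanSpace ℝ (Fin d) → ℝ) x := by
  by_cases hx : x ∈ shadow (M.cell T) u ε ∧ x + ε • u ∉ M.cell T
  · rw [Set.indicator_of_mem (by exact hx)]
    obtain ⟨o, ⟨ho1, ho2, ho3⟩, huniq⟩ := h.existsUnique_exit hx.1 hx.2
    rw [Finset.sum_eq_single_of_mem o (hF' o ho1 ho3), if_pos ho2, Set.indicator_of_mem ho3]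
    intro o' ho' hne
    split_ifs with hu
    · exact Set.indicator_of_notMem (fun hs => hne (huniq o' ⟨hF o' ho', hu, hs⟩)) _
    · rfl
  · rw [Set.indicator_of_notMem (by exact hx)]
    refine Finset.sum_eq_zero fun o ho => ?_
    split_ifs with hu
    · exact Set.indicator_of_notMem (fun hs => hx (h.exit_of_mem_shadow_facet (hF o ho) hu hs)) _
    · rfl

/-- Replacing the time `t` by `ε - t` reverses the segment, so entries into an element become exits
along the reversed segment. -/
theorem shadow_neg (A : Set (EuclideanSpace ℝ (Fin d))) (u x : EuclideanSpace ℝ (Fin d)) (ε : ℝ) :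
    x + ε • u ∈ shadow A (-u) ε ↔ x ∈ shadow A u ε := by
  constructor
  · rintro ⟨t, ht, hx⟩
    refine ⟨ε - t, ⟨by linarith [ht.2], by linarith [ht.1]⟩, ?_⟩
    convert hx using 1
    module
  · rintro ⟨t, ht, hx⟩
    refine ⟨ε - t, ⟨by linarith [ht.2], by linarith [ht.1]⟩, ?_⟩
    convert hx using 1
    module

theorem mem_shadow_of_notMem_frontier {A : Set (EuclideanSpace ℝ (Fin d))}
    {u x : EuclideanSpace ℝ (Fin d)} {ε : ℝ} (hε : 0 < ε) (hx : x ∈ A) (hxf : x ∉ frontier A) :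
    x ∈ shadow A u ε := by
  have hi : x ∈ interior A := by
    by_contra hi
    exact hxf ⟨subset_closure hx, hi⟩
  have hc : ContinuousAt (fun t : ℝ => x + t • u) 0 := by fun_prop
  have h2 : ∀ᶠ t in nhdsWithin (0 : ℝ) (Set.Ioi 0), x + t • u ∈ A :=
    nhdsWithin_le_nhds (hc (by simpa using mem_interior_iff_mem_nhds.1 hi))
  obtain ⟨t, ht1, ht2⟩ := (h2.and (Ioo_mem_nhdsGT hε)).exists
  exact ⟨t, ht2, ht1⟩

/-- The change of the indicator function of an element along a segment of a generic line is the
signed number of crossings of its facets. -/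
theorem Generic.indicator_sub_indicator {T : M.Cell} {u x : EuclideanSpace ℝ (Fin d)} {ε : ℝ}
    (hε : 0 < ε) (h : M.Generic T u x) (hx : x ∉ frontier (M.cell T))
    (hx' : x + ε • u ∉ frontier (M.cell T)) (F : Finset M.Side) (hF : ∀ o ∈ F, M.own o = T)
    (hF' : ∀ o, M.own o = T → x ∈ shadow (M.facet o) u ε → o ∈ F) :
    (M.cell T).indicator (1 : EuclideanSpace ℝ (Fin d) → ℝ) x - (M.cell T).indicator 1 (x + ε • u)
      = ∑ o ∈ F, ((SignType.sign (inner ℝ (M.outer o) u) : SignType) : ℝ) *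
          (shadow (M.facet o) u ε).indicator 1 x := by
  have h1 := h.sum_exits F hF hF'
  -- Run backwards from the end point `x + ε • u`, the same count gives the number of entries.
  have h2 := (h.neg.add_smul (-ε)).sum_exits (ε := ε) F hF (fun o ho hs => hF' o ho
    ((shadow_neg _ _ _ _).1 (by simpa using hs)))
  have e : x + -ε • -u = x + ε • u := by module
  have hsum : ∑ o ∈ F, ((SignType.sign (inner ℝ (M.outer o) u) : SignType) : ℝ) *
      (shadow (M.facet o) u ε).indicator (1 : EuclideanSpace ℝ (Fin d) → ℝ) x
      = (∑ o ∈ F, if 0 < inner ℝ (M.outer o) u then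
          (shadow (M.facet o) u ε).indicator (1 : EuclideanSpace ℝ (Fin d) → ℝ) x else 0)
        - ∑ o ∈ F, if 0 < inner ℝ (M.outer o) (-u) then
          (shadow (M.facet o) (-u) ε).indicator (1 : EuclideanSpace ℝ (Fin d) → ℝ) (x + -ε • -u) else 0 := by
    rw [← Finset.sum_sub_distrib]
    refine Finset.sum_congr rfl fun o _ => ?_
    have e2 : (shadow (M.facet o) (-u) ε).indicator (1 : EuclideanSpace ℝ (Fin d) → ℝ) (x + -ε • -u)
        = (shadow (M.facet o) u ε).indicator (1 : EuclideanSpace ℝ (Fin d) → ℝ) x := by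
      rw [e]
      exact Set.indicator_eq_indicator (shadow_neg _ _ _ _) rfl
    rw [e2, inner_neg_right]
    rcases lt_trichotomy (inner ℝ (M.outer o) u) 0 with hu | hu | hu
    · simp [hu, not_lt.2 hu.le]
    · simp [hu]
    · simp [hu, not_lt.2 hu.le]
  rw [hsum, h1, h2]
  -- Off the frontier, an end point in `T` already forces the open segment to meet `T`. In the
  -- remaining case of both end points outside, a segment meeting `T` has one entry and one exit,
  -- which cancel.
  have hiff1 : x ∈ M.cell T → x ∈ shadow (M.cell T) u ε :=
    fun hm => mem_shadow_of_notMem_frontier hε hm hx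
  have hiff2 : x + ε • u ∈ M.cell T → x ∈ shadow (M.cell T) u ε := fun hm =>
    (shadow_neg _ _ _ _).1 (mem_shadow_of_notMem_frontier hε hm hx')
  have e3 : x + ε • u + ε • -u = x := by module
  classical
  simp only [Set.indicator_apply, Set.mem_sdiff, Set.mem_ofPred_eq, e, shadow_neg, e3, Pi.one_apply]
  by_cases a : x ∈ M.cell T <;> by_cases b : x + ε • u ∈ M.cell T <;>
    by_cases c : x ∈ shadow (M.cell T) u ε <;> simp_all

end DGMesh

/-! ### The divergence theorem on one element. -/

theorem measure_hyperplane_inter_lt_top {V : Type*} [NormedAddCommGroup V] [InnerProductSpace ℝ V]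
    [FiniteDimensional ℝ V] [MeasurableSpace V] [BorelSpace V] {n : V} (hn : ‖n‖ = 1) (c : ℝ)
    {K : Set V} (hK : IsCompact K) :
    (μHE[Module.finrank ℝ V - 1] : Measure V) (K ∩ {x | inner ℝ n x = c}) < ⊤ := by
  have hi : Isometry (fun y : ((Submodule.span ℝ {n})ᗮ : Submodule ℝ V) => (y : V) + c • n) :=
    (isometry_add_right (c • n)).comp isometry_subtype_coe
  rw [← Measure.restrict_apply hK.measurableSet, restrict_hyperplane_eq_map hn,
    hi.isClosedEmbedding.measurableEmbedding.map_apply]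
  exact (hi.isClosedEmbedding.isCompact_preimage hK).measure_lt_top

namespace DGMesh

variable {d : ℕ} {Λ : Submodule ℤ (EuclideanSpace ℝ (Fin d))} (M : DGMesh Λ)

/-- Every translated element meets a ball of integer radius around the origin, and each such ball
meets finitely many. -/
theorem countable_translates :
    {Tl : M.Cell × EuclideanSpace ℝ (Fin d) | Tl.2 ∈ Λ}.Countable := by
  have : {Tl : M.Cell × EuclideanSpace ℝ (Fin d) | Tl.2 ∈ Λ} ⊆ ⋃ N : ℕ,
      {Tl : M.Cell × EuclideanSpace ℝ (Fin d) |
        Tl.2 ∈ Λ ∧ ∃ x ∈ Metric.closedBall 0 (N : ℝ), x - Tl.2 ∈ M.cell Tl.1} := by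
    rintro ⟨T, l⟩ hl
    obtain ⟨x, hx⟩ := M.nonempty_interior T
    obtain ⟨N, hN⟩ := exists_nat_ge ‖x + l‖
    exact Set.mem_iUnion.2 ⟨N, hl, x + l, by simpa using hN, by simpa using interior_subset hx⟩
  exact (Set.countable_iUnion fun N : ℕ =>
    (M.locallyFinite _ (isCompact_closedBall 0 (N : ℝ))).countable).mono this

instance : Countable M.Cell := by
  have h := M.countable_translates
  have hinj : Function.Injective
      (fun T : M.Cell => (⟨(T, 0), Λ.zero_mem⟩ : {Tl : M.Cell × EuclideanSpace ℝ (Fin d) | Tl.2 ∈ Λ})) :=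
    fun T T' hT => congrArg (fun z => z.1.1) hT
  exact @Function.Injective.countable _ _ h.to_subtype _ hinj

theorem countable_period (T : M.Cell) : (Λ : Set (EuclideanSpace ℝ (Fin d))).Countable := by
  refine (M.countable_translates.preimage_of_injOn
    (f := fun l => (T, l)) fun l _ l' _ h => (Prod.mk.inj h).2).mono ?_
  exact fun l hl => hl

theorem ae_notMem_frontier_cell (T : M.Cell) : ∀ᵐ x, x ∉ frontier (M.cell T) :=
  measure_eq_zero_iff_ae_notMem.1 ((M.convex_cell T).addHaar_frontier volume)

/-- Only countably many tubes occur, and each is convex, so its frontier is a null set. -/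
theorem ae_generic (T : M.Cell) (u : EuclideanSpace ℝ (Fin d)) : ∀ᵐ x, M.Generic T u x := by
  have h : ∀ᵐ x, ∀ T', ∀ l ∈ (Λ : Set (EuclideanSpace ℝ (Fin d))),
      x ∉ frontier (tube (M.inter T T' l) u) := by
    refine ae_all_iff.2 fun T' => (ae_ball_iff (M.countable_period T)).2 fun l _ => ?_
    exact measure_eq_zero_iff_ae_notMem.1
      ((convex_tube (M.convex_inter T T' l) u).addHaar_frontier volume)
  filter_upwards [h] with x hx T' l hl _ using hx T' l hl

/-- A side is determined by its pair of translated elements, and both of them meet `K`. -/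
theorem finite_facets_inter {K : Set (EuclideanSpace ℝ (Fin d))} (hK : IsCompact K) :
    {o : M.Side | (M.facet o ∩ K).Nonempty}.Finite := by
  have hfin := M.locallyFinite K hK
  refine Set.Finite.of_finite_image (f := fun o => (((M.own o, (0 : EuclideanSpace ℝ (Fin d))),
    (M.nbr o, M.offset o)))) ((hfin.prod hfin).subset ?_) ?_
  · rintro _ ⟨o, ⟨x, hx, hxK⟩, rfl⟩
    exact ⟨⟨Λ.zero_mem, x, hxK, by simpa using hx.1⟩, M.offset_mem o, x, hxK, hx.2⟩
  · intro o _ o' _ h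
    simp only [Prod.mk.injEq] at h
    exact M.side_injective h.1.1 h.2.1 h.2.2

theorem convex_facet (o : M.Side) : Convex ℝ (M.facet o) := M.convex_inter _ _ _

theorem isClosed_facet (o : M.Side) : IsClosed (M.facet o) := M.isClosed_inter _ _ _

theorem measure_facet_inter_lt_top (o : M.Side) {K : Set (EuclideanSpace ℝ (Fin d))}
    (hK : IsCompact K) : (μHE[d - 1] : Measure _) (M.facet o ∩ K) < ⊤ := by
  obtain ⟨x, hx⟩ := M.facet_nonempty o
  have h := measure_hyperplane_inter_lt_top (M.norm_outer o) (inner ℝ (M.outer o) x) hK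
  rw [finrank_euclideanSpace_fin] at h
  refine (measure_mono ?_).trans_lt h
  exact fun y hy => ⟨hy.2, inner_outer_eq hx hy.1⟩

/-- The sign of the crossing times the Jacobian `|⟪n, u⟫|` is the normal component `⟪n, u⟫` itself.
A tangential direction makes both sides zero, so no transversality is needed. -/
theorem integral_indicator_shadow_facet (o : M.Side) (u : EuclideanSpace ℝ (Fin d)) {ε : ℝ}
    (hε : 0 ≤ ε) {g : EuclideanSpace ℝ (Fin d) → ℝ} (hg : Integrable g) :
    ((SignType.sign (inner ℝ (M.outer o) u) : SignType) : ℝ) *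
        ∫ x, (shadow (M.facet o) u ε).indicator g x
      = inner ℝ (M.outer o) u *
        ∫ t in (0 : ℝ)..ε, ∫ x in M.facet o, g (x - t • u) ∂(μHE[d - 1]) := by
  by_cases hu : inner ℝ (M.outer o) u = 0
  · simp [hu]
  obtain ⟨x, hx⟩ := M.facet_nonempty o
  rw [integral_indicator_shadow (M.norm_outer o) hu (M.convex_facet _)
    (M.isClosed_facet o).measurableSet (fun y hy => inner_outer_eq hx hy) hε hg, ← mul_assoc,
    sign_mul_abs, finrank_euclideanSpace_fin]

/-- The divergence theorem for a finite displacement `ε • u`: the crossing identity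
`Generic.indicator_sub_indicator` is multiplied by `G` and integrated. Only facets whose shadow
meets the set `G ≠ 0` have to be listed in `F`. -/
theorem setIntegral_cell_sub {T : M.Cell} {u : EuclideanSpace ℝ (Fin d)} {ε : ℝ} (hε : 0 < ε)
    {G : EuclideanSpace ℝ (Fin d) → ℝ} (hG : Integrable G) (F : Finset M.Side)
    (hF : ∀ o ∈ F, M.own o = T)
    (hF' : ∀ o x, M.own o = T → G x ≠ 0 → x ∈ shadow (M.facet o) u ε → o ∈ F) :
    (∫ x in M.cell T, G x) - ∫ x in M.cell T, G (x - ε • u)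
      = ∑ o ∈ F, inner ℝ (M.outer o) u *
          ∫ t in (0 : ℝ)..ε, ∫ x in M.facet o, G (x - t • u) ∂(μHE[d - 1]) := by
  have hm := (M.isClosed_cell T).measurableSet
  have h1 : ∫ x in M.cell T, G (x - ε • u)
      = ∫ x, ((fun x => x + ε • u) ⁻¹' M.cell T).indicator G x := by
    rw [← integral_indicator hm, ← integral_add_right_eq_self _ (ε • u)]
    congr 1
    ext x
    by_cases hx : x + ε • u ∈ M.cell T
    · rw [Set.indicator_of_mem hx, Set.indicator_of_mem (by exact hx), add_sub_cancel_right]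
    · rw [Set.indicator_of_notMem hx, Set.indicator_of_notMem (by exact hx)]
  rw [h1, ← integral_indicator hm, ← integral_sub (hG.indicator hm)
    (hG.indicator (hm.preimage (by fun_prop)))]
  simp_rw [← M.integral_indicator_shadow_facet _ u hε.le hG, ← integral_const_mul]
  rw [← integral_finsetSum _ fun o _ => (hG.indicator₀
    ((convex_shadow (M.convex_facet _) u ε).nullMeasurableSet volume)).const_mul _]
  refine integral_congr_ae ?_
  have hfr' : ∀ᵐ x, x + ε • u ∉ frontier (M.cell T) :=
    (measurePreserving_add_right volume (ε • u)).quasiMeasurePreserving.ae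
      (M.ae_notMem_frontier_cell T)
  filter_upwards [M.ae_generic T u, M.ae_notMem_frontier_cell T, hfr'] with x hx hxf hxf'
  by_cases hGx : G x = 0
  · have e : ∀ S : Set (EuclideanSpace ℝ (Fin d)), S.indicator G x = 0 := by
      intro S
      by_cases hS : x ∈ S <;> simp [hS, hGx]
    simp [e]
  · have key := hx.indicator_sub_indicator hε hxf hxf' F hF fun o ho hs => hF' o x ho hGx hs
    have e : ∀ S : Set (EuclideanSpace ℝ (Fin d)), S.indicator G x = S.indicator 1 x * G x := by
      intro S
      by_cases hS : x ∈ S <;> simp [hS]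
    simp only [e]
    rw [show ((fun x => x + ε • u) ⁻¹' M.cell T).indicator (1 : EuclideanSpace ℝ (Fin d) → ℝ) x
      = (M.cell T).indicator 1 (x + ε • u) from Set.indicator_eq_indicator Iff.rfl rfl, ← sub_mul,
      key, Finset.sum_mul]
    simp only [mul_assoc]

/-- The divergence theorem on an element, for the derivative in a constant direction of a compactly
supported function. -/
theorem integral_cell_fderiv {T : M.Cell} (u : EuclideanSpace ℝ (Fin d))
    {G : EuclideanSpace ℝ (Fin d) → ℝ} (hG : ContDiff ℝ 1 G) {R : ℝ}
    (hR : ∀ x, R < ‖x‖ → G x = 0) (F : Finset M.Side) (hF : ∀ o ∈ F, M.own o = T)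
    (hF' : ∀ o, M.own o = T → (M.facet o ∩ Metric.closedBall 0 (R + ‖u‖)).Nonempty → o ∈ F) :
    ∫ x in M.cell T, fderiv ℝ G x u
      = ∑ o ∈ F, inner ℝ (M.outer o) u * ∫ x in M.facet o, G x ∂(μHE[d - 1]) := by
  have hGs : HasCompactSupport G := HasCompactSupport.intro (isCompact_closedBall 0 R)
    fun x hx => hR x (by simpa using hx)
  have hGi : Integrable G := hG.continuous.integrable_of_hasCompactSupport hGs
  have hG's : HasCompactSupport (fderiv ℝ G) := hGs.fderiv ℝ
  obtain ⟨C, hC⟩ := hGs.exists_bound_of_continuous hG.continuous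
  have hG'c : Continuous (fderiv ℝ G) := hG.continuous_fderiv one_ne_zero
  obtain ⟨C', hC'⟩ := hG's.exists_bound_of_continuous hG'c
  -- This ball contains the support of `G (· - t • u)` for every `|t| ≤ 1`, so all integrals reduce
  -- to a fixed set of finite measure.
  set B := Metric.closedBall (0 : EuclideanSpace ℝ (Fin d)) (R + ‖u‖) with hB
  have hBc : IsCompact B := isCompact_closedBall _ _
  have hz : ∀ t : ℝ, |t| ≤ 1 → ∀ x ∉ B, G (x - t • u) = 0 := by
    intro t ht x hx
    refine hR _ ?_
    have h1 : R + ‖u‖ < ‖x‖ := by simpa [hB] using hx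
    have h2 : ‖x‖ - ‖t • u‖ ≤ ‖x - t • u‖ := norm_sub_norm_le _ _
    have h3 : ‖t • u‖ ≤ ‖u‖ := by
      rw [norm_smul]
      exact mul_le_of_le_one_left (norm_nonneg _) ht
    linarith
  have hz' : ∀ x ∉ B, fderiv ℝ G x = 0 := by
    intro x hx
    have h1 : R < ‖x‖ := by
      have : R + ‖u‖ < ‖x‖ := by simpa [hB] using hx
      linarith [norm_nonneg u]
    have : G =ᶠ[nhds x] fun _ => 0 := by
      filter_upwards [continuous_norm.continuousAt.eventually (lt_mem_nhds h1)] with y hy using hR y hy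
    rw [this.fderiv_eq]
    simp
  -- the derivative of the volume integral
  have hm := (M.isClosed_cell T).measurableSet
  have hmB := hBc.measurableSet
  have hcut : ∀ t : ℝ, |t| ≤ 1 → ∫ x in M.cell T, G (x - t • u)
      = ∫ x in M.cell T ∩ B, G (x - t • u) := fun t ht =>
    (setIntegral_eq_of_subset_of_forall_sdiff_eq_zero hm Set.inter_subset_left
      fun x hx => hz t ht x fun hxB => hx.2 ⟨hx.1, hxB⟩)
  have hfin : IsFiniteMeasure (volume.restrict (M.cell T ∩ B)) :=
    ⟨by simpa using (measure_mono Set.inter_subset_right).trans_lt hBc.measure_lt_top⟩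
  have hder : ∀ x : EuclideanSpace ℝ (Fin d), ∀ t : ℝ,
      HasDerivAt (fun t : ℝ => G (x - t • u)) (fderiv ℝ G (x - t • u) (-u)) t := by
    intro x t
    have h1 : HasDerivAt (fun t : ℝ => x - t • u) (-u) t := by
      simpa using ((hasDerivAt_id t).smul_const u).const_sub x
    exact ((hG.differentiable one_ne_zero (x - t • u)).hasFDerivAt).comp_hasDerivAt t h1
  have hL : HasDerivAt (fun t : ℝ => ∫ x in M.cell T ∩ B, G (x - t • u))
      (∫ x in M.cell T ∩ B, fderiv ℝ G (x - (0 : ℝ) • u) (-u)) 0 := by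
    refine (hasDerivAt_integral_of_dominated_loc_of_deriv_le (𝕜 := ℝ)
      (F := fun (t : ℝ) x => G (x - t • u)) (F' := fun (t : ℝ) x => fderiv ℝ G (x - t • u) (-u))
      (bound := fun _ => C' * ‖u‖)
      (Filter.univ_mem) ?_ ?_ ?_ ?_ ?_ ?_).2
    · exact Filter.Eventually.of_forall fun t =>
        (hG.continuous.comp (by fun_prop)).aestronglyMeasurable
    · exact Integrable.of_bound (hG.continuous.comp (by fun_prop)).aestronglyMeasurable C
        (Filter.Eventually.of_forall fun x => hC _)
    · exact ((hG'c.comp (by fun_prop)).clm_apply continuous_const).aestronglyMeasurable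
    · refine Filter.Eventually.of_forall fun x t _ => ?_
      refine (ContinuousLinearMap.le_opNorm _ _).trans ?_
      rw [norm_neg]
      exact mul_le_mul_of_nonneg_right (hC' _) (norm_nonneg _)
    · exact integrable_const _
    · exact Filter.Eventually.of_forall fun x t _ => hder x t
  have hL0 : ∫ x in M.cell T ∩ B, fderiv ℝ G (x - (0 : ℝ) • u) (-u)
      = -∫ x in M.cell T, fderiv ℝ G x u := by
    rw [← setIntegral_eq_of_subset_of_forall_sdiff_eq_zero hm
      (Set.inter_subset_left (t := B)) fun x hx => ?_, ← integral_neg]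
    · simp
    · rw [zero_smul, sub_zero, hz' x fun hxB => hx.2 ⟨hx.1, hxB⟩]
      rfl
  rw [hL0] at hL
  -- the derivative of the surface integrals
  have hfcut : ∀ o, ∀ t : ℝ, |t| ≤ 1 → ∫ x in M.facet o, G (x - t • u) ∂(μHE[d - 1])
      = ∫ x in M.facet o ∩ B, G (x - t • u) ∂(μHE[d - 1]) := fun o t ht =>
    (setIntegral_eq_of_subset_of_forall_sdiff_eq_zero (M.isClosed_facet o).measurableSet
      Set.inter_subset_left fun x hx => hz t ht x fun hxB => hx.2 ⟨hx.1, hxB⟩)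
  have hJ : ∀ o, Continuous fun t : ℝ => ∫ x in M.facet o ∩ B, G (x - t • u) ∂(μHE[d - 1]) := by
    intro o
    have : IsFiniteMeasure ((μHE[d - 1]).restrict (M.facet o ∩ B)) :=
      ⟨by simpa using M.measure_facet_inter_lt_top o hBc⟩
    refine continuous_of_dominated (bound := fun _ => C) ?_ ?_ (integrable_const _) ?_
    · exact fun t => (hG.continuous.comp (by fun_prop)).aestronglyMeasurable
    · exact fun t => Filter.Eventually.of_forall fun x => hC _
    · exact Filter.Eventually.of_forall fun x => hG.continuous.comp (by fun_prop)
  have hRd : HasDerivAt (fun ε : ℝ => ∑ o ∈ F, inner ℝ (M.outer o) u *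
      ∫ t in (0 : ℝ)..ε, ∫ x in M.facet o ∩ B, G (x - t • u) ∂(μHE[d - 1]))
      (∑ o ∈ F, inner ℝ (M.outer o) u *
        ∫ x in M.facet o ∩ B, G (x - (0 : ℝ) • u) ∂(μHE[d - 1])) 0 :=
    HasDerivAt.fun_sum fun o _ => (intervalIntegral.integral_hasDerivAt_right
      ((hJ o).intervalIntegrable _ _) ((hJ o).stronglyMeasurableAtFilter _ _)
      (hJ o).continuousAt).const_mul _
  -- The two sides of the finite displacement formula agree for small positive `ε`, so their right
  -- derivatives at `0` are equal.
  have hL' := (hL.const_sub (∫ x in M.cell T, G x)).hasDerivWithinAt (s := Set.Ioi 0)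
  have heq : ∀ ε ∈ Set.Ioo (0 : ℝ) 1, (∫ x in M.cell T, G x) -
      ∫ x in M.cell T ∩ B, G (x - ε • u) = ∑ o ∈ F, inner ℝ (M.outer o) u *
      ∫ t in (0 : ℝ)..ε, ∫ x in M.facet o ∩ B, G (x - t • u) ∂(μHE[d - 1]) := by
    intro ε hε
    rw [← hcut ε (by rw [abs_of_pos hε.1]; exact hε.2.le), M.setIntegral_cell_sub hε.1 hGi F hF]
    · refine Finset.sum_congr rfl fun o _ => ?_
      congr 1
      refine intervalIntegral.integral_congr fun t ht => hfcut o t ?_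
      rw [Set.uIcc_of_le hε.1.le] at ht
      rw [abs_of_nonneg ht.1]
      exact ht.2.trans hε.2.le
    · rintro o x ho hGx ⟨t, ht, hx⟩
      refine hF' o ho ⟨_, hx, ?_⟩
      by_contra hxB
      refine hGx ?_
      have := hz t (by rw [abs_of_pos ht.1]; exact (ht.2.trans hε.2).le) _ hxB
      simpa using this
  have hev : (fun ε : ℝ => (∫ x in M.cell T, G x) - ∫ x in M.cell T ∩ B, G (x - ε • u))
      =ᶠ[nhdsWithin 0 (Set.Ioi 0)] fun ε : ℝ => ∑ o ∈ F, inner ℝ (M.outer o) u *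
      ∫ t in (0 : ℝ)..ε, ∫ x in M.facet o ∩ B, G (x - t • u) ∂(μHE[d - 1]) :=
    Filter.eventuallyEq_of_mem (Ioo_mem_nhdsGT one_pos) heq
  have hL'' := hRd.hasDerivWithinAt (s := Set.Ioi 0) |>.congr_of_eventuallyEq hev (by
    rw [← hcut 0 (by simp)]
    simp)
  have := (uniqueDiffWithinAt_Ioi (0 : ℝ)).eq_deriv _ hL' hL''
  rw [neg_neg] at this
  rw [this]
  refine Finset.sum_congr rfl fun o _ => ?_
  rw [← hfcut o 0 (by simp)]
  simp

end DGMesh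

/-! ### Series of integrals over a family of measures, for sums over elements and over faces. -/

section FamIntegral

variable {ι α : Type*} [MeasurableSpace α] {μ : ι → Measure α}

/-- Absolute convergence of `∑_i ∫ g_i dμ_i`. -/
def FamIntegrable (μ : ι → Measure α) (g : ι → α → ℝ) : Prop :=
  (∀ i, Integrable (g i) (μ i)) ∧ Summable fun i => ∫ x, ‖g i x‖ ∂μ i

/-- `∑_i ∫ g_i dμ_i` -/
noncomputable def famSum (μ : ι → Measure α) (g : ι → α → ℝ) : ℝ := ∑' i, ∫ x, g i x ∂μ i

namespace FamIntegrable

variable {f g : ι → α → ℝ}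

theorem summable (h : FamIntegrable μ g) : Summable fun i => ∫ x, g i x ∂μ i :=
  h.2.of_norm_bounded fun _ => norm_integral_le_integral_norm _

theorem mono (h : FamIntegrable μ f) (hg : ∀ i, AEStronglyMeasurable (g i) (μ i))
    (hfg : ∀ i x, ‖g i x‖ ≤ f i x) : FamIntegrable μ g := by
  have h1 : ∀ i, Integrable (g i) (μ i) := fun i =>
    (h.1 i).mono' (hg i) (Filter.Eventually.of_forall (hfg i))
  exact ⟨h1, h.summable.of_nonneg_of_le (fun i => integral_nonneg fun x => norm_nonneg _)
    fun i => integral_mono (h1 i).norm (h.1 i) (hfg i)⟩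

theorem norm (h : FamIntegrable μ g) : FamIntegrable μ fun i x => ‖g i x‖ :=
  ⟨fun i => (h.1 i).norm, by simpa using h.2⟩

theorem add (hf : FamIntegrable μ f) (hg : FamIntegrable μ g) :
    FamIntegrable μ fun i x => f i x + g i x := by
  refine ⟨fun i => (hf.1 i).add (hg.1 i), (hf.2.add hg.2).of_nonneg_of_le
    (fun i => integral_nonneg fun x => norm_nonneg _) fun i => ?_⟩
  rw [← integral_add (hf.1 i).norm (hg.1 i).norm]
  exact integral_mono ((hf.1 i).add (hg.1 i)).norm ((hf.1 i).norm.add (hg.1 i).norm)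
    fun x => norm_add_le _ _

theorem const_mul (c : ℝ) (hf : FamIntegrable μ f) : FamIntegrable μ fun i x => c * f i x := by
  refine ⟨fun i => (hf.1 i).const_mul c, ?_⟩
  simp only [norm_mul, integral_const_mul]
  exact hf.2.mul_left _

theorem neg (hf : FamIntegrable μ f) : FamIntegrable μ fun i x => -f i x := by
  simpa using hf.const_mul (-1)

theorem sub (hf : FamIntegrable μ f) (hg : FamIntegrable μ g) :
    FamIntegrable μ fun i x => f i x - g i x := by
  simpa only [sub_eq_add_neg] using hf.add hg.neg

theorem zero : FamIntegrable μ fun _ _ => (0 : ℝ) := ⟨fun _ => integrable_zero _ _ _, by simp⟩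

theorem finset_sum {κ : Type*} (s : Finset κ) {g : κ → ι → α → ℝ}
    (h : ∀ k ∈ s, FamIntegrable μ (g k)) : FamIntegrable μ fun i x => ∑ k ∈ s, g k i x := by
  classical
  induction s using Finset.induction_on with
  | empty => simpa using zero
  | insert a s ha ih =>
    simp only [Finset.sum_insert ha]
    exact (h a (Finset.mem_insert_self _ _)).add
      (ih fun k hk => h k (Finset.mem_insert_of_mem hk))

theorem of_finite [Finite ι] (h : ∀ i, Integrable (g i) (μ i)) : FamIntegrable μ g :=
  ⟨h, Summable.of_finite⟩

theorem of_lintegral_lt_top (h0 : ∀ i x, 0 ≤ g i x) (hg : ∀ i, AEStronglyMeasurable (g i) (μ i))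
    (h : ∑' i, ∫⁻ x, ENNReal.ofReal (g i x) ∂μ i < ⊤) : FamIntegrable μ g := by
  have hi : ∀ i, ∫⁻ x, ENNReal.ofReal (g i x) ∂μ i ≠ ⊤ := fun i =>
    ((ENNReal.le_tsum i).trans_lt h).ne
  have hint : ∀ i, Integrable (g i) (μ i) := fun i =>
    ⟨hg i, (hasFiniteIntegral_iff_ofReal (Filter.Eventually.of_forall (h0 i))).2 (hi i).lt_top⟩
  refine ⟨hint, ?_⟩
  refine (ENNReal.summable_toReal h.ne).congr fun i => ?_
  rw [integral_congr_ae (g := g i) (Filter.Eventually.of_forall fun x => by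
    simp [abs_of_nonneg (h0 i x)]),
    integral_eq_lintegral_of_nonneg_ae (Filter.Eventually.of_forall (h0 i)) (hg i)]

end FamIntegrable

variable {f g : ι → α → ℝ}

theorem famSum_add (hf : FamIntegrable μ f) (hg : FamIntegrable μ g) :
    famSum μ (fun i x => f i x + g i x) = famSum μ f + famSum μ g := by
  unfold famSum
  rw [← hf.summable.tsum_add hg.summable]
  exact tsum_congr fun i => integral_add (hf.1 i) (hg.1 i)

theorem famSum_sub (hf : FamIntegrable μ f) (hg : FamIntegrable μ g) :
    famSum μ (fun i x => f i x - g i x) = famSum μ f - famSum μ g := by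
  unfold famSum
  rw [← hf.summable.tsum_sub hg.summable]
  exact tsum_congr fun i => integral_sub (hf.1 i) (hg.1 i)

theorem famSum_const_mul (c : ℝ) : famSum μ (fun i x => c * f i x) = c * famSum μ f := by
  unfold famSum
  rw [← tsum_mul_left]
  exact tsum_congr fun i => integral_const_mul _ _

theorem famSum_mul_const (c : ℝ) : famSum μ (fun i x => f i x * c) = famSum μ f * c := by
  simp only [mul_comm _ c]
  exact famSum_const_mul c

theorem famSum_neg : famSum μ (fun i x => -f i x) = -famSum μ f := by
  simpa using famSum_const_mul (μ := μ) (f := f) (-1)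

theorem famSum_finset_sum {κ : Type*} (s : Finset κ) {g : κ → ι → α → ℝ}
    (h : ∀ k ∈ s, FamIntegrable μ (g k)) :
    famSum μ (fun i x => ∑ k ∈ s, g k i x) = ∑ k ∈ s, famSum μ (g k) := by
  unfold famSum
  rw [← Summable.tsum_finsetSum fun k hk => (h k hk).summable]
  exact tsum_congr fun i => integral_finsetSum _ fun k hk => (h k hk).1 i

/-- Dominated convergence twice: inside each integral, and for the series. -/
theorem tendsto_famSum {F : ℕ → ι → α → ℝ} (hf : FamIntegrable μ f)
    (hF : ∀ n i, AEStronglyMeasurable (F n i) (μ i)) (hb : ∀ n i x, ‖F n i x‖ ≤ f i x)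
    (hlim : ∀ i x, Filter.Tendsto (fun n => F n i x) Filter.atTop (nhds (g i x))) :
    Filter.Tendsto (fun n => famSum μ (F n)) Filter.atTop (nhds (famSum μ g)) := by
  refine tendsto_tsum_of_dominated_convergence hf.summable (fun i => ?_)
    (Filter.Eventually.of_forall fun n i => ?_)
  · exact tendsto_integral_of_dominated_convergence (f i) (fun n => hF n i) (hf.1 i)
      (fun n => Filter.Eventually.of_forall (hb n i)) (Filter.Eventually.of_forall (hlim i))
  · exact norm_integral_le_of_norm_le (hf.1 i) (Filter.Eventually.of_forall (hb n i))

end FamIntegral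

/-! ### The divergence theorem for broken functions. -/

namespace DGMesh

variable {d : ℕ} {Λ : Submodule ℤ (EuclideanSpace ℝ (Fin d))} (M : DGMesh Λ)

/-- the Lebesgue measure on the elements -/
noncomputable def cellMeasure (T : M.Cell) : Measure (EuclideanSpace ℝ (Fin d)) :=
  volume.restrict (M.cell T)

/-- the surface measure on the faces -/
noncomputable def faceMeasure (e : M.Face) : Measure (EuclideanSpace ℝ (Fin d)) :=
  (μHE[d - 1]).restrict (M.face e)

theorem cellSum_eq (g : M.Broken) : M.cellSum g = famSum M.cellMeasure g := rfl

theorem faceSum_eq (g : M.Face → EuclideanSpace ℝ (Fin d) → ℝ) :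
    M.faceSum g = famSum M.faceMeasure g := rfl

theorem isClosed_face (e : M.Face) : IsClosed (M.face e) := M.isClosed_facet (Sum.inl e)

theorem integrable_faceMeasure_of_hasCompactSupport (e : M.Face)
    {g : EuclideanSpace ℝ (Fin d) → ℝ} (hg : Continuous g) (hs : HasCompactSupport g) :
    Integrable g (M.faceMeasure e) := by
  have h1 : IntegrableOn g (M.face e ∩ tsupport g) (μHE[d - 1]) := by
    have : IsFiniteMeasure ((μHE[d - 1]).restrict (M.face e ∩ tsupport g)) :=
      ⟨by simpa [facet_inl] using M.measure_facet_inter_lt_top (Sum.inl e) hs⟩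
    obtain ⟨C, hC⟩ := hs.exists_bound_of_continuous hg
    exact Integrable.of_bound hg.aestronglyMeasurable C (Filter.Eventually.of_forall hC)
  exact h1.of_forall_sdiff_eq_zero (M.isClosed_face e).measurableSet fun x hx =>
    image_eq_zero_of_notMem_tsupport fun h => hx.2 ⟨hx.1, h⟩

/-- Translation invariance moves the facet seen from `T⁺` onto the face, where the integrand becomes
the trace of the periodic extension. -/
theorem setIntegral_facet_inr (e : M.Face) (g : EuclideanSpace ℝ (Fin d) → ℝ) :
    ∫ x in M.facet (Sum.inr e), g x ∂(μHE[d - 1])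
      = ∫ x in M.face e, g (x - M.shift e) ∂(μHE[d - 1]) := by
  have h := (measurePreserving_sub_right (μHE[d - 1] : Measure (EuclideanSpace ℝ (Fin d)))
    (M.shift e)).setIntegral_preimage_emb (MeasurableEquiv.subRight (M.shift e)).measurableEmbedding
    g (M.facet (Sum.inr e))
  rw [← h, facet_inr]
  congr 2
  ext x
  simp

/-- The divergence theorem for compactly supported broken functions. -/
theorem cellSum_fderiv_of_compact_support (u : EuclideanSpace ℝ (Fin d)) {G : M.Broken}
    (hG : ∀ T, ContDiff ℝ 1 (G T)) {R : ℝ} (hR : ∀ T x, R < ‖x‖ → G T x = 0) :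
    M.cellSum (fun T x => fderiv ℝ (G T) x u)
      = M.faceSum fun e x =>
        inner ℝ (M.normal e) u * (M.traceMinus G e x - M.tracePlus G e x) := by
  classical
  set F := (M.finite_facets_inter (isCompact_closedBall 0 (R + ‖u‖))).toFinset with hFdef
  have hF : ∀ o, o ∈ F ↔ (M.facet o ∩ Metric.closedBall 0 (R + ‖u‖)).Nonempty := by
    simp [hFdef]
  set φ : M.Side → ℝ := fun o =>
    inner ℝ (M.outer o) u * ∫ x in M.facet o, G (M.own o) x ∂(μHE[d - 1]) with hφ
  -- A fixed finite set of sides serves all elements at once and is split by the owning element, so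
  -- that the sum over elements becomes a sum over sides.
  have hcell : ∀ T, ∫ x in M.cell T, fderiv ℝ (G T) x u = ∑ o ∈ F with M.own o = T, φ o := by
    intro T
    rw [M.integral_cell_fderiv u (hG T) (hR T) (F.filter fun o => M.own o = T)
      (fun o ho => (Finset.mem_filter.1 ho).2)
      (fun o ho hne => Finset.mem_filter.2 ⟨(hF o).2 hne, ho⟩)]
    refine Finset.sum_congr rfl fun o ho => ?_
    simp only [hφ, (Finset.mem_filter.1 ho).2]
  have hφ0 : ∀ o ∉ F, φ o = 0 := by
    intro o ho
    rw [hF, Set.not_nonempty_iff_eq_empty] at ho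
    simp only [hφ]
    rw [setIntegral_eq_zero_of_forall_eq_zero, mul_zero]
    intro x hx
    refine hR _ _ ?_
    by_contra! hle
    have : x ∈ M.facet o ∩ Metric.closedBall 0 (R + ‖u‖) :=
      ⟨hx, by simpa using hle.trans (le_add_of_nonneg_right (norm_nonneg u))⟩
    simp [ho] at this
  have hsum : Summable φ := summable_of_ne_finset_zero hφ0
  have h1 : M.cellSum (fun T x => fderiv ℝ (G T) x u) = ∑' o, φ o := by
    unfold cellSum
    simp only [hcell]
    rw [tsum_eq_sum (s := F.image M.own), tsum_eq_sum (s := F) hφ0]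
    · exact Finset.sum_fiberwise_of_maps_to (fun o ho => Finset.mem_image_of_mem _ ho) φ
    · intro T hT
      refine Finset.sum_eq_zero fun o ho => ?_
      obtain ⟨ho1, ho2⟩ := Finset.mem_filter.1 ho
      exact absurd (ho2 ▸ Finset.mem_image_of_mem _ ho1) hT
  have hs1 : Summable (φ ∘ Sum.inl) := hsum.comp_injective Sum.inl_injective
  have hs2 : Summable (φ ∘ Sum.inr) := hsum.comp_injective Sum.inr_injective
  -- Each face contributes two sides with opposite outer normals, which produces the difference of
  -- the traces.
  rw [h1, Summable.tsum_sum hs1 hs2]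
  refine (hs1.tsum_add hs2).symm.trans ?_
  refine tsum_congr fun e => ?_
  have hGs : ∀ T, HasCompactSupport (G T) := fun T =>
    HasCompactSupport.intro (isCompact_closedBall 0 R) fun x hx => hR T x (by simpa using hx)
  have hi1 : Integrable (M.traceMinus G e) ((μHE[d - 1]).restrict (M.face e)) :=
    M.integrable_faceMeasure_of_hasCompactSupport e (hG _).continuous (hGs _)
  have hi2 : Integrable (M.tracePlus G e) ((μHE[d - 1]).restrict (M.face e)) :=
    M.integrable_faceMeasure_of_hasCompactSupport e ((hG _).continuous.comp (by fun_prop))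
      ((hGs _).comp_homeomorph (Homeomorph.subRight (M.shift e)))
  rw [integral_const_mul, integral_sub hi1 hi2]
  simp only [hφ, Function.comp_apply, setIntegral_facet_inr]
  simp only [own, outer, Sum.elim_inl, Sum.elim_inr, facet_inl, inner_neg_left]
  change _ = inner ℝ (M.normal e) u * ((∫ x in M.face e, G (M.minus e) x ∂(μHE[d - 1])) -
    ∫ x in M.face e, G (M.plus e) (x - M.shift e) ∂(μHE[d - 1]))
  ring

/-- The divergence theorem for broken functions. -/
theorem cellSum_fderiv (u : EuclideanSpace ℝ (Fin d)) {G : M.Broken}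
    (hG : ∀ T, ContDiff ℝ 1 (G T)) (h1 : FamIntegrable M.cellMeasure G)
    (h2 : FamIntegrable M.cellMeasure fun T x => fderiv ℝ (G T) x u)
    (h3 : FamIntegrable M.faceMeasure (M.traceMinus G))
    (h4 : FamIntegrable M.faceMeasure (M.tracePlus G)) :
    M.cellSum (fun T x => fderiv ℝ (G T) x u)
      = M.faceSum fun e x =>
        inner ℝ (M.normal e) u * (M.traceMinus G e x - M.tracePlus G e x) := by
  -- The cutoff is `χ (r n • x)` with `r n → 0`: it tends to `1` pointwise, and its derivative is of
  -- order `r n`, so the extra term of the product rule disappears in the limit.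
  let χ : ContDiffBump (0 : EuclideanSpace ℝ (Fin d)) := ⟨1, 2, one_pos, one_lt_two⟩
  have hχ : ContDiff ℝ 1 χ := χ.contDiff
  obtain ⟨C, hC⟩ := (χ.hasCompactSupport.fderiv ℝ).exists_bound_of_continuous
    (hχ.continuous_fderiv one_ne_zero)
  have hC0 : 0 ≤ C := (norm_nonneg _).trans (hC 0)
  set r : ℕ → ℝ := fun n => 1 / ((n : ℝ) + 1) with hr
  have hr0 : ∀ n, 0 < r n := fun n => Nat.one_div_pos_of_nat
  have hr1 : ∀ n, r n ≤ 1 := fun n => by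
    rw [hr, div_le_one (by positivity)]
    linarith [Nat.cast_nonneg (α := ℝ) n]
  have hrlim : Filter.Tendsto r Filter.atTop (nhds 0) := tendsto_one_div_add_atTop_nhds_zero_nat
  set X : ℕ → EuclideanSpace ℝ (Fin d) → ℝ := fun n x => χ (r n • x) with hX
  have hXd : ∀ n, ContDiff ℝ 1 (X n) := fun n => hχ.comp (by fun_prop)
  have hX1 : ∀ n x, ‖X n x‖ ≤ 1 := fun n x => by
    rw [Real.norm_eq_abs, abs_of_nonneg χ.nonneg]
    exact χ.le_one
  have hXf : ∀ n x, fderiv ℝ (X n) x u = r n * fderiv ℝ χ (r n • x) u := by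
    intro n x
    have h : HasFDerivAt (fun x : EuclideanSpace ℝ (Fin d) => r n • x)
        (r n • ContinuousLinearMap.id ℝ _) x := (hasFDerivAt_id x).const_smul (r n)
    have := ((hχ.differentiable one_ne_zero (r n • x)).hasFDerivAt.comp x h).fderiv
    rw [show X n = χ ∘ fun x => r n • x from rfl, this]
    simp
  have hXfb : ∀ n x, ‖fderiv ℝ (X n) x u‖ ≤ C * ‖u‖ := by
    intro n x
    rw [hXf, norm_mul, Real.norm_eq_abs, abs_of_pos (hr0 n)]
    calc r n * ‖fderiv ℝ χ (r n • x) u‖ ≤ 1 * ‖fderiv ℝ χ (r n • x) u‖ := by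
          gcongr
          exact hr1 n
      _ ≤ C * ‖u‖ := by
          rw [one_mul]
          exact (ContinuousLinearMap.le_opNorm _ _).trans (by gcongr; exact hC _)
  have hXlim : ∀ x, Filter.Tendsto (fun n => X n x) Filter.atTop (nhds 1) := by
    intro x
    have h : Filter.Tendsto (fun n => r n • x) Filter.atTop (nhds 0) := by
      simpa using hrlim.smul_const x
    have h' : Filter.Tendsto (fun n => χ (r n • x)) Filter.atTop (nhds (χ 0)) :=
      (hχ.continuous.tendsto 0).comp h
    rwa [χ.one_of_mem_closedBall (by simp [χ])] at h'
  have hXflim : ∀ x, Filter.Tendsto (fun n => fderiv ℝ (X n) x u) Filter.atTop (nhds 0) := by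
    intro x
    refine squeeze_zero_norm (a := fun n => r n * (C * ‖u‖)) (fun n => ?_) (by
      simpa using hrlim.mul_const (C * ‖u‖))
    rw [hXf, norm_mul, Real.norm_eq_abs, abs_of_pos (hr0 n)]
    exact mul_le_mul_of_nonneg_left ((ContinuousLinearMap.le_opNorm _ _).trans
      (by gcongr; exact hC _)) (hr0 n).le
  have hXsupp : ∀ n x, 2 / r n < ‖x‖ → X n x = 0 := by
    intro n x hx
    refine χ.zero_of_le_dist ?_
    rw [dist_zero_right, norm_smul, Real.norm_eq_abs, abs_of_pos (hr0 n)]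
    rw [div_lt_iff₀ (hr0 n)] at hx
    simp only [χ]
    linarith
  have hGd : ∀ T x, DifferentiableAt ℝ (G T) x := fun T x => (hG T).differentiable one_ne_zero x
  -- The cutoff is not periodic, hence the shifted argument on the plus side. It also tends to `1`
  -- there.
  have hcut : ∀ n, M.cellSum (fun T x => X n x * fderiv ℝ (G T) x u + G T x * fderiv ℝ (X n) x u)
      = M.faceSum fun e x => inner ℝ (M.normal e) u *
        (X n x * M.traceMinus G e x - X n (x - M.shift e) * M.tracePlus G e x) := by
    intro n
    refine Eq.trans ?_ (M.cellSum_fderiv_of_compact_support u (G := fun T x => X n x * G T x)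
      (fun T => (hXd n).mul (hG T)) (R := 2 / r n)
      (fun T x hx => by rw [hXsupp n x hx, zero_mul]))
    congr 1
    ext T x
    rw [fderiv_fun_mul ((hXd n).differentiable one_ne_zero x) (hGd T x)]
    simp
  have hL : Filter.Tendsto (fun n => M.cellSum fun T x =>
      X n x * fderiv ℝ (G T) x u + G T x * fderiv ℝ (X n) x u) Filter.atTop
      (nhds (M.cellSum fun T x => fderiv ℝ (G T) x u)) := by
    refine tendsto_famSum (f := fun T x => ‖fderiv ℝ (G T) x u‖ + C * ‖u‖ * ‖G T x‖)
      (h2.norm.add (h1.norm.const_mul _)) ?_ ?_ ?_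
    · intro n T
      have c1 := (hG T).continuous
      have c2 := (hXd n).continuous
      have c3 := (hG T).continuous_fderiv one_ne_zero
      have c4 := (hXd n).continuous_fderiv one_ne_zero
      exact Continuous.aestronglyMeasurable (by fun_prop)
    · intro n T x
      refine (norm_add_le _ _).trans ?_
      rw [norm_mul, norm_mul, mul_comm ‖G T x‖]
      gcongr
      · exact mul_le_of_le_one_left (norm_nonneg _) (hX1 n x)
      · exact hXfb n x
    · intro T x
      simpa using ((hXlim x).mul_const _).add ((hXflim x).const_mul (G T x))
  have hRt : Filter.Tendsto (fun n => M.faceSum fun e x => inner ℝ (M.normal e) u *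
        (X n x * M.traceMinus G e x - X n (x - M.shift e) * M.tracePlus G e x)) Filter.atTop
      (nhds (M.faceSum fun e x => inner ℝ (M.normal e) u *
        (M.traceMinus G e x - M.tracePlus G e x))) := by
    refine tendsto_famSum (f := fun e x => ‖u‖ * (‖M.traceMinus G e x‖ + ‖M.tracePlus G e x‖))
      ((h3.norm.add h4.norm).const_mul _) ?_ ?_ ?_
    · intro n e
      have c1 := (hG (M.minus e)).continuous
      have c2 := (hXd n).continuous
      have c3 := (hG (M.plus e)).continuous
      refine Continuous.aestronglyMeasurable ?_
      unfold traceMinus tracePlus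
      fun_prop
    · intro n e x
      rw [norm_mul]
      gcongr
      · exact (norm_inner_le_norm _ _).trans (by rw [M.norm_normal, one_mul])
      · refine (norm_sub_le _ _).trans ?_
        rw [norm_mul, norm_mul]
        gcongr
        · exact mul_le_of_le_one_left (norm_nonneg _) (hX1 n _)
        · exact mul_le_of_le_one_left (norm_nonneg _) (hX1 n _)
    · intro e x
      simpa using (((hXlim x).mul_const _).sub ((hXlim (x - M.shift e)).mul_const _)).const_mul _
  simp only [hcut] at hL
  exact tendsto_nhds_unique hL hRt

end DGMesh

/-! ### Piecewise polynomials, discrete derivatives and weak forms on a compact mesh. -/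

theorem partialDeriv_mul {d : ℕ} (s : Fin d) {f g : EuclideanSpace ℝ (Fin d) → ℝ}
    {x : EuclideanSpace ℝ (Fin d)} (hf : DifferentiableAt ℝ f x) (hg : DifferentiableAt ℝ g x) :
    partialDeriv s (fun x => f x * g x) x = partialDeriv s f x * g x + f x * partialDeriv s g x := by
  simp only [partialDeriv]
  rw [fderiv_fun_mul hf hg]
  simp
  ring

theorem partialDeriv_const_mul {d : ℕ} (s : Fin d) (c : ℝ) {f : EuclideanSpace ℝ (Fin d) → ℝ}
    {x : EuclideanSpace ℝ (Fin d)} (hf : DifferentiableAt ℝ f x) :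
    partialDeriv s (fun x => c * f x) x = c * partialDeriv s f x := by
  simp only [partialDeriv]
  rw [fderiv_const_mul hf]
  simp

theorem partialDeriv_const {d : ℕ} (s : Fin d) (c : ℝ) (x : EuclideanSpace ℝ (Fin d)) :
    partialDeriv s (fun _ => c) x = 0 := by
  simp [partialDeriv]

theorem contDiff_eval_mvPolynomial {d : ℕ} (P : MvPolynomial (Fin d) ℝ) :
    ContDiff ℝ ∞ fun x : EuclideanSpace ℝ (Fin d) => MvPolynomial.eval (fun i => x i) P := by
  induction P using MvPolynomial.induction_on with
  | C a => simpa using contDiff_const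
  | add P Q hP hQ => simpa using hP.add hQ
  | mul_X P i hP =>
    simp only [map_mul, MvPolynomial.eval_X]
    exact hP.mul (by fun_prop)

namespace DGMesh

variable {d : ℕ} {Λ : Submodule ℤ (EuclideanSpace ℝ (Fin d))} (M : DGMesh Λ)

/-- continuously differentiable on every element -/
def IsSmooth (U : M.Broken) : Prop := ∀ T, ContDiff ℝ 1 (U T)

variable {M}

theorem IsPiecewisePoly.isSmooth {p : ℕ} {U : M.Broken} (h : M.IsPiecewisePoly p U) :
    M.IsSmooth U := by
  intro T
  obtain ⟨P, -, hP⟩ := h T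
  rw [show U T = _ from funext hP]
  exact (contDiff_eval_mvPolynomial P).of_le (by exact_mod_cast le_top)

theorem IsSmooth.continuous {U : M.Broken} (h : M.IsSmooth U) (T : M.Cell) : Continuous (U T) :=
  (h T).continuous

theorem IsSmooth.differentiableAt {U : M.Broken} (h : M.IsSmooth U) (T : M.Cell)
    (x : EuclideanSpace ℝ (Fin d)) : DifferentiableAt ℝ (U T) x :=
  (h T).differentiable one_ne_zero x

theorem IsSmooth.continuous_partialDeriv {U : M.Broken} (h : M.IsSmooth U) (T : M.Cell)
    (s : Fin d) : Continuous (partialDeriv s (U T)) :=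
  ((h T).continuous_fderiv one_ne_zero).clm_apply continuous_const

theorem IsSmooth.sum {κ : Type*} [Fintype κ] {U : κ → M.Broken} (h : ∀ k, M.IsSmooth (U k))
    (c : κ → ℝ) : M.IsSmooth fun T x => ∑ k, c k * U k T x :=
  fun T => ContDiff.sum fun k _ => contDiff_const.mul (h k T)

theorem IsPiecewisePoly.sum {p : ℕ} {κ : Type*} [Fintype κ] {U : κ → M.Broken}
    (h : ∀ k, M.IsPiecewisePoly p (U k)) (c : κ → ℝ) :
    M.IsPiecewisePoly p fun T x => ∑ k, c k * U k T x := by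
  intro T
  choose P hP hP' using fun k => h k T
  refine ⟨∑ k, MvPolynomial.C (c k) * P k, ?_, fun x => ?_⟩
  · refine MvPolynomial.totalDegree_finsetSum_le fun k _ => ?_
    exact (MvPolynomial.totalDegree_mul _ _).trans (by simpa using hP k)
  · simp [hP']

theorem isPiecewisePoly_const (p : ℕ) (c : ℝ) : M.IsPiecewisePoly p fun _ _ => c :=
  fun _ => ⟨MvPolynomial.C c, by simp, by simp⟩

theorem IsSmooth.continuous_traceMinus {U : M.Broken} (h : M.IsSmooth U) (e : M.Face) :
    Continuous (M.traceMinus U e) := h.continuous _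

theorem IsSmooth.continuous_tracePlus {U : M.Broken} (h : M.IsSmooth U) (e : M.Face) :
    Continuous (M.tracePlus U e) := (h.continuous _).comp (by fun_prop)

theorem IsSmooth.continuous_avg {U : M.Broken} (h : M.IsSmooth U) (e : M.Face) :
    Continuous (M.avg U e) :=
  continuous_const.mul ((h.continuous_tracePlus e).add (h.continuous_traceMinus e))

theorem IsSmooth.continuous_jump {U : M.Broken} (h : M.IsSmooth U) (e : M.Face) :
    Continuous (M.jump U e) := (h.continuous_traceMinus e).sub (h.continuous_tracePlus e)

theorem avg_sum {κ : Type*} [Fintype κ] (U : κ → M.Broken) (c : κ → ℝ) (e : M.Face)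
    (x : EuclideanSpace ℝ (Fin d)) :
    M.avg (fun T x => ∑ k, c k * U k T x) e x = ∑ k, c k * M.avg (U k) e x := by
  simp only [avg, tracePlus, traceMinus]
  rw [← Finset.sum_add_distrib, Finset.mul_sum]
  exact Finset.sum_congr rfl fun k _ => by ring

theorem inner_normal_single (e : M.Face) (s : Fin d) :
    inner ℝ (M.normal e) (EuclideanSpace.single s (1 : ℝ)) = M.normal e s := by
  simp [EuclideanSpace.inner_single_right]

section Compact

variable [Finite M.Cell]

theorem finite_face (hM : ∀ T, IsCompact (M.cell T)) : Finite M.Face := by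
  have hK : IsCompact (⋃ T, M.cell T) := isCompact_iUnion hM
  have h : {o : M.Side | (M.facet o ∩ ⋃ T, M.cell T).Nonempty} = Set.univ := by
    refine Set.eq_univ_of_forall fun o => ?_
    obtain ⟨x, hx⟩ := M.facet_nonempty o
    exact ⟨x, hx, Set.mem_iUnion.2 ⟨_, hx.1⟩⟩
  have : Finite M.Side := Set.finite_univ_iff.1 (h ▸ M.finite_facets_inter hK)
  exact Finite.of_injective _ (Sum.inl_injective (α := M.Face) (β := M.Face))

theorem famIntegrable_cell (hM : ∀ T, IsCompact (M.cell T)) {g : M.Broken}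
    (hg : ∀ T, Continuous (g T)) : FamIntegrable M.cellMeasure g :=
  FamIntegrable.of_finite fun T => (hg T).continuousOn.integrableOn_compact (hM T)

theorem famIntegrable_face (hM : ∀ T, IsCompact (M.cell T))
    {g : M.Face → EuclideanSpace ℝ (Fin d) → ℝ} (hg : ∀ e, Continuous (g e)) :
    FamIntegrable M.faceMeasure g := by
  have := M.finite_face hM
  refine FamIntegrable.of_finite fun e => ?_
  have hK : IsCompact (M.face e) :=
    (hM (M.minus e)).of_isClosed_subset (M.isClosed_face e) fun x hx => hx.1
  have hfin : IsFiniteMeasure (M.faceMeasure e) := by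
    refine ⟨?_⟩
    have := M.measure_facet_inter_lt_top (Sum.inl e) hK
    rw [facet_inl, Set.inter_self] at this
    simpa [faceMeasure] using this
  obtain ⟨C, hC⟩ := hK.exists_bound_of_continuousOn (hg e).continuousOn
  refine Integrable.of_bound (hg e).aestronglyMeasurable C ?_
  exact (ae_restrict_iff' (M.isClosed_face e).measurableSet).2 (Filter.Eventually.of_forall hC)

/-- A field that is square integrable on the elements may be multiplied by bounded functions. -/
theorem famIntegrable_field_mul (hM : ∀ T, IsCompact (M.cell T))
    {F : EuclideanSpace ℝ (Fin d) → EuclideanSpace ℝ (Fin d)}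
    (hF : ∀ T, MemLp F 2 (volume.restrict (M.cell T))) (s : Fin d) {g : M.Broken}
    (hg : ∀ T, Continuous (g T)) : FamIntegrable M.cellMeasure fun T x => F x s * g T x := by
  refine FamIntegrable.of_finite fun T => ?_
  have : IsFiniteMeasure (volume.restrict (M.cell T)) := ⟨by simpa using (hM T).measure_lt_top⟩
  have h1 : Integrable F (volume.restrict (M.cell T)) := (hF T).integrable one_le_two
  have h2 : IntegrableOn (fun x => F x s) (M.cell T) := by
    have := (EuclideanSpace.proj s : EuclideanSpace ℝ (Fin d) →L[ℝ] ℝ).integrable_comp h1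
    exact this
  exact h2.mul_continuousOn (hg T).continuousOn (hM T)

/-- The discrete product rule. -/
theorem dhat_eq (hM : ∀ T, IsCompact (M.cell T)) (s : Fin d) {U W : M.Broken} (hU : M.IsSmooth U)
    (hW : M.IsSmooth W) :
    M.dhat s U W = -M.cellSum (fun T x => U T x * partialDeriv s (W T) x)
      + M.faceSum fun e x => M.normal e s * M.avg U e x * M.jump W e x := by
  have h := M.cellSum_fderiv (EuclideanSpace.single s (1 : ℝ)) (G := fun T x => U T x * W T x)
    (fun T => (hU T).mul (hW T))
    (famIntegrable_cell hM fun T => (hU.continuous T).mul (hW.continuous T))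
    (famIntegrable_cell hM fun T =>
      IsSmooth.continuous_partialDeriv (U := fun T x => U T x * W T x)
        (fun T => (hU T).mul (hW T)) T s)
    (famIntegrable_face hM fun e => (hU.continuous_traceMinus e).mul (hW.continuous_traceMinus e))
    (famIntegrable_face hM fun e => (hU.continuous_tracePlus e).mul (hW.continuous_tracePlus e))
  have h1 : M.cellSum (fun T x => fderiv ℝ (fun x => U T x * W T x) x
      (EuclideanSpace.single s (1 : ℝ)))
      = M.cellSum (fun T x => partialDeriv s (U T) x * W T x)
        + M.cellSum (fun T x => U T x * partialDeriv s (W T) x) := by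
    refine Eq.trans ?_ (famSum_add
      (famIntegrable_cell hM fun T => (hU.continuous_partialDeriv T s).mul (hW.continuous T))
      (famIntegrable_cell hM fun T => (hU.continuous T).mul (hW.continuous_partialDeriv T s)))
    rw [cellSum_eq]
    congr 1
    ext T x
    exact partialDeriv_mul s (hU.differentiableAt T x) (hW.differentiableAt T x)
  -- The jump of a product is `[U W] = [U] {W} + {U} [W]`.
  have h2 : (M.faceSum fun e x => inner ℝ (M.normal e) (EuclideanSpace.single s (1 : ℝ)) *
      (M.traceMinus (fun T x => U T x * W T x) e x - M.tracePlus (fun T x => U T x * W T x) e x))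
      = (M.faceSum fun e x => M.normal e s * M.jump U e x * M.avg W e x)
        + M.faceSum fun e x => M.normal e s * M.avg U e x * M.jump W e x := by
    refine Eq.trans ?_ (famSum_add
      (famIntegrable_face hM fun e =>
        (continuous_const.mul (hU.continuous_jump e)).mul (hW.continuous_avg e))
      (famIntegrable_face hM fun e =>
        (continuous_const.mul (hU.continuous_avg e)).mul (hW.continuous_jump e)))
    rw [faceSum_eq]
    congr 1
    ext e x
    rw [inner_normal_single]
    simp only [jump, avg, tracePlus, traceMinus]
    ring
  rw [h1, h2] at h
  rw [dhat]
  linarith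

theorem ip_sum_left (hM : ∀ T, IsCompact (M.cell T)) {κ : Type*} [Fintype κ] {U : κ → M.Broken}
    {W : M.Broken} (hU : ∀ k, ∀ T, Continuous (U k T)) (hW : ∀ T, Continuous (W T)) (c : κ → ℝ) :
    M.ip (fun T x => ∑ k, c k * U k T x) W = ∑ k, c k * M.ip (U k) W := by
  have i : ∀ k, FamIntegrable M.cellMeasure fun T x => c k * U k T x * W T x := fun k =>
    famIntegrable_cell hM fun T => (continuous_const.mul (hU k T)).mul (hW T)
  simp only [ip, cellSum_eq, Finset.sum_mul]
  rw [famSum_finset_sum _ fun k _ => i k]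
  refine Finset.sum_congr rfl fun k _ => ?_
  rw [← famSum_const_mul]
  simp only [mul_assoc]

omit [Finite M.Cell] in
theorem ip_comm (U W : M.Broken) : M.ip U W = M.ip W U := by
  simp only [ip, mul_comm]

theorem ip_sub_left (hM : ∀ T, IsCompact (M.cell T)) {U U' W : M.Broken}
    (hU : ∀ T, Continuous (U T)) (hU' : ∀ T, Continuous (U' T)) (hW : ∀ T, Continuous (W T)) :
    M.ip (U - U') W = M.ip U W - M.ip U' W := by
  simp only [ip, cellSum_eq, Pi.sub_apply, sub_mul]
  exact famSum_sub (famIntegrable_cell hM fun T => (hU T).mul (hW T))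
    (famIntegrable_cell hM fun T => (hU' T).mul (hW T))

/-- After summation by parts no derivative falls on `U`, so linearity can be read off. -/
theorem dhat_sum_left (hM : ∀ T, IsCompact (M.cell T)) (s : Fin d) {κ : Type*} [Fintype κ]
    {U : κ → M.Broken} {W : M.Broken} (hU : ∀ k, M.IsSmooth (U k)) (hW : M.IsSmooth W)
    (c : κ → ℝ) :
    M.dhat s (fun T x => ∑ k, c k * U k T x) W = ∑ k, c k * M.dhat s (U k) W := by
  rw [dhat_eq hM s (IsSmooth.sum hU c) hW]
  simp only [dhat_eq hM s (hU _) hW, mul_add, mul_neg, Finset.sum_add_distrib,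
    Finset.sum_neg_distrib]
  congr 1
  · rw [neg_inj]
    simp only [cellSum_eq, Finset.sum_mul, ← famSum_const_mul, ← mul_assoc]
    exact famSum_finset_sum _ fun k _ => famIntegrable_cell hM fun T =>
      (continuous_const.mul ((hU k).continuous T)).mul (hW.continuous_partialDeriv T s)
  · simp only [faceSum_eq, avg_sum, Finset.sum_mul, Finset.mul_sum, ← famSum_const_mul]
    have i : ∀ k, FamIntegrable M.faceMeasure
        fun e x => c k * (M.normal e s * M.avg (U k) e x * M.jump W e x) := fun k =>
      famIntegrable_face hM fun e => continuous_const.mul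
        ((continuous_const.mul ((hU k).continuous_avg e)).mul (hW.continuous_jump e))
    rw [← famSum_finset_sum _ fun k _ => i k]
    congr 1
    ext e x
    exact Finset.sum_congr rfl fun k _ => by ring

/-- The weak form of a linear transport operator with a field, in terms of discrete derivatives. -/
theorem weakForm_eq (hM : ∀ T, IsCompact (M.cell T))
    {F : EuclideanSpace ℝ (Fin d) → EuclideanSpace ℝ (Fin d)}
    (hF : ∀ T, MemLp F 2 (volume.restrict (M.cell T))) {κ : Type*} [Fintype κ]
    {K : κ → M.Broken} {ψ : M.Broken} (hK : ∀ k, M.IsSmooth (K k)) (hψ : M.IsSmooth ψ)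
    (a b : Fin d → κ → ℝ) :
    M.cellSum (fun T x => ∑ s, (-((∑ j, a s j * K j T x) * partialDeriv s (ψ T) x)
        + F x s * (∑ j, b s j * K j T x) * ψ T x))
      + M.faceSum (fun e x => (∑ s, M.normal e s * M.avg (fun T x => ∑ j, a s j * K j T x) e x) *
        M.jump ψ e x)
      = ∑ s, ∑ j, (a s j * M.dhat s (K j) ψ + b s j * M.cellSum fun T x => F x s * (K j T x * ψ T x)) := by
  have i1 : ∀ s j, FamIntegrable M.cellMeasure fun T x => K j T x * partialDeriv s (ψ T) x :=
    fun s j => famIntegrable_cell hM fun T =>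
      ((hK j).continuous T).mul (hψ.continuous_partialDeriv T s)
  have i2 : ∀ s j, FamIntegrable M.cellMeasure fun T x => F x s * (K j T x * ψ T x) :=
    fun s j => famIntegrable_field_mul hM hF s fun T => ((hK j).continuous T).mul (hψ.continuous T)
  have i3 : ∀ s j, FamIntegrable M.faceMeasure
      fun e x => M.normal e s * M.avg (K j) e x * M.jump ψ e x :=
    fun s j => famIntegrable_face hM fun e =>
      (continuous_const.mul ((hK j).continuous_avg e)).mul (hψ.continuous_jump e)
  have h1 : M.cellSum (fun T x => ∑ s, (-((∑ j, a s j * K j T x) * partialDeriv s (ψ T) x)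
        + F x s * (∑ j, b s j * K j T x) * ψ T x))
      = ∑ s, ∑ j, ((-a s j) * M.cellSum (fun T x => K j T x * partialDeriv s (ψ T) x)
        + b s j * M.cellSum fun T x => F x s * (K j T x * ψ T x)) := by
    simp only [cellSum_eq, ← famSum_const_mul]
    simp only [← famSum_add ((i1 _ _).const_mul _) ((i2 _ _).const_mul _)]
    have i4 : ∀ s j, FamIntegrable M.cellMeasure fun T x =>
        -a s j * (K j T x * partialDeriv s (ψ T) x) + b s j * (F x s * (K j T x * ψ T x)) :=
      fun s j => ((i1 s j).const_mul _).add ((i2 s j).const_mul _)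
    simp only [← famSum_finset_sum _ fun j _ => i4 _ j]
    rw [← famSum_finset_sum _ fun s _ => FamIntegrable.finset_sum _ fun j _ => i4 s j]
    congr 1
    ext T x
    refine Finset.sum_congr rfl fun s _ => ?_
    rw [Finset.sum_add_distrib, Finset.sum_mul, Finset.mul_sum, Finset.sum_mul,
      ← Finset.sum_neg_distrib]
    congr 1 <;> exact Finset.sum_congr rfl fun j _ => by ring
  have h2 : M.faceSum (fun e x =>
        (∑ s, M.normal e s * M.avg (fun T x => ∑ j, a s j * K j T x) e x) * M.jump ψ e x)
      = ∑ s, ∑ j, a s j * M.faceSum fun e x => M.normal e s * M.avg (K j) e x * M.jump ψ e x := by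
    simp only [faceSum_eq, ← famSum_const_mul]
    simp only [← famSum_finset_sum _ fun j _ => (i3 _ j).const_mul _]
    rw [← famSum_finset_sum _ fun s _ => FamIntegrable.finset_sum _ fun j _ => (i3 s j).const_mul _]
    congr 1
    ext e x
    rw [Finset.sum_mul]
    refine Finset.sum_congr rfl fun s _ => ?_
    rw [avg_sum, Finset.mul_sum, Finset.sum_mul]
    exact Finset.sum_congr rfl fun j _ => by ring
  rw [h1, h2, ← Finset.sum_add_distrib]
  refine Finset.sum_congr rfl fun s _ => ?_
  rw [← Finset.sum_add_distrib]
  refine Finset.sum_congr rfl fun j _ => ?_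
  rw [dhat_eq hM s (hK j) hψ]
  ring

end Compact

end DGMesh

/-! ### Gaussian-weighted square integrability and the velocity space. -/

section FamSq

variable {ι α : Type*} [MeasurableSpace α] {μ : ι → Measure α} {w : α → ℝ}

/-- Convergence of `∑_i ∫ f_i² w dμ_i`. -/
def FamSqIntegrable (μ : ι → Measure α) (w : α → ℝ) (f : ι → α → ℝ) : Prop :=
  (∀ i, AEStronglyMeasurable (f i) (μ i)) ∧ FamIntegrable μ fun i x => w x * f i x ^ 2

namespace FamSqIntegrable

variable {f g : ι → α → ℝ}

/-- Young's inequality `|f g| ≤ f² + g²`, multiplied by the weight. -/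
theorem mul (hw : ∀ x, 0 ≤ w x) (hwm : ∀ i, AEStronglyMeasurable w (μ i))
    (hf : FamSqIntegrable μ w f) (hg : FamSqIntegrable μ w g) :
    FamIntegrable μ fun i x => f i x * g i x * w x := by
  refine (hf.2.add hg.2).mono (fun i => ((hf.1 i).mul (hg.1 i)).mul (hwm i)) fun i x => ?_
  rw [Real.norm_eq_abs, abs_mul, abs_of_nonneg (hw x), ← mul_add, mul_comm]
  refine mul_le_mul_of_nonneg_left ?_ (hw x)
  rw [abs_le]
  constructor <;> nlinarith [sq_nonneg (f i x + g i x), sq_nonneg (f i x - g i x)]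

theorem const_mul (c : ℝ) (hf : FamSqIntegrable μ w f) :
    FamSqIntegrable μ w fun i x => c * f i x := by
  refine ⟨fun i => (hf.1 i).const_mul c, ?_⟩
  convert hf.2.const_mul (c ^ 2) using 3
  ring

theorem add (hw : ∀ x, 0 ≤ w x) (hwm : ∀ i, AEStronglyMeasurable w (μ i))
    (hf : FamSqIntegrable μ w f) (hg : FamSqIntegrable μ w g) :
    FamSqIntegrable μ w fun i x => f i x + g i x := by
  refine ⟨fun i => (hf.1 i).add (hg.1 i), ?_⟩
  convert (hf.2.add hg.2).add ((hf.mul hw hwm hg).const_mul 2) using 3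
  ring

theorem sum (hw : ∀ x, 0 ≤ w x) (hwm : ∀ i, AEStronglyMeasurable w (μ i)) {κ : Type*}
    (s : Finset κ) {f : κ → ι → α → ℝ} (hf : ∀ k, FamSqIntegrable μ w (f k)) (c : κ → ℝ) :
    FamSqIntegrable μ w fun i x => ∑ k ∈ s, c k * f k i x := by
  classical
  induction s using Finset.induction_on with
  | empty =>
    simp only [Finset.sum_empty]
    refine ⟨fun i => aestronglyMeasurable_const, ?_⟩
    simpa using FamIntegrable.zero
  | insert a s ha ih =>
    simp only [Finset.sum_insert ha]
    exact ((hf a).const_mul (c a)).add hw hwm ih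

end FamSqIntegrable

end FamSq

section Gauss

variable {d : ℕ}

theorem gaussWeight_nonneg (v : EuclideanSpace ℝ (Fin d)) : 0 ≤ gaussWeight v := (Real.exp_pos _).le

theorem contDiff_gaussWeight : ContDiff ℝ 1 (gaussWeight (d := d)) := by
  unfold gaussWeight
  exact (((contDiff_norm_sq ℝ).neg).div_const 2).exp

theorem partialDeriv_gaussWeight (s : Fin d) (v : EuclideanSpace ℝ (Fin d)) :
    partialDeriv s gaussWeight v = -(v s * gaussWeight v) := by
  have h1 : HasFDerivAt (fun v : EuclideanSpace ℝ (Fin d) => ‖v‖ ^ 2) (2 • innerSL ℝ v) v :=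
    (hasStrictFDerivAt_norm_sq v).hasFDerivAt
  have h2 : HasFDerivAt (gaussWeight (d := d)) _ v := ((h1.neg).mul_const (2 : ℝ)⁻¹).exp
  rw [partialDeriv, h2.fderiv]
  simp [gaussWeight, EuclideanSpace.inner_single_right, div_eq_mul_inv]
  ring

end Gauss

namespace DGMesh

variable {d : ℕ} {M : DGMesh (⊥ : Submodule ℤ (EuclideanSpace ℝ (Fin d)))}

theorem shift_eq_zero (e : M.Face) : M.shift e = 0 := (Submodule.mem_bot ℤ).1 (M.shift_mem e)

theorem tracePlus_eq (U : M.Broken) (e : M.Face) (x : EuclideanSpace ℝ (Fin d)) :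
    M.tracePlus U e x = U (M.plus e) x := by
  rw [tracePlus, shift_eq_zero, sub_zero]

/-- Square integrability of a broken function and its traces with the Gaussian weight. -/
structure IsWeightedTest (W : M.Broken) : Prop where
  cell : FamSqIntegrable M.cellMeasure gaussWeight W
  minus : FamSqIntegrable M.faceMeasure gaussWeight (M.traceMinus W)
  plus : FamSqIntegrable M.faceMeasure gaussWeight (M.tracePlus W)

theorem gauss_aesm {ι : Type*} (μ : ι → Measure (EuclideanSpace ℝ (Fin d))) (i : ι) :
    AEStronglyMeasurable gaussWeight (μ i) :=
  contDiff_gaussWeight.continuous.aestronglyMeasurable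

theorem _root_.FamSqIntegrable.gauss_mul {ι : Type*} {μ : ι → Measure (EuclideanSpace ℝ (Fin d))}
    {f g : ι → EuclideanSpace ℝ (Fin d) → ℝ} (hf : FamSqIntegrable μ gaussWeight f)
    (hg : FamSqIntegrable μ gaussWeight g) :
    FamIntegrable μ fun i x => f i x * g i x * gaussWeight x :=
  hf.mul gaussWeight_nonneg (gauss_aesm μ) hg

theorem IsWeightedTest.sum {κ : Type*} [Fintype κ] {U : κ → M.Broken}
    (h : ∀ k, IsWeightedTest (U k)) (c : κ → ℝ) :
    IsWeightedTest fun T v => ∑ k, c k * U k T v :=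
  ⟨FamSqIntegrable.sum gaussWeight_nonneg (gauss_aesm _) _ (fun k => (h k).cell) c,
   FamSqIntegrable.sum gaussWeight_nonneg (gauss_aesm _) _ (fun k => (h k).minus) c,
   FamSqIntegrable.sum gaussWeight_nonneg (gauss_aesm _) _ (fun k => (h k).plus) c⟩

namespace MemVelocitySpace

variable {q : ℕ} {V : M.Broken}

theorem isSmooth (h : M.MemVelocitySpace q V) : M.IsSmooth V := h.1.isSmooth

theorem famIntegrable (h : M.MemVelocitySpace q V) : FamIntegrable M.cellMeasure fun T v =>
    gaussWeight v * ((1 + ‖v‖ ^ 2) * V T v ^ 2 + ‖fderiv ℝ (V T) v‖ ^ 2) := by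
  refine FamIntegrable.of_lintegral_lt_top (fun T v => ?_) (fun T => ?_) h.2.1
  · have := gaussWeight_nonneg v
    positivity
  · have c1 := (contDiff_gaussWeight (d := d)).continuous
    have c2 := h.isSmooth.continuous T
    have c3 := (h.isSmooth T).continuous_fderiv one_ne_zero
    exact Continuous.aestronglyMeasurable (by fun_prop)

/-- The volume condition of the velocity space dominates the squares of `V`, `v_s V` and `∂_s V`
simultaneously; these are the three instances needed. -/
theorem sq_of_le (h : M.MemVelocitySpace q V) {g : M.Broken} (hg : ∀ T, Continuous (g T))
    (hle : ∀ T v, g T v ^ 2 ≤ (1 + ‖v‖ ^ 2) * V T v ^ 2 + ‖fderiv ℝ (V T) v‖ ^ 2) :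
    FamSqIntegrable M.cellMeasure gaussWeight g := by
  refine ⟨fun T => (hg T).aestronglyMeasurable, h.famIntegrable.mono (fun T => ?_) fun T v => ?_⟩
  · exact (contDiff_gaussWeight.continuous.mul ((hg T).pow 2)).aestronglyMeasurable
  · have := gaussWeight_nonneg v
    rw [Real.norm_eq_abs, abs_of_nonneg (by positivity)]
    exact mul_le_mul_of_nonneg_left (hle T v) this

theorem sq_cell (h : M.MemVelocitySpace q V) : FamSqIntegrable M.cellMeasure gaussWeight V :=
  h.sq_of_le (fun T => h.isSmooth.continuous T) fun T v => by
    nlinarith [sq_nonneg (V T v), sq_nonneg ‖fderiv ℝ (V T) v‖, mul_nonneg (sq_nonneg ‖v‖) (sq_nonneg (V T v))]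

theorem sq_coord (h : M.MemVelocitySpace q V) (s : Fin d) :
    FamSqIntegrable M.cellMeasure gaussWeight (M.mulCoord s V) := by
  refine h.sq_of_le (fun T => ?_) fun T v => ?_
  · have := h.isSmooth.continuous T
    unfold mulCoord
    fun_prop
  · have h1 : (v s) ^ 2 ≤ ‖v‖ ^ 2 := by
      have := PiLp.norm_apply_le v s
      rw [← sq_abs (v s)]
      gcongr
      exact this
    simp only [mulCoord, mul_pow]
    nlinarith [sq_nonneg (V T v), sq_nonneg ‖fderiv ℝ (V T) v‖,
      mul_le_mul_of_nonneg_right h1 (sq_nonneg (V T v))]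

theorem sq_partialDeriv (h : M.MemVelocitySpace q V) (s : Fin d) :
    FamSqIntegrable M.cellMeasure gaussWeight fun T v => partialDeriv s (V T) v := by
  refine h.sq_of_le (fun T => h.isSmooth.continuous_partialDeriv T s) fun T v => ?_
  have h1 : |partialDeriv s (V T) v| ≤ ‖fderiv ℝ (V T) v‖ := by
    refine ((fderiv ℝ (V T) v).le_opNorm (EuclideanSpace.single s (1 : ℝ))).trans ?_
    simp
  have h2 : partialDeriv s (V T) v ^ 2 ≤ ‖fderiv ℝ (V T) v‖ ^ 2 := by
    rw [← sq_abs]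
    gcongr
  nlinarith [sq_nonneg (V T v), mul_nonneg (sq_nonneg ‖v‖) (sq_nonneg (V T v))]

theorem famIntegrable_face (h : M.MemVelocitySpace q V) : FamIntegrable M.faceMeasure fun e v =>
    gaussWeight v * (M.traceMinus V e v ^ 2 + M.tracePlus V e v ^ 2) := by
  refine FamIntegrable.of_lintegral_lt_top (fun e v => ?_) (fun e => ?_) h.2.2
  · have := gaussWeight_nonneg v
    positivity
  · have c1 := (contDiff_gaussWeight (d := d)).continuous
    have c2 := h.isSmooth.continuous_traceMinus e
    have c3 := h.isSmooth.continuous_tracePlus e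
    exact Continuous.aestronglyMeasurable (by fun_prop)

theorem isWeightedTest (h : M.MemVelocitySpace q V) : IsWeightedTest V := by
  have key : ∀ g : M.Face → EuclideanSpace ℝ (Fin d) → ℝ, (∀ e, Continuous (g e)) →
      (∀ e v, g e v ^ 2 ≤ M.traceMinus V e v ^ 2 + M.tracePlus V e v ^ 2) →
      FamSqIntegrable M.faceMeasure gaussWeight g := by
    intro g hg hle
    refine ⟨fun e => (hg e).aestronglyMeasurable,
      h.famIntegrable_face.mono (fun e => ?_) fun e v => ?_⟩
    · exact (contDiff_gaussWeight.continuous.mul ((hg e).pow 2)).aestronglyMeasurable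
    · have := gaussWeight_nonneg v
      rw [Real.norm_eq_abs, abs_of_nonneg (by positivity)]
      exact mul_le_mul_of_nonneg_left (hle e v) this
  exact ⟨h.sq_cell, key _ (fun e => h.isSmooth.continuous_traceMinus e) fun e v => by
    linarith [sq_nonneg (M.tracePlus V e v)],
    key _ (fun e => h.isSmooth.continuous_tracePlus e) fun e v => by
    linarith [sq_nonneg (M.traceMinus V e v)]⟩

theorem partialDeriv_weighted (h : M.MemVelocitySpace q V) (s : Fin d) (T : M.Cell)
    (v : EuclideanSpace ℝ (Fin d)) : partialDeriv s (M.weighted V T) v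
      = partialDeriv s (V T) v * gaussWeight v - M.mulCoord s V T v * gaussWeight v := by
  have := partialDeriv_mul s ((contDiff_gaussWeight (d := d)).differentiable one_ne_zero v)
    (h.isSmooth.differentiableAt T v)
  rw [partialDeriv_gaussWeight] at this
  refine this.trans ?_
  simp only [mulCoord]
  ring

theorem famIntegrable_dhat_cell (h : M.MemVelocitySpace q V) (s : Fin d) {W : M.Broken}
    (hW : IsWeightedTest W) :
    FamIntegrable M.cellMeasure fun T v => partialDeriv s (M.weighted V T) v * W T v := by
  convert ((h.sq_partialDeriv s).gauss_mul hW.cell).sub ((h.sq_coord s).gauss_mul hW.cell)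
    using 3 with T v
  rw [h.partialDeriv_weighted]
  ring

/-- The weight is continuous across faces, so it factors out of the jump. What remains is a
combination of four products of traces. -/
theorem famIntegrable_dhat_face (h : M.MemVelocitySpace q V) (s : Fin d) {W : M.Broken}
    (hW : IsWeightedTest W) : FamIntegrable M.faceMeasure
      fun e v => M.normal e s * M.jump (M.weighted V) e v * M.avg W e v := by
  have hV := h.isWeightedTest
  have h1 := (((hV.minus.gauss_mul hW.minus).add (hV.minus.gauss_mul hW.plus)).sub
    ((hV.plus.gauss_mul hW.minus).add (hV.plus.gauss_mul hW.plus)))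
  refine (h1.norm).mono (fun e => ?_) fun e v => ?_
  · have hn : AEStronglyMeasurable (fun _ => M.normal e s) (M.faceMeasure e) :=
      aestronglyMeasurable_const
    have c1 : Continuous (M.jump (M.weighted V) e) := IsSmooth.continuous_jump
      (fun T => contDiff_gaussWeight.mul (h.isSmooth T)) e
    have m1 : AEStronglyMeasurable (M.avg W e) (M.faceMeasure e) :=
      ((hW.plus.1 e).add (hW.minus.1 e)).const_mul _
    exact (hn.mul c1.aestronglyMeasurable).mul m1
  · have hn : |M.normal e s| ≤ 1 := by
      have := PiLp.norm_apply_le (M.normal e) s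
      rwa [M.norm_normal] at this
    have e1 : M.normal e s * M.jump (M.weighted V) e v * M.avg W e v
        = (M.normal e s * (1 / 2)) * (M.traceMinus V e v * M.traceMinus W e v * gaussWeight v +
          M.traceMinus V e v * M.tracePlus W e v * gaussWeight v -
          (M.tracePlus V e v * M.traceMinus W e v * gaussWeight v +
            M.tracePlus V e v * M.tracePlus W e v * gaussWeight v)) := by
      simp only [jump, avg, tracePlus_eq, traceMinus, weighted]
      ring
    rw [e1, norm_mul]
    refine mul_le_of_le_one_left (norm_nonneg _) ?_
    rw [Real.norm_eq_abs, abs_mul, abs_of_pos (one_half_pos (α := ℝ))]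
    linarith

theorem dhat_weighted_sum (h : M.MemVelocitySpace q V) (s : Fin d) {κ : Type*} [Fintype κ]
    {U : κ → M.Broken} (hU : ∀ k, IsWeightedTest (U k)) (c : κ → ℝ) :
    M.dhat s (M.weighted V) (fun T v => ∑ k, c k * U k T v)
      = ∑ k, c k * M.dhat s (M.weighted V) (U k) := by
  simp only [dhat, mul_sub, Finset.sum_sub_distrib, cellSum_eq, faceSum_eq, ← famSum_const_mul]
  congr 1
  · rw [← famSum_finset_sum _ fun k _ => (h.famIntegrable_dhat_cell s (hU k)).const_mul (c k)]
    congr 1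
    ext T v
    rw [Finset.mul_sum]
    exact Finset.sum_congr rfl fun k _ => by ring
  · rw [← famSum_finset_sum _ fun k _ => (h.famIntegrable_dhat_face s (hU k)).const_mul (c k)]
    congr 1
    ext e v
    rw [avg_sum, Finset.mul_sum]
    exact Finset.sum_congr rfl fun k _ => by ring

/-- Summation by parts against a coordinate function. -/
theorem dhat_weighted_coord (h : M.MemVelocitySpace q V) (s s' : Fin d)
    (h1 : IsWeightedTest (fun _ _ => 1 : M.Broken))
    (hc : IsWeightedTest (fun _ v => v s' : M.Broken)) :
    M.dhat s (M.weighted V) (fun _ v => v s')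
      = -((if s = s' then 1 else 0) * M.cellSum fun T v => V T v * gaussWeight v) := by
  have hV := h.isWeightedTest
  have hd : ∀ v : EuclideanSpace ℝ (Fin d), partialDeriv s (fun v => v s') v
      = if s = s' then 1 else 0 := by
    intro v
    have : HasFDerivAt (fun v : EuclideanSpace ℝ (Fin d) => v s')
        (EuclideanSpace.proj s' : EuclideanSpace ℝ (Fin d) →L[ℝ] ℝ) v :=
      (EuclideanSpace.proj s' : EuclideanSpace ℝ (Fin d) →L[ℝ] ℝ).hasFDerivAt
    rw [partialDeriv, this.fderiv]
    simp [eq_comm]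
  have hG : ∀ T, ContDiff ℝ 1 fun v => M.weighted V T v * v s' := fun T =>
    (contDiff_gaussWeight.mul (h.isSmooth T)).mul (by fun_prop)
  have hpd : ∀ T v, fderiv ℝ (fun v => M.weighted V T v * v s') v (EuclideanSpace.single s (1 : ℝ))
      = partialDeriv s (M.weighted V T) v * v s'
        + (if s = s' then 1 else 0) * (V T v * gaussWeight v) := by
    intro T v
    refine (partialDeriv_mul s ((contDiff_gaussWeight.mul (h.isSmooth T)).differentiable
      one_ne_zero v) (g := fun v => v s') (by fun_prop)).trans ?_
    rw [hd]
    change partialDeriv s (M.weighted V T) v * v s' + gaussWeight v * V T v * _ = _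
    ring
  have i1 : FamIntegrable M.cellMeasure fun T v => V T v * gaussWeight v := by
    simpa using hV.cell.gauss_mul h1.cell
  have i2 := h.famIntegrable_dhat_cell s hc
  have key := M.cellSum_fderiv (EuclideanSpace.single s (1 : ℝ))
    (G := fun T v => M.weighted V T v * v s') hG
    (by
      convert hV.cell.gauss_mul hc.cell using 3
      simp only [weighted]
      ring)
    (by
      simp only [hpd]
      exact i2.add (i1.const_mul _))
    (by
      convert hV.minus.gauss_mul hc.minus using 3
      simp only [weighted, traceMinus]
      ring)
    (by
      convert hV.plus.gauss_mul hc.plus using 3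
      simp only [weighted, tracePlus_eq]
      ring)
  simp only [hpd] at key
  have e1 := (famSum_add i2 (i1.const_mul (if s = s' then 1 else 0))).symm
  rw [famSum_const_mul] at e1
  -- A coordinate function has no jump and equals its average, so the face term of the divergence
  -- theorem is exactly the face term in the discrete derivative, and the two cancel.
  have e2 : (M.faceSum fun e x => inner ℝ (M.normal e) (EuclideanSpace.single s (1 : ℝ)) *
      (M.traceMinus (fun T v => M.weighted V T v * v s') e x -
        M.tracePlus (fun T v => M.weighted V T v * v s') e x))
      = M.faceSum fun e v => M.normal e s * M.jump (M.weighted V) e v *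
        M.avg (fun _ v => v s' : M.Broken) e v := by
    congr 1
    ext e v
    rw [inner_normal_single]
    simp only [jump, avg, tracePlus_eq, traceMinus]
    ring
  rw [e2] at key
  rw [dhat, cellSum_eq, cellSum_eq]
  rw [cellSum_eq] at key
  linarith

end MemVelocitySpace

end DGMesh

/-! ### Velocity moments of a low-rank state. -/

namespace DGMesh

variable {d : ℕ} {M : DGMesh (⊥ : Submodule ℤ (EuclideanSpace ℝ (Fin d)))}

theorem wip_comm (V W : M.Broken) : M.wip V W = M.wip W V := by
  simp only [wip, mul_comm (V _ _)]

theorem wip_sum_left {κ : Type*} [Fintype κ] {U : κ → M.Broken} {W : M.Broken}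
    (hU : ∀ k, FamSqIntegrable M.cellMeasure gaussWeight (U k))
    (hW : FamSqIntegrable M.cellMeasure gaussWeight W) (c : κ → ℝ) :
    M.wip (fun T v => ∑ k, c k * U k T v) W = ∑ k, c k * M.wip (U k) W := by
  simp only [wip, cellSum_eq, ← famSum_const_mul]
  rw [← famSum_finset_sum _ fun k _ => ((hU k).gauss_mul hW).const_mul (c k)]
  congr 1
  ext T v
  rw [Finset.sum_mul, Finset.sum_mul]
  exact Finset.sum_congr rfl fun k _ => by ring

end DGMesh

theorem exists_coeff_of_mem_span {κ α β : Type*} [Fintype κ] {U : κ → α → β → ℝ} {f : α → β → ℝ}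
    (h : f ∈ Submodule.span ℝ (Set.range U)) :
    ∃ c : κ → ℝ, f = fun T v => ∑ k, c k * U k T v := by
  obtain ⟨c, hc⟩ := (Submodule.mem_span_range_iff_exists_fun ℝ).1 h
  refine ⟨c, ?_⟩
  rw [← hc]
  ext T v
  simp

section Scheme

open DGMesh

variable {d : ℕ} {Λ : Submodule ℤ (EuclideanSpace ℝ (Fin d))} {Mx : DGMesh Λ}
  {Mv : DGMesh (⊥ : Submodule ℤ (EuclideanSpace ℝ (Fin d)))} {m p q : ℕ}
  {U : Fin m → Mv.Broken} {st : LowRankState Mx Mv m}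

theorem IsVelocityBasis.mem_inl {k : ℕ} {W : Fin k → Mv.Broken} (hV : IsVelocityBasis q U W)
    (a : Fin m) : Mv.MemVelocitySpace q (U a) := hV.1 (Sum.inl a)

theorem IsVelocityBasis.mem_V (hV : IsVelocityBasis q U st.W) (j : Fin m ⊕ Fin st.k) :
    Mv.MemVelocitySpace q (st.V U j) := hV.1 j

theorem IsVelocityBasis.wip_inl (hV : IsVelocityBasis q U st.W) (a : Fin m)
    (j : Fin m ⊕ Fin st.k) : Mv.wip (U a) (st.V U j) = if Sum.inl a = j then 1 else 0 := by
  split_ifs with h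
  · subst h
    exact hV.2.1 (Sum.inl a)
  · exact hV.2.2 (Sum.inl a) j h

namespace LowRankState

theorem K_eq (j : Fin m ⊕ Fin st.k) : st.K j = fun T x => ∑ i, st.S i j * st.X i T x := by
  ext T x
  exact Finset.sum_congr rfl fun i _ => mul_comm _ _

theorem isPiecewisePoly_K (hX : IsSpatialBasis p st.X) (j : Fin m ⊕ Fin st.k) :
    Mx.IsPiecewisePoly p (st.K j) := by
  rw [K_eq]
  exact IsPiecewisePoly.sum hX.1 _

/-- The velocity moments of the basis functions. -/
noncomputable def basisMoment (st : LowRankState Mx Mv m) (U : Fin m → Mv.Broken)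
    (g : EuclideanSpace ℝ (Fin d) → ℝ) (j : Fin m ⊕ Fin st.k) : ℝ :=
  Mv.cellSum fun T v => g v * st.V U j T v * gaussWeight v

theorem moment_eq (g : EuclideanSpace ℝ (Fin d) → ℝ)
    (hg : ∀ j, FamIntegrable Mv.cellMeasure fun T v => g v * st.V U j T v * gaussWeight v) :
    st.moment U g = fun T x => ∑ j, st.basisMoment U g j * st.K j T x := by
  ext T x
  simp only [moment, basisMoment, cellSum_eq, ← famSum_mul_const]
  rw [← famSum_finset_sum]
  · congr 1
    ext T' v
    simp only [f, K]
    rw [Finset.sum_comm, Finset.mul_sum, Finset.mul_sum]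
    refine Finset.sum_congr rfl fun j _ => ?_
    rw [Finset.mul_sum, Finset.mul_sum, Finset.mul_sum]
    exact Finset.sum_congr rfl fun i _ => by ring
  · intro j _
    simpa only [mul_comm] using (hg j).const_mul (st.K j T x)

/-- The fixed functions belong to the orthonormal velocity basis, so a moment in their span does not
see the variable basis functions. -/
theorem basisMoment_of_span (hV : IsVelocityBasis q U st.W) {g : EuclideanSpace ℝ (Fin d) → ℝ}
    {c : Fin m → ℝ} (hg : (fun _ v => g v : Mv.Broken) = fun T v => ∑ a, c a * U a T v) :
    st.basisMoment U g = Sum.elim c 0 := by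
  ext j
  have h1 : st.basisMoment U g j = Mv.wip (fun _ v => g v) (st.V U j) := rfl
  rw [h1, hg, wip_sum_left (fun a => (hV.mem_inl a).sq_cell) (hV.mem_V j).sq_cell]
  simp only [hV.wip_inl]
  cases j with
  | inl b => simp [Sum.inl.injEq]
  | inr b => simp

theorem isWeightedTest_of_span (hV : IsVelocityBasis q U st.W)
    {g : EuclideanSpace ℝ (Fin d) → ℝ} {c : Fin m → ℝ}
    (hg : (fun _ v => g v : Mv.Broken) = fun T v => ∑ a, c a * U a T v) :
    IsWeightedTest (fun _ v => g v : Mv.Broken) := by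
  rw [hg]
  exact IsWeightedTest.sum (fun a => (hV.mem_inl a).isWeightedTest) c

/-- This is why `ρ` and `j_s` are piecewise polynomial and why a truncation that keeps the `K_a` of
the fixed functions cannot change them. -/
theorem moment_of_span (hV : IsVelocityBasis q U st.W) {g : EuclideanSpace ℝ (Fin d) → ℝ}
    {c : Fin m → ℝ} (hg : (fun _ v => g v : Mv.Broken) = fun T v => ∑ a, c a * U a T v) :
    st.moment U g = fun T x => ∑ a, c a * st.K (Sum.inl a) T x := by
  rw [st.moment_eq g fun j => (isWeightedTest_of_span hV hg).cell.gauss_mul (hV.mem_V j).sq_cell,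
    basisMoment_of_span hV hg]
  ext T x
  simp

/-- The product `v_s v_{s'}` need not be in the span of the fixed functions, so all `K_j` enter.
Only `v_s` is expanded, while `v_{s'}` stays with `V_j`; this yields rows of the transport matrix.
-/
theorem sigma_eq (hV : IsVelocityBasis q U st.W) {s : Fin d} {c : Fin m → ℝ}
    (hg : (fun _ v => v s : Mv.Broken) = fun T v => ∑ a, c a * U a T v) (s' : Fin d) :
    st.sigma U s s' = fun T x => ∑ j, (∑ a, c a * st.matA U s' (Sum.inl a) j) * st.K j T x := by
  have h := isWeightedTest_of_span hV hg
  rw [sigma, st.moment_eq]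
  · ext T x
    refine Finset.sum_congr rfl fun j _ => ?_
    congr 1
    have h1 : st.basisMoment U (fun v => v s * v s') j
        = Mv.wip (fun _ v => v s) (Mv.mulCoord s' (st.V U j)) := by
      simp only [basisMoment, wip, mulCoord, mul_assoc]
    rw [h1, hg, wip_sum_left (fun a => (hV.mem_inl a).sq_cell) ((hV.mem_V j).sq_coord s')]
    exact Finset.sum_congr rfl fun a _ => by rw [wip_comm]; rfl
  · intro j
    have := h.cell.gauss_mul ((hV.mem_V j).sq_coord s')
    simp only [mulCoord, ← mul_assoc] at this
    exact this

/-- Linearity in the test function replaces the `U_a` by `v_s`, and summation by parts against this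
coordinate leaves the mass of `V_j`. -/
theorem sum_matB (hV : IsVelocityBasis q U st.W) {s : Fin d} {c c₁ : Fin m → ℝ}
    (hg : (fun _ v => v s : Mv.Broken) = fun T v => ∑ a, c a * U a T v)
    (h1 : (fun _ _ => 1 : Mv.Broken) = fun T v => ∑ a, c₁ a * U a T v) (s' : Fin d)
    (j : Fin m ⊕ Fin st.k) :
    ∑ a, c a * st.matB U s' (Sum.inl a) j
      = -((if s' = s then 1 else 0) * st.basisMoment U (fun _ => 1) j) := by
  have h : ∑ a, c a * st.matB U s' (Sum.inl a) j
      = Mv.dhat s' (Mv.weighted (st.V U j)) (fun _ v => v s) := by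
    rw [hg, (hV.mem_V j).dhat_weighted_sum s' fun a => (hV.mem_inl a).isWeightedTest]
    rfl
  rw [h, (hV.mem_V j).dhat_weighted_coord s' s (isWeightedTest_of_span hV h1)
    (isWeightedTest_of_span hV hg)]
  simp only [basisMoment, one_mul]

end LowRankState

/-! ### K-step, S-step and the momentum balance of one time step. -/

open LowRankState

variable [Finite Mx.Cell] (hM : ∀ T, IsCompact (Mx.cell T))
  {F : EuclideanSpace ℝ (Fin d) → EuclideanSpace ℝ (Fin d)}
  (hF : ∀ T, MemLp F 2 (volume.restrict (Mx.cell T)))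
  {τ : ℝ} {K' : Fin m ⊕ Fin st.k → Mx.Broken}

include hM hF

/-- One component of the K-step, written with discrete derivatives. -/
theorem LowRankState.IsKStep.component (hX : IsSpatialBasis p st.X)
    (hK : st.IsKStep U p τ 1 F K') (i : Fin m ⊕ Fin st.k) {ψ : Mx.Broken}
    (hψ : Mx.IsPiecewisePoly p ψ) :
    1 / τ * (Mx.ip (K' i) ψ - Mx.ip (st.K i) ψ) + ∑ s, ∑ j, (st.matA U s i j * Mx.dhat s (st.K j) ψ
      + (-st.matB U s i j) * Mx.cellSum fun T x => F x s * (st.K j T x * ψ T x)) = 0 := by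
  classical
  have hKs : ∀ j, Mx.IsSmooth (st.K j) := fun j => (isPiecewisePoly_K hX j).isSmooth
  -- Testing with `ψ` in slot `i` and zero elsewhere isolates row `i` of the system.
  have h := hK.2 (Pi.single i ψ) fun j => by
    by_cases hj : j = i
    · subst hj
      simpa using hψ
    · rw [Pi.single_eq_of_ne hj]
      exact isPiecewisePoly_const p 0
  rw [← weakForm_eq hM hF hKs hψ.isSmooth]
  have e1 : ∑ j, Mx.ip (K' j - st.K j) ((Pi.single i ψ : Fin m ⊕ Fin st.k → Mx.Broken) j)
      = Mx.ip (K' i) ψ - Mx.ip (st.K i) ψ := by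
    rw [Finset.sum_eq_single i, Pi.single_eq_same,
      ip_sub_left hM ((hK.1 i).isSmooth.continuous) (hKs i).continuous hψ.isSmooth.continuous]
    · intro j _ hj
      rw [Pi.single_eq_of_ne hj]
      simp [ip, cellSum]
    · simp
  rw [e1] at h
  rw [← add_assoc]
  have ed : ∀ s T x, (fun j => partialDeriv s ((Pi.single i ψ : Fin m ⊕ Fin st.k → Mx.Broken) j T) x)
      = Pi.single i (partialDeriv s (ψ T) x) := by
    intro s T x
    ext j
    by_cases hj : j = i
    · subst hj
      simp
    · rw [Pi.single_eq_of_ne hj, Pi.single_eq_of_ne hj]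
      exact partialDeriv_const s 0 x
  have ev : ∀ T x, (fun j => (Pi.single i ψ : Fin m ⊕ Fin st.k → Mx.Broken) j T x)
      = Pi.single i (ψ T x) := by
    intro T x
    ext j
    by_cases hj : j = i
    · subst hj
      simp
    · rw [Pi.single_eq_of_ne hj, Pi.single_eq_of_ne hj]
      rfl
  have ej : ∀ e x, (fun j => Mx.jump ((Pi.single i ψ : Fin m ⊕ Fin st.k → Mx.Broken) j) e x)
      = Pi.single i (Mx.jump ψ e x) := by
    intro e x
    ext j
    by_cases hj : j = i
    · subst hj
      simp
    · rw [Pi.single_eq_of_ne hj, Pi.single_eq_of_ne hj]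
      simp [jump, traceMinus, tracePlus]
  refine Eq.trans ?_ h
  congr 1
  · congr 2
    ext T x
    refine Finset.sum_congr rfl fun s _ => ?_
    rw [ed, ev, dotProduct_single, dotProduct_single]
    simp only [Matrix.mulVec, dotProduct, neg_mul, Finset.sum_neg_distrib]
    ring
  · congr 1
    ext e x
    rw [ej, dotProduct_single]
    congr 1
    -- With `α = 1` the dissipative term containing `|A|` has coefficient zero, which leaves the
    -- average.
    simp only [numericalFlux, sub_self, zero_div, zero_smul, add_zero]
    change _ = ∑ j, (∑ s, Mx.normal e s • st.matA U s) i j *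
      ((1 / 2 : ℝ) * (Mx.tracePlus (st.K j) e x + Mx.traceMinus (st.K j) e x))
    simp only [avg_sum, Finset.mul_sum]
    rw [Finset.sum_comm]
    refine Finset.sum_congr rfl fun j _ => ?_
    rw [Matrix.sum_apply, Finset.sum_mul]
    refine Finset.sum_congr rfl fun s _ => ?_
    simp only [Matrix.smul_apply, smul_eq_mul, avg]
    ring

theorem cellSum_field_mul_sum {κ : Type*} [Fintype κ] (s : Fin d) {X : κ → Mx.Broken}
    {ψ : Mx.Broken} (hX : ∀ i T, Continuous (X i T)) (hψ : ∀ T, Continuous (ψ T)) (c : κ → ℝ) :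
    (Mx.cellSum fun T x => F x s * ((∑ i, c i * X i T x) * ψ T x))
      = ∑ i, c i * Mx.cellSum fun T x => F x s * (X i T x * ψ T x) := by
  have h : ∀ i, FamIntegrable Mx.cellMeasure fun T x => F x s * (X i T x * ψ T x) :=
    fun i => famIntegrable_field_mul hM hF s fun T => (hX i T).mul (hψ T)
  simp only [cellSum_eq, ← famSum_const_mul]
  rw [← famSum_finset_sum _ fun i _ => (h i).const_mul (c i)]
  congr 1
  ext T x
  rw [Finset.sum_mul, Finset.mul_sum]
  exact Finset.sum_congr rfl fun i _ => by ring

/-- The coefficients of the S-step that belong to the fixed velocity functions are those of the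
K-step. -/
theorem LowRankState.IsKStep.sStep_eq (hX : IsSpatialBasis p st.X)
    (hV : IsVelocityBasis q U st.W) (hτ : τ ≠ 0) (hK : st.IsKStep U p τ 1 F K') {rt kt : ℕ}
    {Xt : Fin rt → Mx.Broken} {Wt : Fin kt → Mv.Broken} (hXt : IsSpatialBasis p Xt) (k : Fin rt)
    (a : Fin m) :
    st.sStep U τ F Xt Wt k (Sum.inl a) = Mx.ip (K' (Sum.inl a)) (Xt k) := by
  have hXs : ∀ i, Mx.IsSmooth (st.X i) := fun i => (hX.1 i).isSmooth
  have hXts := (hXt.1 k).isSmooth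
  have hcomp := hK.component hM hF hX (Sum.inl a) (hXt.1 k)
  have hip : ∀ j, Mx.ip (st.K j) (Xt k) = ∑ i, st.S i j * Mx.ip (Xt k) (st.X i) := by
    intro j
    rw [K_eq, ip_sum_left hM (fun i => (hXs i).continuous) hXts.continuous]
    simp only [ip_comm (Xt k)]
  have hd : ∀ s j, Mx.dhat s (st.K j) (Xt k) = ∑ i, st.S i j * Mx.dhat s (st.X i) (Xt k) := by
    intro s j
    rw [K_eq, dhat_sum_left hM s hXs hXts]
  have hf : ∀ s j, (Mx.cellSum fun T x => F x s * (st.K j T x * Xt k T x))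
      = ∑ i, st.S i j * Mx.cellSum fun T x => F x s * (st.X i T x * Xt k T x) := by
    intro s j
    rw [K_eq, cellSum_field_mul_sum hM hF s (fun i => (hXs i).continuous) hXts.continuous]
  have hipF : ∀ s i, Mx.ip (Xt k) (fun T x => -F x s * st.X i T x)
      = -Mx.cellSum fun T x => F x s * (st.X i T x * Xt k T x) := by
    intro s i
    rw [ip, cellSum_eq, cellSum_eq, ← famSum_neg]
    congr 1
    ext T x
    ring
  -- Because `(U_a, V_j)` is a Kronecker delta, the transformed old coefficient is the projection of
  -- `K_a` alone.
  have h1 : ∑ i, ∑ j, Mx.ip (Xt k) (st.X i) * st.S i j * Mv.wip (U a) (st.V U j)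
      = Mx.ip (st.K (Sum.inl a)) (Xt k) := by
    rw [hip]
    refine Finset.sum_congr rfl fun i _ => ?_
    simp only [hV.wip_inl, mul_ite, mul_one, mul_zero, Finset.sum_ite_eq, Finset.mem_univ, if_true]
    ring
  -- Contracting `S` with the `X_i` gives the `K_j`, and the velocity factors are row `a` of the
  -- K-step matrices; so the S-step increment equals the K-step increment tested with `Xt k`.
  have h2 : ∑ i, ∑ j, ∑ s, (Mx.dhat s (st.X i) (Xt k) * st.S i j *
          Mv.wip (U a) (Mv.mulCoord s (st.V U j))
        + Mx.ip (Xt k) (fun T x => -F x s * st.X i T x) * st.S i j *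
          Mv.dhat s (Mv.weighted (st.V U j)) (U a))
      = ∑ s, ∑ j, (st.matA U s (Sum.inl a) j * Mx.dhat s (st.K j) (Xt k)
        + (-st.matB U s (Sum.inl a) j) *
          Mx.cellSum fun T x => F x s * (st.K j T x * Xt k T x)) := by
    simp only [hd, hf, hipF]
    rw [Finset.sum_comm]
    conv_rhs => rw [Finset.sum_comm]
    refine Finset.sum_congr rfl fun j _ => ?_
    rw [Finset.sum_comm]
    refine Finset.sum_congr rfl fun s _ => ?_
    rw [Finset.mul_sum, Finset.mul_sum, ← Finset.sum_add_distrib]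
    refine Finset.sum_congr rfl fun i _ => ?_
    rw [wip_comm]
    simp only [matA, matB, Matrix.of_apply]
    change _ * _ * _ + _ = _ * _ + -(Mv.dhat s (Mv.weighted (st.V U j)) (U a)) * _
    change _ * _ * _ + _ = (Mv.wip (Mv.mulCoord s (st.V U j)) (U a)) * _ + _
    ring
  have h3 : st.sStep U τ F Xt Wt k (Sum.inl a)
      = (∑ i, ∑ j, Mx.ip (Xt k) (st.X i) * st.S i j * Mv.wip (U a) (st.V U j))
        - τ * ∑ i, ∑ j, ∑ s, (Mx.dhat s (st.X i) (Xt k) * st.S i j *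
          Mv.wip (U a) (Mv.mulCoord s (st.V U j))
        + Mx.ip (Xt k) (fun T x => -F x s * st.X i T x) * st.S i j *
          Mv.dhat s (Mv.weighted (st.V U j)) (U a)) := rfl
  have h4 : ∀ D Z : ℝ, 1 / τ * D + Z = 0 → D = -(τ * Z) := by
    intro D Z h
    field_simp at h
    linarith
  rw [h3, h1, h2]
  linarith [h4 _ _ hcomp]

/-- The coefficients are inner products with an orthonormal system whose span contains `K'_a`, so
the expansion reproduces `K'_a`. This is where the augmentation by the K-step output is used. -/
theorem LowRankState.IsKStep.K_succ_eq (hX : IsSpatialBasis p st.X)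
    (hV : IsVelocityBasis q U st.W) (hτ : τ ≠ 0) (hK : st.IsKStep U p τ 1 F K') {rt kt : ℕ}
    {Xt : Fin rt → Mx.Broken} {Wt : Fin kt → Mv.Broken} (hXt : IsSpatialBasis p Xt) {a : Fin m}
    (hspan : K' (Sum.inl a) ∈ Submodule.span ℝ (Set.range Xt)) (T : Mx.Cell)
    (x : EuclideanSpace ℝ (Fin d)) :
    ∑ k, Xt k T x * st.sStep U τ F Xt Wt k (Sum.inl a) = K' (Sum.inl a) T x := by
  obtain ⟨c, hc⟩ := exists_coeff_of_mem_span hspan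
  have hXts : ∀ k, Mx.IsSmooth (Xt k) := fun k => (hXt.1 k).isSmooth
  have hck : ∀ k, Mx.ip (K' (Sum.inl a)) (Xt k) = c k := by
    intro k
    rw [hc, ip_sum_left hM (fun i => (hXts i).continuous) (hXts k).continuous,
      Finset.sum_eq_single k, hXt.2.1 k, mul_one]
    · intro i _ hi
      rw [hXt.2.2 i k hi, mul_zero]
    · simp
  simp only [hK.sStep_eq hM hF hX hV hτ hXt, hck]
  rw [hc]
  exact Finset.sum_congr rfl fun k _ => mul_comm _ _

/-- The momentum balance of one time step. -/
theorem IsTimeStep.momentum_balance {st' : LowRankState Mx Mv m} (hX : IsSpatialBasis p st.X)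
    (hV : IsVelocityBasis q U st.W) (hV' : IsVelocityBasis q U st'.W) (hτ : τ ≠ 0)
    (hstep : IsTimeStep p q U τ 1 F st st')
    (hU_one : (fun _ _ => 1 : Mv.Broken) ∈ Submodule.span ℝ (Set.range U)) (s : Fin d)
    (hU_coord : (fun _ v => v s : Mv.Broken) ∈ Submodule.span ℝ (Set.range U))
    {ψ : Mx.Broken} (hψ : Mx.IsPiecewisePoly p ψ) :
    1 / τ * Mx.ip (st'.mom U s - st.mom U s) ψ
        + Mx.cellSum (fun T x =>
            -(∑ s', st.sigma U s s' T x * partialDeriv s' (ψ T) x)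
              + F x s * st.rho U T x * ψ T x)
        + Mx.faceSum (fun e x =>
            (∑ s', Mx.normal e s' * Mx.avg (st.sigma U s s') e x) * Mx.jump ψ e x) = 0 := by
  obtain ⟨c₁, hc₁⟩ := exists_coeff_of_mem_span hU_one
  obtain ⟨c, hc⟩ := exists_coeff_of_mem_span hU_coord
  obtain ⟨K', nL, L, rt, kt, Xt, Wt, St, hK, -, hXt, -, hK't, -, -, -, rfl, hSt, -⟩ := hstep
  have hKs : ∀ j, Mx.IsSmooth (st.K j) := fun j => (isPiecewisePoly_K hX j).isSmooth
  have hK's : ∀ j, Mx.IsSmooth (K' j) := fun j => (hK.1 j).isSmooth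
  have hψs := hψ.isSmooth
  have hmom : st.mom U s = fun T x => ∑ a, c a * st.K (Sum.inl a) T x := moment_of_span hV hc
  have hmom' : st'.mom U s = fun T x => ∑ a, c a * K' (Sum.inl a) T x := by
    refine (moment_of_span hV' hc).trans ?_
    ext T x
    refine Finset.sum_congr rfl fun a _ => ?_
    rw [hSt, hK.K_succ_eq hM hF hX hV hτ hXt (hK't _)]
  have hip : Mx.ip (st'.mom U s - st.mom U s) ψ
      = ∑ a, c a * (Mx.ip (K' (Sum.inl a)) ψ - Mx.ip (st.K (Sum.inl a)) ψ) := by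
    rw [hmom, hmom', ip_sub_left hM
      (IsSmooth.continuous (IsSmooth.sum (fun a => hK's (Sum.inl a)) c))
      (IsSmooth.continuous (IsSmooth.sum (fun a => hKs (Sum.inl a)) c)) hψs.continuous,
      ip_sum_left hM (fun a => (hK's (Sum.inl a)).continuous) hψs.continuous,
      ip_sum_left hM (fun a => (hKs (Sum.inl a)).continuous) hψs.continuous,
      ← Finset.sum_sub_distrib]
    exact Finset.sum_congr rfl fun a _ => by ring
  have hrho : st.rho U = fun T x => ∑ j, st.basisMoment U (fun _ => 1) j * st.K j T x :=
    st.moment_eq _ fun j => (isWeightedTest_of_span hV hc₁).cell.gauss_mul (hV.mem_V j).sq_cell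
  -- These coefficients represent `σ_{s s'}` and, in the single component `s' = s`, the density `ρ`
  -- in terms of the `K_j`.
  have hweak := weakForm_eq hM hF hKs hψs
    (fun s' j => ∑ a, c a * st.matA U s' (Sum.inl a) j)
    (fun s' j => (if s' = s then 1 else 0) * st.basisMoment U (fun _ => 1) j)
  have hcomp := fun a => hK.component hM hF hX (Sum.inl a) hψ
  -- The rows of the K-step are combined with the coefficients of `v_s`.
  have hsum : ∑ a, c a * (1 / τ * (Mx.ip (K' (Sum.inl a)) ψ - Mx.ip (st.K (Sum.inl a)) ψ)
      + ∑ s', ∑ j, (st.matA U s' (Sum.inl a) j * Mx.dhat s' (st.K j) ψ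
      + (-st.matB U s' (Sum.inl a) j) *
        Mx.cellSum fun T x => F x s' * (st.K j T x * ψ T x))) = 0 :=
    Finset.sum_eq_zero fun a _ => by rw [hcomp a, mul_zero]
  have hsum2 : ∑ a, c a * ∑ s', ∑ j, (st.matA U s' (Sum.inl a) j * Mx.dhat s' (st.K j) ψ
      + (-st.matB U s' (Sum.inl a) j) *
        Mx.cellSum fun T x => F x s' * (st.K j T x * ψ T x))
      = ∑ s', ∑ j, ((∑ a, c a * st.matA U s' (Sum.inl a) j) * Mx.dhat s' (st.K j) ψ
        + ((if s' = s then 1 else 0) * st.basisMoment U (fun _ => 1) j) *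
          Mx.cellSum fun T x => F x s' * (st.K j T x * ψ T x)) := by
    simp only [Finset.mul_sum]
    rw [Finset.sum_comm]
    refine Finset.sum_congr rfl fun s' _ => ?_
    rw [Finset.sum_comm]
    refine Finset.sum_congr rfl fun j _ => ?_
    have hB := sum_matB hV hc hc₁ s' j
    rw [show (if s' = s then (1 : ℝ) else 0) * st.basisMoment U (fun _ => 1) j
      = -∑ a, c a * st.matB U s' (Sum.inl a) j by rw [hB, neg_neg], ← Finset.sum_neg_distrib,
      Finset.sum_mul, Finset.sum_mul, ← Finset.sum_add_distrib]
    exact Finset.sum_congr rfl fun a _ => by ring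
  simp only [mul_add, Finset.sum_add_distrib] at hsum
  simp only [mul_add, Finset.sum_add_distrib] at hsum2
  have hA : Mx.cellSum (fun T x => ∑ s',
        (-((∑ j, (∑ a, c a * st.matA U s' (Sum.inl a) j) * st.K j T x) * partialDeriv s' (ψ T) x)
        + F x s' * (∑ j, ((if s' = s then 1 else 0) * st.basisMoment U (fun _ => 1) j) *
          st.K j T x) * ψ T x))
      = Mx.cellSum (fun T x =>
            -(∑ s', st.sigma U s s' T x * partialDeriv s' (ψ T) x)
              + F x s * st.rho U T x * ψ T x) := by
    congr 1
    ext T x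
    rw [Finset.sum_add_distrib, Finset.sum_neg_distrib]
    congr 1
    · simp only [sigma_eq hV hc]
    · rw [Finset.sum_eq_single s, hrho]
      · simp
      · intro s' _ hs'
        simp [hs']
      · simp
  have hB : Mx.faceSum (fun e x => (∑ s', Mx.normal e s' * Mx.avg
        (fun T x => ∑ j, (∑ a, c a * st.matA U s' (Sum.inl a) j) * st.K j T x) e x) *
        Mx.jump ψ e x)
      = Mx.faceSum (fun e x =>
            (∑ s', Mx.normal e s' * Mx.avg (st.sigma U s s') e x) * Mx.jump ψ e x) := by
    simp only [sigma_eq hV hc]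
  rw [hA, hB] at hweak
  rw [add_assoc, hweak, hip]
  simp only [Finset.sum_add_distrib]
  rw [← hsum2, Finset.mul_sum, ← hsum]
  congr 1
  exact Finset.sum_congr rfl fun a _ => by ring

end Scheme

/-! ### Periodic functions and the mesh as a fundamental domain. -/

/-- `f` is invariant under the translations by the elements of `Λ`. -/
def IsPeriodicFun {V β : Type*} [AddCommGroup V] (Λ : Submodule ℤ V) (f : V → β) : Prop :=
  ∀ l ∈ Λ, ∀ x, f (x + l) = f x

theorem IsPeriodicFun.sub {V β : Type*} [AddCommGroup V] {Λ : Submodule ℤ V} {f : V → β}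
    (h : IsPeriodicFun Λ f) {l : V} (hl : l ∈ Λ) (x : V) : f (x - l) = f x := by
  rw [← h l hl (x - l), sub_add_cancel]

theorem IsPeriodicFun.vadd {V β : Type*} [AddCommGroup V] {Λ : Submodule ℤ V} {f : V → β}
    (h : IsPeriodicFun Λ f) (l : Λ.toAddSubgroup) (x : V) : f (l +ᵥ x) = f x := by
  rw [show l +ᵥ x = x + (l : V) from add_comm _ _]
  exact h l l.2 x

namespace DGMesh

variable {d : ℕ} {Λ : Submodule ℤ (EuclideanSpace ℝ (Fin d))} (M : DGMesh Λ)

/-- the union of the interiors of the elements -/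
def domain : Set (EuclideanSpace ℝ (Fin d)) := ⋃ T, interior (M.cell T)

theorem isOpen_domain : IsOpen M.domain := isOpen_iUnion fun _ => isOpen_interior

theorem interior_cell_ae_eq (T : M.Cell) : interior (M.cell T) =ᵐ[volume] M.cell T := by
  filter_upwards [M.ae_notMem_frontier_cell T] with x hx
  refine propext ⟨fun h => interior_subset h, fun h => ?_⟩
  by_contra hn
  exact hx ⟨subset_closure h, hn⟩

theorem countable_periods (M : DGMesh Λ) : (Λ : Set (EuclideanSpace ℝ (Fin d))).Countable :=
  let ⟨T, _⟩ := M.cover 0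
  M.countable_period T

theorem ae_exists_mem_interior : ∀ᵐ x, ∃ T, ∃ l ∈ Λ, x - l ∈ interior (M.cell T) := by
  have h : ∀ᵐ x, ∀ T, ∀ l ∈ (Λ : Set (EuclideanSpace ℝ (Fin d))), x - l ∉ frontier (M.cell T) :=
    ae_all_iff.2 fun T => (ae_ball_iff (M.countable_period T)).2 fun l _ =>
      (measurePreserving_sub_right volume l).quasiMeasurePreserving.ae (M.ae_notMem_frontier_cell T)
  filter_upwards [h] with x hx
  obtain ⟨T, l, hl, hxl⟩ := M.cover x
  refine ⟨T, l, hl, ?_⟩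
  by_contra hn
  exact hx T l hl ⟨subset_closure hxl, hn⟩

/-- The elements tile up to their frontiers, which are null sets by convexity. With interiors in
place of closed elements the disjointness is exact. -/
theorem isAddFundamentalDomain : IsAddFundamentalDomain Λ.toAddSubgroup M.domain volume := by
  refine IsAddFundamentalDomain.mk'' M.isOpen_domain.measurableSet.nullMeasurableSet ?_ ?_ ?_
  · filter_upwards [M.ae_exists_mem_interior] with x hx
    obtain ⟨T, l, hl, hxl⟩ := hx
    refine ⟨⟨-l, Λ.neg_mem hl⟩, Set.mem_iUnion.2 ⟨T, ?_⟩⟩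
    rwa [show (⟨-l, Λ.neg_mem hl⟩ : Λ.toAddSubgroup) +ᵥ x = x - l from neg_add_eq_sub l x]
  · intro g hg
    refine Disjoint.aedisjoint (Set.disjoint_left.2 ?_)
    rintro _ ⟨y, hy, rfl⟩ hx
    obtain ⟨T', hT'⟩ := Set.mem_iUnion.1 hy
    obtain ⟨T, hT⟩ := Set.mem_iUnion.1 hx
    refine M.disjoint_interior T T' g g.2 (Or.inr fun h => hg (Subtype.ext h)) _ hT ?_
    have h : (g +ᵥ y : EuclideanSpace ℝ (Fin d)) - g = y :=
      add_sub_cancel_left (g : EuclideanSpace ℝ (Fin d)) y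
    simpa only [h] using hT'
  · intro g
    exact (measurePreserving_vadd g volume).quasiMeasurePreserving

theorem cellSum_eq_setIntegral {g : M.Broken} {h : EuclideanSpace ℝ (Fin d) → ℝ}
    (hgh : ∀ T, ∀ x ∈ interior (M.cell T), g T x = h x) (hh : IntegrableOn h M.domain) :
    M.cellSum g = ∫ x in M.domain, h x := by
  rw [domain, integral_iUnion (fun T => isOpen_interior.measurableSet) ?_ hh]
  · refine tsum_congr fun T => ?_
    rw [← setIntegral_congr_set (M.interior_cell_ae_eq T)]
    exact setIntegral_congr_fun isOpen_interior.measurableSet (hgh T)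
  · intro T T' hT
    refine Set.disjoint_left.2 fun x hx hx' => ?_
    exact M.disjoint_interior T T' 0 Λ.zero_mem (Or.inl hT) x hx (by simpa using hx')

/-- The periodic function that agrees with `g T` in the interior of each element `T`. -/
noncomputable def periodize (g : M.Broken) (x : EuclideanSpace ℝ (Fin d)) : ℝ :=
  open Classical in
  if h : ∃ Tl : M.Cell × EuclideanSpace ℝ (Fin d), Tl.2 ∈ Λ ∧ x - Tl.2 ∈ interior (M.cell Tl.1)
  then g h.choose.1 (x - h.choose.2) else 0

variable {M}

/-- The chosen representative does not matter, because the interiors of different translated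
elements are disjoint. -/
theorem periodize_eq (g : M.Broken) {x : EuclideanSpace ℝ (Fin d)} {T : M.Cell}
    {l : EuclideanSpace ℝ (Fin d)} (hl : l ∈ Λ) (hx : x - l ∈ interior (M.cell T)) :
    M.periodize g x = g T (x - l) := by
  have h : ∃ Tl : M.Cell × EuclideanSpace ℝ (Fin d), Tl.2 ∈ Λ ∧ x - Tl.2 ∈ interior (M.cell Tl.1) :=
    ⟨(T, l), hl, hx⟩
  rw [periodize, dif_pos h]
  obtain ⟨h1, h2⟩ := h.choose_spec
  by_cases hne : T ≠ h.choose.1 ∨ h.choose.2 - l ≠ 0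
  · exact absurd (by simpa using h2) (M.disjoint_interior _ _ _ (Λ.sub_mem h1 hl) hne _ hx)
  · push Not at hne
    rw [← hne.1, sub_eq_zero.1 hne.2]

theorem periodize_of_mem (g : M.Broken) {x : EuclideanSpace ℝ (Fin d)} {T : M.Cell}
    (hx : x ∈ interior (M.cell T)) : M.periodize g x = g T x := by
  have := periodize_eq g (T := T) (l := 0) Λ.zero_mem (by simpa using hx)
  simpa using this

theorem isPeriodicFun_periodize (g : M.Broken) : IsPeriodicFun Λ (M.periodize g) := by
  intro l hl x
  by_cases h : ∃ Tl : M.Cell × EuclideanSpace ℝ (Fin d),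
      Tl.2 ∈ Λ ∧ x - Tl.2 ∈ interior (M.cell Tl.1)
  · obtain ⟨⟨T, l'⟩, hl', hx⟩ := h
    rw [periodize_eq g hl' hx, periodize_eq (x := x + l) g (T := T) (Λ.add_mem hl' hl)
      (by rwa [add_sub_add_right_eq_sub]), add_sub_add_right_eq_sub]
  · have h' : ¬∃ Tl : M.Cell × EuclideanSpace ℝ (Fin d),
        Tl.2 ∈ Λ ∧ x + l - Tl.2 ∈ interior (M.cell Tl.1) := by
      rintro ⟨⟨T, l'⟩, hl', hx⟩
      exact h ⟨(T, l' - l), Λ.sub_mem hl' hl, by rwa [sub_sub_eq_add_sub]⟩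
    rw [periodize, periodize, dif_neg h, dif_neg h']

theorem norm_periodize_le {g : M.Broken} {C : ℝ} (hC : 0 ≤ C)
    (hg : ∀ T, ∀ x ∈ M.cell T, ‖g T x‖ ≤ C) (x : EuclideanSpace ℝ (Fin d)) :
    ‖M.periodize g x‖ ≤ C := by
  by_cases h : ∃ Tl : M.Cell × EuclideanSpace ℝ (Fin d),
      Tl.2 ∈ Λ ∧ x - Tl.2 ∈ interior (M.cell Tl.1)
  · obtain ⟨⟨T, l'⟩, hl', hx⟩ := h
    rw [periodize_eq g hl' hx]
    exact hg _ _ (interior_subset hx)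
  · rw [periodize, dif_neg h]
    simpa using hC

theorem continuousAt_periodize {g : M.Broken} (hg : ∀ T, Continuous (g T))
    {x : EuclideanSpace ℝ (Fin d)} {T : M.Cell} {l : EuclideanSpace ℝ (Fin d)} (hl : l ∈ Λ)
    (hx : x - l ∈ interior (M.cell T)) : ContinuousAt (M.periodize g) x := by
  have h1 : ∀ᶠ y in nhds x, y - l ∈ interior (M.cell T) :=
    (continuous_sub_right l).continuousAt.eventually (isOpen_interior.mem_nhds hx)
  have h2 : M.periodize g =ᶠ[nhds x] fun y => g T (y - l) := by
    filter_upwards [h1] with y hy using periodize_eq g hl hy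
  exact (((hg T).comp (continuous_sub_right l)).continuousAt).congr h2.symm

/-- The function is continuous on an open set of full measure, namely on the translated interiors.
-/
theorem aestronglyMeasurable_periodize {g : M.Broken} (hg : ∀ T, Continuous (g T)) :
    AEStronglyMeasurable (M.periodize g) volume := by
  set O : Set (EuclideanSpace ℝ (Fin d)) := {x | ∃ T, ∃ l ∈ Λ, x - l ∈ interior (M.cell T)} with hO
  have hOo : IsOpen O := by
    refine isOpen_iff_mem_nhds.2 ?_
    rintro x ⟨T, l, hl, hx⟩
    filter_upwards [(continuous_sub_right l).continuousAt.eventually (isOpen_interior.mem_nhds hx)]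
      with y hy using ⟨T, l, hl, hy⟩
  have hc : ContinuousOn (M.periodize g) O := by
    rintro x ⟨T, l, hl, hx⟩
    exact (continuousAt_periodize hg hl hx).continuousWithinAt
  have h := hc.aestronglyMeasurable hOo.measurableSet (μ := volume)
  have hae : ∀ᵐ x, x ∈ O := M.ae_exists_mem_interior
  rwa [Measure.restrict_eq_self_of_ae_mem hae] at h

end DGMesh

namespace DGMesh

variable {d : ℕ} {Λ : Submodule ℤ (EuclideanSpace ℝ (Fin d))} (M : DGMesh Λ)

theorem locallyIntegrable_of_isPeriodicFun {f : EuclideanSpace ℝ (Fin d) → ℝ}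
    (hf : IsPeriodicFun Λ f) (hi : ∀ T, IntegrableOn f (M.cell T)) :
    LocallyIntegrable f volume := by
  rw [locallyIntegrable_iff]
  intro K hK
  have hfin := M.locallyFinite K hK
  have hsub : K ⊆ ⋃ Tl ∈ {Tl : M.Cell × EuclideanSpace ℝ (Fin d) |
      Tl.2 ∈ Λ ∧ ∃ x ∈ K, x - Tl.2 ∈ M.cell Tl.1}, (fun x => x - Tl.2) ⁻¹' M.cell Tl.1 := by
    intro x hx
    obtain ⟨T, l, hl, hxl⟩ := M.cover x
    exact Set.mem_biUnion (x := (T, l)) ⟨hl, x, hx, hxl⟩ hxl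
  refine IntegrableOn.mono_set ?_ hsub
  refine (integrableOn_finite_biUnion hfin).2 fun Tl hTl => ?_
  have h := ((measurePreserving_sub_right volume Tl.2).integrableOn_comp_preimage
    (measurableEmbedding_subRight Tl.2) (f := f) (s := M.cell Tl.1)).2 (hi Tl.1)
  rwa [show f ∘ (fun x => x - Tl.2) = f from funext fun x => hf.sub hTl.1 x] at h

end DGMesh

/-! ### Convolution on the torus and its symmetry. -/

section Periodic

open scoped Pointwise

variable {d : ℕ} {Λ : Submodule ℤ (EuclideanSpace ℝ (Fin d))} {D : Set (EuclideanSpace ℝ (Fin d))}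

theorem preimage_sub_vadd {V : Type*} [AddCommGroup V] (t : V) (D : Set V) :
    (fun x => x - t) ⁻¹' ((-t) +ᵥ D) = D := by
  ext x
  simp [Set.mem_vadd_set_iff_neg_vadd_mem]

/-- A translate of a fundamental domain is again one, and periodic functions have the same integral
over both. -/
theorem IsPeriodicFun.setIntegral_sub [Countable Λ]
    (hD : IsAddFundamentalDomain Λ.toAddSubgroup D volume)
    {h : EuclideanSpace ℝ (Fin d) → ℝ} (hh : IsPeriodicFun Λ h) (t : EuclideanSpace ℝ (Fin d)) :
    ∫ x in D, h (x - t) = ∫ x in D, h x := by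
  have : Countable Λ.toAddSubgroup := ‹Countable Λ›
  have h1 := (measurePreserving_sub_right volume t).setIntegral_preimage_emb
    (measurableEmbedding_subRight t) h ((-t) +ᵥ D)
  rw [preimage_sub_vadd] at h1
  rw [h1]
  exact (hD.vadd_of_comm (-t)).setIntegral_eq hD hh.vadd

theorem IsPeriodicFun.integrableOn_sub [Countable Λ]
    (hD : IsAddFundamentalDomain Λ.toAddSubgroup D volume)
    {h : EuclideanSpace ℝ (Fin d) → ℝ} (hh : IsPeriodicFun Λ h) (t : EuclideanSpace ℝ (Fin d))
    (hi : IntegrableOn h D) : IntegrableOn (fun x => h (x - t)) D := by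
  have : Countable Λ.toAddSubgroup := ‹Countable Λ›
  have h1 := (measurePreserving_sub_right volume t).integrableOn_comp_preimage
    (measurableEmbedding_subRight t) (f := h) (s := (-t) +ᵥ D)
  rw [preimage_sub_vadd] at h1
  exact h1.2 (((hD.vadd_of_comm (-t)).integrableOn_iff hD hh.vadd).2 hi)

/-- Periodic, locally integrable functions that are square integrable on the fundamental
domain `D`. -/
structure IsPeriodicL2 (Λ : Submodule ℤ (EuclideanSpace ℝ (Fin d)))
    (D : Set (EuclideanSpace ℝ (Fin d))) (f : EuclideanSpace ℝ (Fin d) → ℝ) : Prop where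
  periodic : IsPeriodicFun Λ f
  locallyIntegrable : LocallyIntegrable f volume
  integrableOn_sq : IntegrableOn (fun x => f x ^ 2) D

namespace IsPeriodicL2

variable {f g k : EuclideanSpace ℝ (Fin d) → ℝ}

theorem correlation_symm [Countable Λ] (hD : IsAddFundamentalDomain Λ.toAddSubgroup D volume)
    (hf : IsPeriodicFun Λ f) (hg : IsPeriodicFun Λ g) (t : EuclideanSpace ℝ (Fin d)) :
    ∫ x in D, f x * g (x - t) = ∫ x in D, g x * f (x - -t) := by
  have h : IsPeriodicFun Λ fun x => f (x + t) * g x := fun l hl x => by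
    simp only [hg l hl x, add_right_comm x l t, hf l hl (x + t)]
  have := h.setIntegral_sub hD t
  simp only [sub_add_cancel] at this
  rw [this]
  simp only [sub_neg_eq_add, mul_comm]

theorem integrableOn_sq_sub [Countable Λ] (hD : IsAddFundamentalDomain Λ.toAddSubgroup D volume)
    (hf : IsPeriodicL2 Λ D f) (t : EuclideanSpace ℝ (Fin d)) :
    IntegrableOn (fun x => f (x - t) ^ 2) D :=
  IsPeriodicFun.integrableOn_sub hD (h := fun x => f x ^ 2)
    (fun l hl x => by simp only [hf.periodic l hl x]) t hf.integrableOn_sq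

/-- The bound does not depend on `t`, which provides the absolute integrability for Fubini's theorem
against an integrable kernel. -/
theorem norm_correlation_le [Countable Λ] (hD : IsAddFundamentalDomain Λ.toAddSubgroup D volume)
    (hf : IsPeriodicL2 Λ D f) (hg : IsPeriodicL2 Λ D g) (t : EuclideanSpace ℝ (Fin d)) :
    IntegrableOn (fun x => f x * g (x - t)) D ∧
      ∫ x in D, ‖f x * g (x - t)‖ ≤ ((∫ x in D, f x ^ 2) + ∫ x in D, g x ^ 2) / 2 := by
  have hb : ∀ x, ‖f x * g (x - t)‖ ≤ (f x ^ 2 + g (x - t) ^ 2) / 2 := fun x => by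
    rw [Real.norm_eq_abs, abs_le]
    constructor <;> nlinarith [sq_nonneg (f x + g (x - t)), sq_nonneg (f x - g (x - t))]
  have hi := (hf.integrableOn_sq.add (hg.integrableOn_sq_sub hD t)).div_const 2
  have hm : AEStronglyMeasurable (fun x => f x * g (x - t)) (volume.restrict D) :=
    (hf.locallyIntegrable.aestronglyMeasurable.mul
      (hg.locallyIntegrable.aestronglyMeasurable.comp_quasiMeasurePreserving
        (measurePreserving_sub_right volume t).quasiMeasurePreserving)).restrict
  have hint : IntegrableOn (fun x => f x * g (x - t)) D :=
    hi.mono' hm (Filter.Eventually.of_forall hb)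
  refine ⟨hint, (integral_mono hint.norm hi hb).trans_eq ?_⟩
  simp only [Pi.add_apply]
  rw [integral_div, integral_add hf.integrableOn_sq (hg.integrableOn_sq_sub hD t),
    IsPeriodicFun.setIntegral_sub hD (h := fun x => g x ^ 2)
      (fun l hl x => by simp only [hg.periodic l hl x]) t]

theorem setIntegral_mul_convolution [Countable Λ]
    (hD : IsAddFundamentalDomain Λ.toAddSubgroup D volume)
    (hf : IsPeriodicL2 Λ D f) (hg : IsPeriodicL2 Λ D g) (hk : Integrable k) :
    ∫ x in D, f x * convolution k g (ContinuousLinearMap.lsmul ℝ ℝ) volume x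
      = ∫ t, k t * ∫ x in D, f x * g (x - t) := by
  simp only [convolution, ContinuousLinearMap.lsmul_apply, smul_eq_mul, ← integral_const_mul]
  rw [integral_integral_swap]
  · exact integral_congr_ae (Filter.Eventually.of_forall fun t =>
      integral_congr_ae (Filter.Eventually.of_forall fun x => by ring))
  have hm : AEStronglyMeasurable (Function.uncurry fun x t => f x * (k t * g (x - t)))
      ((volume.restrict D).prod volume) := by
    have h1 := hk.aestronglyMeasurable.convolution_integrand (ContinuousLinearMap.lsmul ℝ ℝ)
      (μ := volume) hg.locallyIntegrable.aestronglyMeasurable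
    have h2 := hf.locallyIntegrable.aestronglyMeasurable.comp_fst
      (ν := (volume : Measure (EuclideanSpace ℝ (Fin d))))
    exact (h2.mul h1).mono_ac
      (Measure.restrict_le_self.absolutelyContinuous.prod Measure.AbsolutelyContinuous.rfl)
  have e : ∀ t x, f x * (k t * g (x - t)) = k t * (f x * g (x - t)) := fun t x => by ring
  refine (integrable_prod_iff' hm).2 ⟨Filter.Eventually.of_forall fun t => ?_, ?_⟩
  · simp only [Function.uncurry_apply_pair, e t]
    exact (hf.norm_correlation_le hD hg t).1.const_mul _
  · refine (hk.norm.mul_const (((∫ x in D, f x ^ 2) + ∫ x in D, g x ^ 2) / 2)).mono'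
      hm.norm.prod_swap.integral_prod_right' (Filter.Eventually.of_forall fun t => ?_)
    simp only [Function.uncurry_apply_pair, e t, norm_mul (k t), integral_const_mul]
    rw [Real.norm_eq_abs, abs_of_nonneg (mul_nonneg (norm_nonneg _)
      (integral_nonneg fun x => norm_nonneg _))]
    exact mul_le_mul_of_nonneg_left (hf.norm_correlation_le hD hg t).2 (norm_nonneg _)

/-- Convolution with an even (`ε = 1`) or odd (`ε = -1`) kernel is symmetric or antisymmetric on
periodic functions. -/
theorem setIntegral_mul_convolution_comm [Countable Λ]
    (hD : IsAddFundamentalDomain Λ.toAddSubgroup D volume)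
    (hf : IsPeriodicL2 Λ D f) (hg : IsPeriodicL2 Λ D g) (hk : Integrable k) {ε : ℝ}
    (hε : ∀ t, k (-t) = ε * k t) :
    ∫ x in D, f x * convolution k g (ContinuousLinearMap.lsmul ℝ ℝ) volume x
      = ε * ∫ x in D, g x * convolution k f (ContinuousLinearMap.lsmul ℝ ℝ) volume x := by
  rw [hf.setIntegral_mul_convolution hD hg hk, hg.setIntegral_mul_convolution hD hf hk,
    ← integral_neg_eq_self, ← integral_const_mul]
  refine integral_congr_ae (Filter.Eventually.of_forall fun t => ?_)
  simp only [hε t, correlation_symm hD hf.periodic hg.periodic (-t), neg_neg, mul_assoc]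

/-- Antisymmetry makes the integral equal to its own negative. -/
theorem setIntegral_mul_convolution_self [Countable Λ]
    (hD : IsAddFundamentalDomain Λ.toAddSubgroup D volume)
    (hf : IsPeriodicL2 Λ D f) (hk : Integrable k) (hodd : ∀ t, k (-t) = -k t) :
    ∫ x in D, f x * convolution k f (ContinuousLinearMap.lsmul ℝ ℝ) volume x = 0 := by
  have := hf.setIntegral_mul_convolution_comm hD hf hk (ε := -1) (by simpa using hodd)
  linarith

end IsPeriodicL2

theorem IsPeriodicFun.convolution {g : EuclideanSpace ℝ (Fin d) → ℝ} (hg : IsPeriodicFun Λ g)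
    (k : EuclideanSpace ℝ (Fin d) → ℝ) :
    IsPeriodicFun Λ (convolution k g (ContinuousLinearMap.lsmul ℝ ℝ) volume) := by
  intro l hl x
  simp only [MeasureTheory.convolution, add_sub_right_comm x l, hg l hl]

end Periodic

/-! ### Smooth kernels of definite parity. -/

section Kernel

variable {d : ℕ}

/-- smooth functions with compact support and with `k (-t) = ε k t` -/
structure IsTestKernel (ε : ℝ) (k : EuclideanSpace ℝ (Fin d) → ℝ) : Prop where
  contDiff : ContDiff ℝ ∞ k
  hasCompactSupport : HasCompactSupport k
  parity : ∀ t, k (-t) = ε * k t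

namespace IsTestKernel

variable {ε : ℝ} {k g : EuclideanSpace ℝ (Fin d) → ℝ}

theorem integrable (hk : IsTestKernel ε k) : Integrable k :=
  hk.contDiff.continuous.integrable_of_hasCompactSupport hk.hasCompactSupport

/-- Differentiation reverses parity. Hence second derivatives of an even mollifier give symmetric
convolutions and third derivatives antisymmetric ones. -/
theorem partialDeriv (hk : IsTestKernel ε k) (s : Fin d) :
    IsTestKernel (-ε) (partialDeriv s k) := by
  refine ⟨?_, hk.hasCompactSupport.fderiv_apply ℝ _, fun t => ?_⟩
  · exact (hk.contDiff.fderiv_right (m := ∞) (by simp)).clm_apply contDiff_const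
  · have h1 : (fun t => k (-t)) = fun t => ε * k t := funext hk.parity
    have hd : Differentiable ℝ k := hk.contDiff.differentiable (by simp)
    have h2 := congrArg (fun f => _root_.partialDeriv s f t) h1
    simp only [partialDeriv_const_mul s ε (hd t)] at h2
    have h3 : HasFDerivAt (fun t => k (-t)) ((fderiv ℝ k (-t)).comp
        (-ContinuousLinearMap.id ℝ (EuclideanSpace ℝ (Fin d)))) t :=
      (hd (-t)).hasFDerivAt.comp t (hasFDerivAt_id t).neg
    simp only [_root_.partialDeriv, h3.fderiv] at h2 ⊢
    simp at h2
    linarith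

theorem contDiff_convolution (hk : IsTestKernel ε k) (hg : LocallyIntegrable g volume) :
    ContDiff ℝ ∞ (convolution k g (ContinuousLinearMap.lsmul ℝ ℝ) volume) :=
  hk.hasCompactSupport.contDiff_convolution_left _ hk.contDiff hg

theorem partialDeriv_convolution (hk : IsTestKernel ε k) (hg : LocallyIntegrable g volume)
    (s : Fin d) (x : EuclideanSpace ℝ (Fin d)) :
    _root_.partialDeriv s (convolution k g (ContinuousLinearMap.lsmul ℝ ℝ) volume) x
      = convolution (_root_.partialDeriv s k) g (ContinuousLinearMap.lsmul ℝ ℝ) volume x := by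
  have h1 : ContDiff ℝ 1 k := hk.contDiff.of_le (by exact_mod_cast le_top)
  have h := hk.hasCompactSupport.hasFDerivAt_convolution_left (ContinuousLinearMap.lsmul ℝ ℝ) h1 hg x
  have hint := (hk.hasCompactSupport.fderiv ℝ).convolutionExists_left
    ((ContinuousLinearMap.lsmul ℝ ℝ : ℝ →L[ℝ] ℝ →L[ℝ] ℝ).precompL (EuclideanSpace ℝ (Fin d)))
    (h1.continuous_fderiv one_ne_zero) hg x
  rw [_root_.partialDeriv, h.fderiv]
  simp only [convolution]
  rw [ContinuousLinearMap.integral_apply hint]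
  rfl

end IsTestKernel

end Kernel

/-! ### The total force of a weak solution of Poisson's equation vanishes. -/

section WeakField

variable {d : ℕ} {Λ : Submodule ℤ (EuclideanSpace ℝ (Fin d))} {D : Set (EuclideanSpace ℝ (Fin d))}
  {F : Fin d → EuclideanSpace ℝ (Fin d) → ℝ} {Φ r : EuclideanSpace ℝ (Fin d) → ℝ}

/-- For a weak solution of `F = -∇Φ`, `∇ · F = r` on a torus, the force `F r` has mean zero after
mollification. -/
theorem setIntegral_mul_convolution_eq_zero [Countable Λ]
    (hD : IsAddFundamentalDomain Λ.toAddSubgroup D volume)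
    (hF : ∀ s, IsPeriodicL2 Λ D (F s)) (hΦ : IsPeriodicL2 Λ D Φ) (hr : IsPeriodicL2 Λ D r)
    (hgrad : ∀ φ, ContDiff ℝ ∞ φ → IsPeriodicFun Λ φ → ∀ s,
      ∫ x in D, Φ x * partialDeriv s φ x = ∫ x in D, F s x * φ x)
    (hdiv : ∀ φ, ContDiff ℝ ∞ φ → IsPeriodicFun Λ φ →
      ∑ s, ∫ x in D, F s x * partialDeriv s φ x = -∫ x in D, r x * φ x)
    {η : EuclideanSpace ℝ (Fin d) → ℝ} (hη : IsTestKernel 1 η) (s : Fin d) :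
    ∫ x in D, F s x * convolution η r (ContinuousLinearMap.lsmul ℝ ℝ) volume x = 0 := by
  -- The even mollifier is moved from `r` to `F s`, whose mollification is smooth and periodic and
  -- so may be used as a test function.
  rw [(hF s).setIntegral_mul_convolution_comm hD hr hη.integrable hη.parity, one_mul]
  have h := hdiv _ (hη.contDiff_convolution (hF s).locallyIntegrable)
    ((hF s).periodic.convolution η)
  rw [← neg_eq_zero, ← h]
  refine Finset.sum_eq_zero fun s' _ => ?_
  simp only [hη.partialDeriv_convolution (hF s).locallyIntegrable s']
  have h1 := hη.partialDeriv s'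
  have h2 := h1.partialDeriv s'
  have h3 := h2.partialDeriv s
  rw [neg_neg] at h2
  -- The gradient equation replaces `F s'` by `Φ` at the cost of one more derivative on the kernel,
  -- which is then even again.
  rw [← hgrad _ (h1.contDiff_convolution (hF s).locallyIntegrable)
    ((hF s).periodic.convolution _) s']
  simp only [h1.partialDeriv_convolution (hF s).locallyIntegrable s']
  -- By symmetry the convolution passes from `F s` to `Φ`, and the gradient equation removes the
  -- remaining `F s`. Now `Φ` is paired with itself through an odd third derivative of `η`, so each
  -- term of the sum vanishes.
  rw [hΦ.setIntegral_mul_convolution_comm hD (hF s) h2.integrable h2.parity, one_mul,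
    ← hgrad _ (h2.contDiff_convolution hΦ.locallyIntegrable) (hΦ.periodic.convolution _) s]
  simp only [h2.partialDeriv_convolution hΦ.locallyIntegrable s]
  exact hΦ.setIntegral_mul_convolution_self hD h3.integrable fun t => by simpa using h3.parity t

theorem isTestKernel_normed (b : ContDiffBump (0 : EuclideanSpace ℝ (Fin d))) :
    IsTestKernel 1 (b.normed volume) :=
  ⟨b.contDiff_normed, b.hasCompactSupport_normed, fun t => by rw [b.normed_neg, one_mul]⟩

/-- Mollifications of `r` converge almost everywhere and stay bounded by `C`, so `‖f‖ C` dominates.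
Boundedness of `r` makes integrability of `f` sufficient. -/
theorem setIntegral_mul_eq_zero_of_mollified
    {f : EuclideanSpace ℝ (Fin d) → ℝ} (hf : IntegrableOn f D)
    {C : ℝ} (hr : LocallyIntegrable r volume) (hC : ∀ x, ‖r x‖ ≤ C)
    (h : ∀ b : ContDiffBump (0 : EuclideanSpace ℝ (Fin d)),
      ∫ x in D, f x * convolution (b.normed volume) r (ContinuousLinearMap.lsmul ℝ ℝ) volume x = 0) :
    ∫ x in D, f x * r x = 0 := by
  -- The outer radius is twice the inner one, as required by the convergence theorem with `K = 2`.
  let b : ℕ → ContDiffBump (0 : EuclideanSpace ℝ (Fin d)) := fun n =>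
    ⟨1 / ((n : ℝ) + 1), 2 * (1 / ((n : ℝ) + 1)), Nat.one_div_pos_of_nat, by
      have : 0 < 1 / ((n : ℝ) + 1) := Nat.one_div_pos_of_nat
      linarith⟩
  have hb : Filter.Tendsto (fun n => (b n).rOut) Filter.atTop (nhds 0) := by
    have h0 := (tendsto_one_div_add_atTop_nhds_zero_nat (𝕜 := ℝ)).const_mul 2
    rwa [mul_zero] at h0
  have hlim := ContDiffBump.ae_convolution_tendsto_right_of_locallyIntegrable (K := 2) hb
    (Filter.Eventually.of_forall fun n => le_rfl) hr
  have hk : ∀ n, IsTestKernel 1 ((b n).normed volume) := fun n => isTestKernel_normed (b n)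
  have hbd : ∀ n x, ‖convolution ((b n).normed volume) r (ContinuousLinearMap.lsmul ℝ ℝ)
      volume x‖ ≤ C := by
    intro n x
    calc _ ≤ ∫ t, C * (b n).normed volume t := by
          refine norm_integral_le_of_norm_le ((b n).integrable_normed.const_mul C)
            (Filter.Eventually.of_forall fun t => ?_)
          rw [ContinuousLinearMap.lsmul_apply, norm_smul, Real.norm_eq_abs,
            abs_of_nonneg ((b n).nonneg_normed t), mul_comm]
          exact mul_le_mul_of_nonneg_right (hC _) ((b n).nonneg_normed t)
      _ = C := by rw [integral_const_mul, (b n).integral_normed, mul_one]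
  have htend := tendsto_integral_of_dominated_convergence (μ := volume.restrict D)
    (F := fun n x => f x * convolution ((b n).normed volume) r (ContinuousLinearMap.lsmul ℝ ℝ)
      volume x) (f := fun x => f x * r x) (fun x => ‖f x‖ * C)
    (fun n => hf.aestronglyMeasurable.mul
      ((hk n).contDiff_convolution hr).continuous.aestronglyMeasurable)
    (hf.norm.mul_const C)
    (fun n => Filter.Eventually.of_forall fun x => by
      rw [norm_mul]
      exact mul_le_mul_of_nonneg_left (hbd n x) (norm_nonneg _))
    (by
      filter_upwards [ae_restrict_of_ae hlim] with x hx using hx.const_mul (f x))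
  simp only [h] at htend
  exact (tendsto_nhds_unique htend tendsto_const_nhds)

end WeakField

/-! ### The electric force on the mesh. -/

namespace DGMesh

variable {d : ℕ} {Λ : Submodule ℤ (EuclideanSpace ℝ (Fin d))} {M : DGMesh Λ} [Finite M.Cell]
  {F : EuclideanSpace ℝ (Fin d) → EuclideanSpace ℝ (Fin d)} {ρ : M.Broken}

theorem integrableOn_domain {f : EuclideanSpace ℝ (Fin d) → ℝ}
    (hf : ∀ T, IntegrableOn f (M.cell T)) : IntegrableOn f M.domain :=
  integrableOn_finite_iUnion.2 fun T => (hf T).mono_set interior_subset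

theorem isPeriodicL2 (hM : ∀ T, IsCompact (M.cell T)) {f : EuclideanSpace ℝ (Fin d) → ℝ}
    (hf : IsPeriodicFun Λ f) (hi : ∀ T, MemLp f 2 (volume.restrict (M.cell T))) :
    IsPeriodicL2 Λ M.domain f := by
  refine ⟨hf, M.locallyIntegrable_of_isPeriodicFun hf fun T => ?_,
    integrableOn_domain fun T => (hi T).integrable_sq⟩
  have : IsFiniteMeasure (volume.restrict (M.cell T)) := ⟨by simpa using (hM T).measure_lt_top⟩
  exact (hi T).integrable one_le_two

omit [Finite M.Cell] in
theorem cellSum_const_eq {h : EuclideanSpace ℝ (Fin d) → ℝ} (hh : IntegrableOn h M.domain) :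
    M.cellSum (fun _ => h) = ∫ x in M.domain, h x :=
  M.cellSum_eq_setIntegral (fun _ _ _ => rfl) hh

-- The constant `1` is an admissible periodic test function in the gradient equation, and its
-- derivatives vanish.
omit [Finite M.Cell] in
theorem IsElectricField.cellSum_eq_zero (h : M.IsElectricField ρ F) (s : Fin d) :
    M.cellSum (fun _ x => F x s) = 0 := by
  obtain ⟨-, -, Φ, -, -, h⟩ := h
  have h1 := (h (fun _ => 1) contDiff_const fun _ _ _ => rfl).1 s
  simp only [partialDeriv_const, mul_zero, mul_one] at h1
  have h2 : M.cellSum (fun _ x => -F x s) = -M.cellSum (fun _ x => F x s) :=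
    famSum_neg (μ := M.cellMeasure) (f := fun _ x => F x s)
  rw [h2, neg_neg] at h1
  rw [← h1]
  simp [cellSum]

/-- The total electric force on the density `1 - ρ` vanishes. -/
theorem IsElectricField.cellSum_mul_eq_zero (hM : ∀ T, IsCompact (M.cell T))
    (h : M.IsElectricField ρ F) (hρ : ∀ T, Continuous (ρ T)) (s : Fin d) :
    M.cellSum (fun T x => F x s * (1 - ρ T x)) = 0 := by
  obtain ⟨hFp, hF, Φ, hΦp, hΦ, h⟩ := h
  have : Countable Λ := M.countable_periods.to_subtype
  have hD := M.isAddFundamentalDomain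
  have hg : ∀ T, Continuous fun x => 1 - ρ T x := fun T => continuous_const.sub (hρ T)
  obtain ⟨C, hC0, hC⟩ : ∃ C : ℝ, 0 ≤ C ∧ ∀ T, ∀ x ∈ M.cell T, ‖1 - ρ T x‖ ≤ C := by
    choose C hC using fun T => (hM T).exists_bound_of_continuousOn (hg T).continuousOn
    obtain ⟨B, hB⟩ := (Set.finite_range C).bddAbove
    exact ⟨max B 0, le_max_right _ _, fun T x hx =>
      (hC T x hx).trans ((hB ⟨T, rfl⟩).trans (le_max_left _ _))⟩
  -- The broken function `1 - ρ` is extended to a bounded periodic function on `ℝ^d`, so that it can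
  -- be convolved.
  set r := M.periodize fun T x => 1 - ρ T x with hr
  have hrC : ∀ x, ‖r x‖ ≤ C := norm_periodize_le hC0 hC
  have hrm : AEStronglyMeasurable r volume := aestronglyMeasurable_periodize hg
  have hfin : ∀ T, IsFiniteMeasure (volume.restrict (M.cell T)) := fun T =>
    ⟨by simpa using (hM T).measure_lt_top⟩
  have hr2 : IsPeriodicL2 Λ M.domain r := isPeriodicL2 hM (isPeriodicFun_periodize _) fun T =>
    MemLp.of_bound hrm.restrict C (Filter.Eventually.of_forall hrC)
  have hFs : ∀ s T, MemLp (fun x => F x s) 2 (volume.restrict (M.cell T)) := fun s T =>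
    (EuclideanSpace.proj s : EuclideanSpace ℝ (Fin d) →L[ℝ] ℝ).comp_memLp' (hF T)
  have hF2 : ∀ s, IsPeriodicL2 Λ M.domain fun x => F x s := fun s =>
    isPeriodicL2 hM (fun l hl x => by rw [hFp l hl x]) (hFs s)
  have hΦ2 : IsPeriodicL2 Λ M.domain Φ := isPeriodicL2 hM hΦp hΦ
  have hcont : ∀ {f φ : EuclideanSpace ℝ (Fin d) → ℝ}, IsPeriodicL2 Λ M.domain f → Continuous φ →
      IntegrableOn (fun x => f x * φ x) M.domain := fun hf hφ =>
    integrableOn_domain fun T => (hf.locallyIntegrable.integrableOn_isCompact (hM T)).mul_continuousOn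
      hφ.continuousOn (hM T)
  have hpd : ∀ {φ : EuclideanSpace ℝ (Fin d) → ℝ}, ContDiff ℝ ∞ φ → ∀ s,
      Continuous (partialDeriv s φ) := fun hφ s =>
    (hφ.continuous_fderiv (by simp)).clm_apply continuous_const
  have hmain := fun b : ContDiffBump (0 : EuclideanSpace ℝ (Fin d)) =>
    setIntegral_mul_convolution_eq_zero (F := fun s x => F x s) hD hF2 hΦ2 hr2
      (fun φ hφ hφp s => by
        have h1 := (h φ hφ hφp).1 s
        simp only [neg_mul] at h1
        have hi : IntegrableOn (fun x => -(F x s * φ x)) M.domain :=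
          (hcont (hF2 s) hφ.continuous).neg
        rw [cellSum_const_eq (hcont hΦ2 (hpd hφ s)), cellSum_const_eq hi,
          integral_neg, neg_neg] at h1
        exact h1)
      (fun φ hφ hφp => by
        have h1 := (h φ hφ hφp).2
        simp only [neg_mul, Finset.sum_neg_distrib] at h1
        have hi : ∀ s ∈ Finset.univ, IntegrableOn (fun x => F x s * partialDeriv s φ x) M.domain :=
          fun s _ => hcont (hF2 s) (hpd hφ s)
        have hn : IntegrableOn (fun x => -∑ s, F x s * partialDeriv s φ x) M.domain :=
          (integrable_finsetSum _ hi).neg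
        rw [cellSum_const_eq hn, integral_neg, integral_finsetSum _ hi,
          M.cellSum_eq_setIntegral (h := fun x => r x * φ x)
            (fun T x hx => by rw [hr, periodize_of_mem _ hx]) (hcont hr2 hφ.continuous)] at h1
        linarith)
      (isTestKernel_normed b) s
  have hFi : IntegrableOn (fun x => F x s) M.domain :=
    integrableOn_domain fun T => (hFs s T).integrable one_le_two
  rw [M.cellSum_eq_setIntegral (h := fun x => F x s * r x)
    (fun T x hx => by rw [hr, periodize_of_mem _ hx])
    (hFi.mul_bdd hrm.restrict (Filter.Eventually.of_forall hrC))]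
  exact setIntegral_mul_eq_zero_of_mollified hFi hr2.locallyIntegrable hrC hmain

end DGMesh

/-! ### Conservation of the total momentum. -/

section Scheme

open DGMesh

variable {d : ℕ} {Λ : Submodule ℤ (EuclideanSpace ℝ (Fin d))} {Mx : DGMesh Λ}
  {Mv : DGMesh (⊥ : Submodule ℤ (EuclideanSpace ℝ (Fin d)))} {m p q : ℕ} {U : Fin m → Mv.Broken}
  {st : LowRankState Mx Mv m}

/-- Moments of functions in the span of the fixed functions belong to the spatial DG space. -/
theorem LowRankState.isPiecewisePoly_moment (hX : IsSpatialBasis p st.X)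
    (hV : IsVelocityBasis q U st.W) {g : EuclideanSpace ℝ (Fin d) → ℝ}
    (hg : (fun _ v => g v : Mv.Broken) ∈ Submodule.span ℝ (Set.range U)) :
    Mx.IsPiecewisePoly p (st.moment U g) := by
  obtain ⟨c, hc⟩ := exists_coeff_of_mem_span hg
  rw [moment_of_span hV hc]
  exact IsPiecewisePoly.sum (fun a => isPiecewisePoly_K hX _) _

variable [Finite Mx.Cell] (hM : ∀ T, IsCompact (Mx.cell T))

include hM in
/-- One time step conserves the total momentum. -/
theorem IsTimeStep.cellSum_mom_eq {F : EuclideanSpace ℝ (Fin d) → EuclideanSpace ℝ (Fin d)}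
    {τ : ℝ} {st' : LowRankState Mx Mv m} (hX : IsSpatialBasis p st.X)
    (hX' : IsSpatialBasis p st'.X) (hV : IsVelocityBasis q U st.W)
    (hV' : IsVelocityBasis q U st'.W) (hτ : τ ≠ 0) (hF : Mx.IsElectricField (st.rho U) F)
    (hstep : IsTimeStep p q U τ 1 F st st')
    (hU_one : (fun _ _ => 1 : Mv.Broken) ∈ Submodule.span ℝ (Set.range U)) (s : Fin d)
    (hU_coord : (fun _ v => v s : Mv.Broken) ∈ Submodule.span ℝ (Set.range U)) :
    Mx.cellSum (st'.mom U s) = Mx.cellSum (st.mom U s) := by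
  have hρ : ∀ T, Continuous (st.rho U T) :=
    (LowRankState.isPiecewisePoly_moment hX hV hU_one).isSmooth.continuous
  have hj : ∀ T, Continuous (st.mom U s T) :=
    (LowRankState.isPiecewisePoly_moment hX hV hU_coord).isSmooth.continuous
  have hj' : ∀ T, Continuous (st'.mom U s T) :=
    (LowRankState.isPiecewisePoly_moment hX' hV' hU_coord).isSmooth.continuous
  -- With `ψ = 1` the gradient and the jumps of the test function vanish, so the transport term
  -- drops out.
  have h := hstep.momentum_balance hM hF.2.1 hX hV hV' hτ hU_one s hU_coord
    (isPiecewisePoly_const p 1)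
  -- This uses `F ρ = F - F (1 - ρ)`, where both terms on the right have integral zero.
  have h1 : Mx.cellSum (fun T x => F x s * st.rho U T x) = 0 := by
    have h2 := famSum_sub (famIntegrable_field_mul hM hF.2.1 s (g := fun _ _ => 1)
      fun _ => continuous_const) (famIntegrable_field_mul hM hF.2.1 s
        (g := fun T x => 1 - st.rho U T x) fun T => continuous_const.sub (hρ T))
    simp only [← cellSum_eq, mul_one] at h2
    rw [hF.cellSum_eq_zero s, hF.cellSum_mul_eq_zero hM hρ s, sub_zero] at h2
    rw [← h2]
    congr 1
    ext T x
    ring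
  rw [ip_sub_left hM hj' hj fun _ => continuous_const] at h
  simp only [partialDeriv_const, mul_zero, Finset.sum_const_zero, neg_zero, zero_add, mul_one, h1,
    jump, traceMinus, tracePlus, sub_self, ip, add_zero] at h
  have h3 : Mx.faceSum (fun _ _ => 0) = 0 := by simp [faceSum]
  rw [h3, add_zero] at h
  have := (mul_eq_zero.1 h).resolve_left (one_div_ne_zero hτ)
  linarith

end Scheme

theorem mainTheorem2 {d : ℕ} (Λ : Submodule ℤ (EuclideanSpace ℝ (Fin d)))
    [DiscreteTopology Λ] [IsZLattice ℝ Λ]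
    (Mx : DGMesh Λ) [Finite Mx.Cell] (hMx : ∀ T, IsCompact (Mx.cell T))
    (Mv : DGMesh (⊥ : Submodule ℤ (EuclideanSpace ℝ (Fin d))))
    (p q m : ℕ) (hm : 1 + d ≤ m) (U : Fin m → Mv.Broken)
    (hU_one : (fun _ _ => 1 : Mv.Broken) ∈ Submodule.span ℝ (Set.range U))
    (hU_coord : ∀ s : Fin d, (fun _ v => v s : Mv.Broken) ∈ Submodule.span ℝ (Set.range U))
    (τ : ℝ) (hτ : 0 < τ)
    (st : ℕ → LowRankState Mx Mv m)
    (E : ℕ → EuclideanSpace ℝ (Fin d) → EuclideanSpace ℝ (Fin d))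
    (hrun : IsSchemeRun p q U τ 1 st E) :
    (∀ n (s : Fin d), Mx.IsPiecewisePoly p ((st n).mom U s) ∧
      ∀ ψ : Mx.Broken, Mx.IsPiecewisePoly p ψ →
        1 / τ * Mx.ip ((st (n + 1)).mom U s - (st n).mom U s) ψ
        + Mx.cellSum (fun T x =>
            -(∑ s', (st n).sigma U s s' T x * partialDeriv s' (ψ T) x)
              + E n x s * (st n).rho U T x * ψ T x)
        + Mx.faceSum (fun e x =>
            (∑ s', Mx.normal e s' * Mx.avg ((st n).sigma U s s') e x) * Mx.jump ψ e x) = 0) ∧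
    (∀ n (s : Fin d), Mx.cellSum (fun T x => E n x s * (1 - (st n).rho U T x)) = 0) ∧
    (∀ n (s : Fin d), Mx.cellSum ((st n).mom U s) = Mx.cellSum ((st 0).mom U s)) := by
  refine ⟨fun n s => ⟨?_, fun ψ hψ => ?_⟩, fun n s => ?_, fun n s => ?_⟩
  · exact LowRankState.isPiecewisePoly_moment (hrun.spatialBasis n) (hrun.velocityBasis n)
      (hU_coord s)
  · exact (hrun.timeStep n).momentum_balance hMx (hrun.electricField n).2.1 (hrun.spatialBasis n)
      (hrun.velocityBasis n) (hrun.velocityBasis (n + 1)) hτ.ne' hU_one s (hU_coord s) hψ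
  · exact (hrun.electricField n).cellSum_mul_eq_zero hMx
      (LowRankState.isPiecewisePoly_moment (hrun.spatialBasis n) (hrun.velocityBasis n)
        hU_one).isSmooth.continuous s
  · induction n with
    | zero => rfl
    | succ n ih =>
      rw [← ih]
      exact (hrun.timeStep n).cellSum_mom_eq hMx (hrun.spatialBasis n) (hrun.spatialBasis (n + 1))
        (hrun.velocityBasis n) (hrun.velocityBasis (n + 1)) hτ.ne' (hrun.electricField n)
        hU_one s (hU_coord s)
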